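/- **Setting.** Let $\mathcal A\subset\mathbb R^2$ be a (filled) regular polygon with side length $1$, vertices $q_1,\dots,q_{N_0}$ ($N_0\ge 3$, counter-clockwise) and sides $L_i=\overline{q_i,q_{i+1}}$ (with $q_{N_0+1}=q_1$); let $\partial\mathcal A=\bigcup_i L_i$, $\mathcal A^o=\mathcal A\setminus\partial\mathcal A$, and let $\mathscr G$ be the symmetry group of $\mathcal A$ (generated by its $N_0$ rotations and $N_0$ axial symmetries). Let $S$ be a finite set with $\#S\ge N_0$ and, for $i\in S$, let $\Psi_i(x)=\pm\rho_i x+c_i$ with $0<\rho_i<1$, $c_i\in\mathbb R^2$ and $\Psi_i\mathcal A\subset\mathcal A$. Let $K\subset\mathcal A$ be the unique non-empty compact set with $K=\bigcup_{i\in S}\Psi_iK$. For $i\ne j$ in $S$, $\Psi_i,\Psi_j$ are *perfectly touching* if $\Psi_i\mathcal A\cap\Psi_j\mathcal A=\Psi_iL_k=\Psi_jL_{k'}$ for some $k,k'$. The set $K$ is a *perfect polygon carpet* if * (open set condition) $\Psi_i(\mathcal A^o)\cap\Psi_j(\mathcal A^o)=\emptyset$ for all $i\neq j$; * (connectivity)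 $K$ is connected; * (symmetry) $\Gamma\big(\bigcup_{i}\Psi_i\mathcal A\big)=\bigcup_{i}\Psi_i\mathcal A$ for all $\Gamma\in\mathscr G$; * (non-triviality) $\bigcup_{i}\Psi_i\mathcal A\ne\mathcal A$; * (perfectness) any $i\ne j$ in $S$ are joined by a chain of indices in $S$ whose consecutive members are perfectly touching; and for all $i\ne j$ with $\Psi_i\mathcal A\cap\Psi_j\mathcal A\neq\emptyset$, either $\Psi_i,\Psi_j$ are perfectly touching or $\Psi_i\mathcal A\cap\Psi_j\mathcal A=\{\Psi_iq_k\}=\{\Psi_jq_{k'}\}$ for some $k,k'$. For a finite word $w=w_1\cdots w_n$ over $S$ put $\Psi_w=\Psi_{w_1}\circ\cdots\circ\Psi_{w_n}$, $\rho_w=\rho_{w_1}\cdots\rho_{w_n}$, and let $w^-$ be $w$ without its last letter. Let $\rho_*=\min_i\rho_i$, let $d_H$ be the Hausdorff dimension of $K$, let $\Lambda_0$ consist of the empty word, and for $n\ge1$ let $\Lambda_n=\{w:\rho_w\le\rho_*^n<\rho_{w^-}\}$. For $w\ne v$ in $\Lambda_n$ write $w\stackrel n\sim v$ if $\Psi_wK\cap\Psi_vK\ne\emptyset$;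 let $d_n$ be the graph distance of $(\Lambda_n,\stackrel n\sim)$ and $\mathcal N_2^c(w)=\{v\in\Lambda_n:d_n(w,v)>2\}$. For $w\in\Lambda_n$ and $m\ge0$ let $\mathcal B_m(w)=\{v\in\Lambda_{n+m}:\Psi_vK\subset\Psi_wK\}$, and $\mathcal B_m(A)=\bigcup_{w\in A}\mathcal B_m(w)$ for $A\subset\Lambda_n$. For $A\subset\Lambda_n$ and $f:A\to\mathbb R$ let $$\mathcal D_{n,A}(f)=\sum_{\{w,v\}\subset A,\ w\stackrel n\sim v}\big(f(w)-f(v)\big)^2,\qquad \mathcal D_n=\mathcal D_{n,\Lambda_n},\qquad [f]_A=\Big(\sum_{w\in A}\rho_w^{d_H}\Big)^{-1}\sum_{w\in A}\rho_w^{d_H}f(w).$$ For $A,B\subset\Lambda_n$ let $R_n(A,B)=\big(\inf\{\mathcal D_n(f):f|_A=1,\ f|_B=0\}\big)^{-1}\in[0,\infty]$ (so that $R_n(A,B)=0$ if $A\cap B\ne\emptyset$, and $1/0=\infty$). For $m\ge1$ put $$R_m=\inf\big\{R_{n+m}\big(\mathcal B_m(w),\mathcal B_m(\mathcal N_2^c(w))\big):n\ge1,\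 w\in\Lambda_n\big\},$$ $$\sigma_m=\sup\big\{\big([f]_{\mathcal B_m(w)}-[f]_{\mathcal B_m(w')}\big)^2:\ n\ge1,\ w\stackrel n\sim w'\text{ in }\Lambda_n,\ f:\mathcal B_m(\{w,w'\})\to\mathbb R,\ \mathcal D_{n+m,\mathcal B_m(\{w,w'\})}(f)=1\big\}.$$ **Theorem 5.3.** Let $K$ be a perfect polygon carpet. Then condition (B) holds: there is a finite constant $C>0$, which may depend on $K$ and its i.f.s. but not on $m$, such that $$\sigma_m\le C\,R_m\qquad\text{for all } m\ge1 .$$ -/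

import Mathlib

open scoped ENNReal

namespace PolygonCarpet

noncomputable section

/-! ### The polygon

The plane `ℝ²` is `ℂ`. -/

/-- A regular polygon in the plane with `N₀ ≥ 3` vertices and side length `1`, in arbitrary
position. It is given by its center and by the vector from the center to the vertex `0`. -/
structure RegularPolygon (N₀ : ℕ) where
  three_le : 3 ≤ N₀
  center : ℂ
  spoke : ℂ
  side_length : ‖spoke * Complex.exp (2 * Real.pi * Complex.I / N₀) - spoke‖ = 1

namespace RegularPolygon

variable {N₀ : ℕ} (P : RegularPolygon N₀)

/-- The vertices, counter-clockwise; the index `k` only matters modulo `N₀`. -/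
def vertex (k : ℕ) : ℂ :=
  P.center + P.spoke * Complex.exp (2 * Real.pi * Complex.I * k / N₀)

/-- The (filled) polygon `𝒜`. -/
def body : Set ℂ := convexHull ℝ (Set.range fun k : Fin N₀ => P.vertex k)

/-- The side from the vertex `k` to the vertex `k + 1`. -/
def side (k : ℕ) : Set ℂ := segment ℝ (P.vertex k) (P.vertex (k + 1))

/-- The boundary of the polygon, the union of its sides. -/
def boundary : Set ℂ := ⋃ k : Fin N₀, P.side k

/-- The interior of the polygon. -/
def inner : Set ℂ := P.body \ P.boundary

/-- The rotation about the center that takes each vertex `k` to the vertex `k + j`. -/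
def rotation (j : ℕ) (x : ℂ) : ℂ :=
  P.center + Complex.exp (2 * Real.pi * Complex.I * j / N₀) * (x - P.center)

/-- The axial symmetry that exchanges the vertices `a` and `b` whenever `a + b = j` mod `N₀`. -/
def reflection (j : ℕ) (x : ℂ) : ℂ :=
  P.center + P.spoke / (starRingEnd ℂ) P.spoke *
    Complex.exp (2 * Real.pi * Complex.I * j / N₀) * (starRingEnd ℂ) (x - P.center)

/-- Invariance of a set under the symmetry group of the polygon, the dihedral group that consists
of the `N₀` rotations and the `N₀` axial symmetries. -/
def IsSymmetric (X : Set ℂ) : Prop :=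
  ∀ j : Fin N₀, P.rotation j '' X = X ∧ P.reflection j '' X = X

end RegularPolygon

/-! ### The iterated function system and its attractor -/

/-- A finite family of contracting similarities `Ψ i x = ± ρ i * x + c i` of the plane that map a
regular polygon with `N₀` vertices into itself, with at least `N₀` members. -/
structure PolygonIFS (N₀ : ℕ) (S : Type*) [Fintype S] extends RegularPolygon N₀ where
  le_card : N₀ ≤ Fintype.card S
  sign : S → ℝ
  sign_eq : ∀ i, sign i = 1 ∨ sign i = -1
  ratio : S → ℝ
  ratio_pos : ∀ i, 0 < ratio i
  ratio_lt_one : ∀ i, ratio i < 1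
  shift : S → ℂ
  maps_body : ∀ i, (fun x : ℂ => (sign i * ratio i : ℝ) * x + shift i) ''
    toRegularPolygon.body ⊆ toRegularPolygon.body

namespace PolygonIFS

variable {N₀ : ℕ} {S : Type*} [Fintype S] (I : PolygonIFS N₀ S)

/-- The similarity `Ψ i`. -/
def map (i : S) (x : ℂ) : ℂ := (I.sign i * I.ratio i : ℝ) * x + I.shift i

/-- `𝒜`, `⋃ i, Ψ i 𝒜`, `⋃ i j, Ψ i (Ψ j 𝒜)`, and so on. -/
def stage : ℕ → Set ℂ
  | 0 => I.body
  | n + 1 => ⋃ i, I.map i '' stage n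

/-- The attractor `K` of the i.f.s.: see `attractor_spec` and `eq_attractor`, which say that it is
the unique non-empty compact set with `K = ⋃ i, Ψ i K`. -/
def attractor : Set ℂ := ⋂ n, I.stage n

theorem nonempty_index (I : PolygonIFS N₀ S) : Nonempty S :=
  Fintype.card_pos_iff.1 (lt_of_lt_of_le (by have := I.three_le; omega) I.le_card)

theorem abs_sign_mul_ratio (i : S) : |I.sign i * I.ratio i| = I.ratio i := by
  rcases I.sign_eq i with h | h <;> simp [h, abs_of_pos (I.ratio_pos i)]

theorem dist_map (i : S) (x y : ℂ) : dist (I.map i x) (I.map i y) = I.ratio i * dist x y := by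
  have h : I.map i x - I.map i y = ((I.sign i * I.ratio i : ℝ) : ℂ) * (x - y) := by
    simp only [map]; ring
  rw [dist_eq_norm, dist_eq_norm, h, norm_mul, Complex.norm_real, Real.norm_eq_abs,
    I.abs_sign_mul_ratio]

theorem map_injective (i : S) : Function.Injective (I.map i) := by
  intro x y h
  have h1 := I.dist_map i x y
  rw [h, dist_self] at h1
  rcases mul_eq_zero.1 h1.symm with h2 | h2
  · exact absurd h2 (I.ratio_pos i).ne'
  · exact dist_eq_zero.1 h2

theorem continuous_map (i : S) : Continuous (I.map i) := by
  unfold map; fun_prop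

theorem stage_succ_subset (n : ℕ) : I.stage (n + 1) ⊆ I.stage n := by
  induction n with
  | zero => exact Set.iUnion_subset fun i => I.maps_body i
  | succ n ih => exact Set.iUnion_mono fun i => Set.image_mono ih

theorem antitone_stage : Antitone I.stage := antitone_nat_of_succ_le I.stage_succ_subset

theorem isCompact_stage (n : ℕ) : IsCompact (I.stage n) := by
  induction n with
  | zero => exact (Set.finite_range _).isCompact_convexHull ℝ
  | succ n ih => exact isCompact_iUnion fun i => ih.image (I.continuous_map i)

theorem nonempty_stage (n : ℕ) : (I.stage n).Nonempty := by
  have := I.nonempty_index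
  induction n with
  | zero =>
    exact ⟨I.vertex 0, subset_convexHull ℝ _ ⟨⟨0, by have := I.three_le; omega⟩, rfl⟩⟩
  | succ n ih =>
    obtain ⟨x, hx⟩ := ih
    exact ⟨I.map (Classical.arbitrary S) x, Set.mem_iUnion.2 ⟨_, x, hx, rfl⟩⟩

/-- `K ⊆ 𝒜` is compact and non-empty and satisfies `K = ⋃ i, Ψ i K`. -/
theorem attractor_spec : I.attractor ⊆ I.body ∧ IsCompact I.attractor ∧ I.attractor.Nonempty ∧
    I.attractor = ⋃ i, I.map i '' I.attractor := by
  refine ⟨Set.iInter_subset _ 0, ?_, ?_, ?_⟩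
  · exact (I.isCompact_stage 0).of_isClosed_subset
      (isClosed_iInter fun n => (I.isCompact_stage n).isClosed) (Set.iInter_subset _ 0)
  · exact IsCompact.nonempty_iInter_of_sequence_nonempty_isCompact_isClosed _
      I.stage_succ_subset I.nonempty_stage (I.isCompact_stage 0)
      fun n => (I.isCompact_stage n).isClosed
  · apply Set.Subset.antisymm
    · intro x hx
      have h : ∀ n, ∃ i, x ∈ I.map i '' I.stage n := fun n =>
        Set.mem_iUnion.1 (Set.mem_iInter.1 hx (n + 1))
      choose g hg using h
      obtain ⟨i, hi⟩ := Finite.exists_infinite_fiber g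
      have hi2 : (g ⁻¹' {i}).Infinite := Set.infinite_coe_iff.1 hi
      obtain ⟨n0, hn0⟩ := hi2.nonempty
      obtain ⟨y, -, hy⟩ := hg n0
      rw [show g n0 = i from hn0] at hy
      refine Set.mem_iUnion.2 ⟨i, y, Set.mem_iInter.2 fun n => ?_, hy⟩
      obtain ⟨k, hk, hnk⟩ := hi2.exists_gt n
      obtain ⟨z, hz, hzx⟩ := hg k
      rw [show g k = i from hk] at hzx
      have : z = y := I.map_injective i (hzx.trans hy.symm)
      exact I.antitone_stage hnk.le (this ▸ hz)
    · refine Set.iUnion_subset fun i => ?_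
      rintro _ ⟨y, hy, rfl⟩
      refine Set.mem_iInter.2 fun n => I.stage_succ_subset n ?_
      exact Set.mem_iUnion.2 ⟨i, y, Set.mem_iInter.1 hy n, rfl⟩

theorem subset_of_invariant {X Y : Set ℂ} (hX : IsCompact X) (hXne : X.Nonempty)
    (hXeq : X = ⋃ i, I.map i '' X) (hY : IsCompact Y) (hYne : Y.Nonempty)
    (hYeq : Y = ⋃ i, I.map i '' Y) : X ⊆ Y := by
  obtain ⟨x0, hx0, hmax⟩ := hX.exists_isMaxOn hXne (Metric.continuous_infDist_pt Y).continuousOn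
  have hx0' := hx0
  rw [hXeq] at hx0'
  obtain ⟨i, x1, hx1, rfl⟩ := Set.mem_iUnion.1 hx0'
  obtain ⟨y, hy, hyd⟩ := hY.exists_infDist_eq_dist hYne x1
  have hyY : I.map i y ∈ Y := by
    rw [hYeq]; exact Set.mem_iUnion.2 ⟨i, y, hy, rfl⟩
  have h1 : Metric.infDist (I.map i x1) Y ≤ I.ratio i * Metric.infDist x1 Y := by
    rw [hyd, ← I.dist_map]; exact Metric.infDist_le_dist_of_mem hyY
  have h2 : Metric.infDist x1 Y ≤ Metric.infDist (I.map i x1) Y := hmax hx1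
  have h3 : 0 ≤ Metric.infDist x1 Y := Metric.infDist_nonneg
  have h4 : Metric.infDist (I.map i x1) Y ≤ 0 := by
    nlinarith [I.ratio_lt_one i, I.ratio_pos i]
  intro x hx
  have h5 : Metric.infDist x Y = 0 := le_antisymm ((hmax hx).trans h4) Metric.infDist_nonneg
  exact (hY.isClosed.mem_iff_infDist_zero hYne).2 h5

/-- `K` is the only non-empty compact set with `K = ⋃ i, Ψ i K`. -/
theorem eq_attractor {X : Set ℂ} (hX : IsCompact X) (hXne : X.Nonempty)
    (hXeq : X = ⋃ i, I.map i '' X) : X = I.attractor := by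
  obtain ⟨-, hK, hKne, hKeq⟩ := I.attractor_spec
  exact Set.Subset.antisymm (I.subset_of_invariant hX hXne hXeq hK hKne hKeq)
    (I.subset_of_invariant hK hKne hKeq hX hXne hXeq)

/-! ### Perfect polygon carpets -/

/-- `Ψ i`, `Ψ j` are perfectly touching: the two small polygons meet exactly in a common side. -/
def PerfectlyTouching (i j : S) : Prop :=
  i ≠ j ∧ ∃ k k' : Fin N₀,
    I.map i '' I.body ∩ I.map j '' I.body = I.map i '' I.side k ∧
    I.map i '' I.side k = I.map j '' I.side k'

/-- The small polygons meet exactly in a common vertex. -/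
def VertexTouching (i j : S) : Prop :=
  ∃ k k' : Fin N₀,
    I.map i '' I.body ∩ I.map j '' I.body = {I.map i (I.vertex k)} ∧
    I.map i (I.vertex k) = I.map j (I.vertex k')

/-- A perfect i.f.s. -/
structure IsPerfect : Prop where
  chain : ∀ i j : S, i ≠ j → Relation.ReflTransGen I.PerfectlyTouching i j
  touching : ∀ i j : S, i ≠ j → (I.map i '' I.body ∩ I.map j '' I.body).Nonempty →
    I.PerfectlyTouching i j ∨ I.VertexTouching i j

/-- The attractor of the i.f.s. is a polygon carpet. -/
structure IsPolygonCarpet : Prop where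
  open_set : ∀ i j : S, i ≠ j → I.map i '' I.inner ∩ I.map j '' I.inner = ∅
  connected : IsConnected I.attractor
  symmetric : I.IsSymmetric (⋃ i, I.map i '' I.body)
  nontrivial : (⋃ i, I.map i '' I.body) ≠ I.body

/-- The attractor of the i.f.s. is a perfect polygon carpet. -/
structure IsPerfectPolygonCarpet : Prop extends I.IsPolygonCarpet, I.IsPerfect

/-! ### Words, partitions, cells -/

/-- `Ψ w = Ψ w₁ ∘ ⋯ ∘ Ψ wₙ` for a finite word `w`. -/
def wordMap : List S → ℂ → ℂ
  | [] => id
  | i :: w => I.map i ∘ wordMap w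

/-- `ρ w = ρ w₁ ⋯ ρ wₙ`. -/
def wordRatio (w : List S) : ℝ := (w.map I.ratio).prod

/-- `ρ_* = min ρ i`. -/
def minRatio : ℝ := ⨅ i, I.ratio i

/-- The partition `Λ n`: `Λ 0` consists of the empty word, and for `n ≥ 1` it consists of the words
`w` with `ρ w ≤ ρ_* ^ n < ρ w⁻`, where `w⁻` is `w` without its last letter. -/
def levelSet (n : ℕ) : Set (List S) :=
  if n = 0 then {[]} else
    {w | I.wordRatio w ≤ I.minRatio ^ n ∧ I.minRatio ^ n < I.wordRatio w.dropLast}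

theorem minRatio_pos : 0 < I.minRatio := by
  have := I.nonempty_index
  obtain ⟨i, hi⟩ := exists_eq_ciInf_of_finite (f := I.ratio)
  rw [minRatio, ← hi]; exact I.ratio_pos i

theorem levelSet_finite (n : ℕ) : (I.levelSet n).Finite := by
  have := I.nonempty_index
  unfold levelSet
  split_ifs with h0
  · exact Set.finite_singleton _
  obtain ⟨i0, hi0⟩ := Finite.exists_max I.ratio
  obtain ⟨L, hL⟩ := exists_pow_lt_of_lt_one (pow_pos I.minRatio_pos n) (I.ratio_lt_one i0)
  have hle : ∀ w : List S, I.wordRatio w ≤ I.ratio i0 ^ w.length := by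
    intro w
    induction w with
    | nil => simp [wordRatio]
    | cons i w ih =>
      have hnn : 0 ≤ I.wordRatio w := List.prod_nonneg fun a ha => by
        obtain ⟨j, -, rfl⟩ := List.mem_map.1 ha
        exact (I.ratio_pos j).le
      have : I.wordRatio (i :: w) = I.ratio i * I.wordRatio w := by simp [wordRatio]
      rw [this, List.length_cons, pow_succ, mul_comm (I.ratio i0 ^ _)]
      exact mul_le_mul (hi0 i) ih hnn (I.ratio_pos i0).le
  refine (List.finite_length_le S (L + 1)).subset fun w hw => ?_
  by_contra hlen
  have hlen' : L + 1 < w.length := not_le.1 hlen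
  have h1 : L ≤ w.dropLast.length := by rw [List.length_dropLast]; omega
  have h2 := pow_le_pow_of_le_one (I.ratio_pos i0).le (I.ratio_lt_one i0).le h1
  exact absurd (hw.2.trans_le ((hle _).trans h2)) (not_lt.2 hL.le)

/-- The finite set `Λ n`. -/
def level (n : ℕ) : Finset (List S) := (I.levelSet_finite n).toFinset

/-- The cell `Ψ w K`. -/
def cell (w : List S) : Set ℂ := I.wordMap w '' I.attractor

open scoped Classical in
/-- `ℬ_m(A)` for a set `A` of words of `Λ n`: the words of `Λ (n + m)` whose cells are contained in
the cell of some `w ∈ A`. -/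
def subcells (n m : ℕ) (A : Finset (List S)) : Finset (List S) :=
  (I.level (n + m)).filter fun v => ∃ w ∈ A, I.cell v ⊆ I.cell w

/-- The graph on `Λ n`: two distinct words are adjacent if their cells intersect. (Words outside
`Λ n` are isolated vertices.) -/
def graph (n : ℕ) : SimpleGraph (List S) where
  Adj w v := w ≠ v ∧ w ∈ I.level n ∧ v ∈ I.level n ∧ (I.cell w ∩ I.cell v).Nonempty
  symm := ⟨fun _ _ h => ⟨h.1.symm, h.2.2.1, h.2.1, by rw [Set.inter_comm]; exact h.2.2.2⟩⟩
  loopless := ⟨fun _ h => h.1 rfl⟩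

open scoped Classical in
/-- The complement in `Λ n` of the `k`-neighbourhood of `w` for the graph distance. -/
def farLevel (n k : ℕ) (w : List S) : Finset (List S) :=
  (I.level n).filter fun v => ¬ (I.graph n).edist w v ≤ k

/-! ### Energies, resistances and Poincare constants

A function on a subset `A` of `Λ n` is represented by a function on all words, of which only
the values on `A` are used. -/

open scoped Classical in
/-- The energy `𝒟_{n,A}(f)`: the sum of `(f w - f v) ^ 2` over the edges `{w, v}` of the graph on
`Λ n` with both ends in `A`. Each edge counts once, whence the factor `1 / 2`. -/
def energy (n : ℕ) (A : Finset (List S)) (f : List S → ℝ) : ℝ :=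
  (1 / 2) * ∑ w ∈ A, ∑ v ∈ A, if (I.graph n).Adj w v then (f w - f v) ^ 2 else 0

/-- The Hausdorff dimension of `K`. -/
def dimension : ℝ := (dimH I.attractor).toReal

/-- The weighted average of `f` on `A`, with weights `ρ w ^ d_H`. -/
def average (A : Finset (List S)) (f : List S → ℝ) : ℝ :=
  (∑ w ∈ A, I.wordRatio w ^ I.dimension)⁻¹ * ∑ w ∈ A, I.wordRatio w ^ I.dimension * f w

/-- The resistance between `A` and `B` in `Λ n`, with values in `[0, ∞]`. It is `0` if `A` and `B`
intersect, and `∞` if `A` or `B` is empty. -/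
def resistance (n : ℕ) (A B : Finset (List S)) : ℝ≥0∞ :=
  (⨅ (f : List S → ℝ) (_ : ∀ w ∈ A, f w = 1) (_ : ∀ w ∈ B, f w = 0),
    ENNReal.ofReal (I.energy n (I.level n) f))⁻¹

/-- The constant `R_m`. -/
def resistanceConst (m : ℕ) : ℝ≥0∞ :=
  ⨅ (n : ℕ) (_ : 1 ≤ n) (w : List S) (_ : w ∈ I.level n),
    I.resistance (n + m) (I.subcells n m {w}) (I.subcells n m (I.farLevel n 2 w))

open scoped Classical in
/-- The quantity `σ_m(w, w')` for `w`, `w'` in `Λ n`. -/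
def pairConst (n m : ℕ) (w w' : List S) : ℝ≥0∞ :=
  ⨆ (f : List S → ℝ) (_ : I.energy (n + m) (I.subcells n m {w, w'}) f = 1),
    ENNReal.ofReal ((I.average (I.subcells n m {w}) f - I.average (I.subcells n m {w'}) f) ^ 2)

/-- The constant `σ_m`. -/
def neighbourConst (m : ℕ) : ℝ≥0∞ :=
  ⨆ (n : ℕ) (_ : 1 ≤ n) (w : List S) (w' : List S) (_ : (I.graph n).Adj w w'),
    I.pairConst n m w w'

/-- Condition (B): there is a finite `C > 0` with `σ_m ≤ C * R_m` for all `m ≥ 1`. -/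
def ConditionB : Prop :=
  ∃ C : ℝ, 0 < C ∧ ∀ m : ℕ, 1 ≤ m → I.neighbourConst m ≤ ENNReal.ofReal C * I.resistanceConst m

end PolygonIFS

end

end PolygonCarpet

/-!
The polygon is placed in the standard position, with center `0` and a vertex at `1`. All the
similarities have the same ratio `r`, since the small polygons are connected through common sides,
so `Λ n` consists of the words of length `n`, and the averages are arithmetic means. The symmetry
group of the polygon permutes the small polygons (`Carpet.exists_perm`), as a family of tiles that is
connected through common sides is determined by its union (`tiles_eq_of_iUnion_eq`). So if two tiles of
the same level meet in a point, then a symmetry takes the position of the point in one tile to its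
position in the other one (`Carpet.exists_gluing`).

The resistances are estimated by weights of *skeletons*. A skeleton of level `j` is a set of words of
length `j` whose cells form a connected set that is invariant under the symmetries and that meets the
boundary of the polygon. There are three facts about them.

* Any two skeletons of the same level have intersecting cells (`Carpet.IsSkeleton.exists_crossing`). In
  the fundamental sector of the symmetry group, each of them joins a point of the boundary to both
  rays. Depending on the order of the two boundary points, the part of one that goes to the first ray
  crosses the part of the other that goes to the second ray, which is shown with continuous logarithms
  (`inter_nonempty_of_crossing`, `inter_nonempty_of_invariant`).
* A connected set of words of length `n + j` can be folded into the polygon, by removing the first `n`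
  letters and by applying the symmetries. The result is a skeleton, unless all the tiles of level `n`
  that are visited have a common vertex (`Carpet.isSkeleton_fold_or`).
* The words `i :: u`, where `i` is any letter and `u` is a word of a skeleton, form a skeleton
  (`Carpet.IsSkeleton.extend`).

Let `E j` be the smallest possible sum of squares of a weight on the words of length `j` for which each
skeleton has weight at least one. By folding, such a weight gives a potential that separates a cell of
level `n` from the cells that are disjoint from it, so that `R_m ≥ const / E (m - k)` for a fixed `k`
(`Carpet.exists_potential`). Folding also shows that `E (k + j) ≤ const * (#S * r ^ 2) ^ k * E j`, as a
skeleton of level `k + j` visits at least `const * r ^ (-k)` tiles of level `k`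
(`Carpet.exists_hasWeight_add`). Here `#S * r ^ 2 < 1`, by comparing areas. Together,
`1 ≤ const * (#S * r ^ 2) ^ k * E (m - k) * R_m`.

For a function `f` on the words of length `m`, and for each tile of level `k - 1`, the definition of
`E (m - k)` gives a skeleton of level `m - k` along all of whose copies in the subtiles `f` has total
variation at most `const * √(𝒟(f) / E (m - k))`, which is at most `const * √(#S * r ^ 2) ^ k * √(R_m * 𝒟(f))`.
The copies are linked to each other, and to the copies that belong to the subtiles, since skeletons
cross each other. Summing a geometric series, `f` oscillates by at most `const * √(R_m * 𝒟(f))`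
(`Carpet.exists_oscillation_le`). This applies to both cells in the definition of `σ_m`.
-/

set_option linter.unusedSectionVars false

/-! ### Crossing of connected sets in a right triangle -/

namespace PolygonCarpet

/-- An angle that varies continuously in a closed half-plane of directions cannot leave it. -/
theorem angle_stays {g : ℝ → ℝ} (hg : Continuous g) (hc : ∀ s ∈ Set.Icc (0 : ℝ) 1, 0 ≤ Real.cos (g s))
    {s t : ℝ} (hs : s ∈ Set.Icc (0 : ℝ) 1) (ht : t ∈ Set.Icc (0 : ℝ) 1)
    (h0 : |g s| ≤ Real.pi / 2) : |g t| ≤ Real.pi / 2 := by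
  by_contra! h
  have hpi := Real.pi_pos
  have himg : IsPreconnected ((fun x => |g x|) '' Set.Icc (0 : ℝ) 1) :=
    isPreconnected_Icc.image _ (by fun_prop)
  set y := min (|g t|) Real.pi with hy
  have hy1 : Real.pi / 2 < y := lt_min h (by linarith)
  have hmem : y ∈ (fun x => |g x|) '' Set.Icc (0 : ℝ) 1 :=
    himg.ordConnected.out ⟨s, hs, rfl⟩ ⟨t, ht, rfl⟩ ⟨by linarith, min_le_left _ _⟩
  obtain ⟨x, hx, hxy⟩ := hmem
  have h1 := hc x hx
  rw [← Real.cos_abs, show |g x| = y from hxy] at h1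
  have h2 := Real.cos_neg_of_pi_div_two_lt_of_lt hy1
    (by have : y ≤ Real.pi := min_le_right _ _; linarith)
  linarith

/-- Two points of a connected subset `E` of a convex set `Q` are joined by a path in `Q` that stays
`ε`-close to `E`. -/
theorem joinedIn_thickening {E Q : Set ℂ} (hE : IsPreconnected E) (hQ : Convex ℝ Q) (hEQ : E ⊆ Q)
    {ε : ℝ} (hε : 0 < ε) {x y : ℂ} (hx : x ∈ E) (hy : y ∈ E) :
    JoinedIn (Metric.thickening ε E ∩ Q) x y := by
  refine hE.induction₂' (fun a b => JoinedIn (Metric.thickening ε E ∩ Q) a b) ?_ ?_ hx hy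
  · intro a ha
    have : ∀ b ∈ E, dist b a < ε → JoinedIn (Metric.thickening ε E ∩ Q) a b := by
      intro b hb hab
      have hconv : Convex ℝ (Metric.ball a ε ∩ Q) := (convex_ball a ε).inter hQ
      refine JoinedIn.mono ?_ (Set.inter_subset_inter_left Q (Metric.ball_subset_thickening ha ε))
      exact (hconv.isPathConnected ⟨a, Metric.mem_ball_self hε, hEQ ha⟩).joinedIn a
        ⟨Metric.mem_ball_self hε, hEQ ha⟩ b ⟨hab, hEQ hb⟩
    filter_upwards [mem_nhdsWithin_of_mem_nhds (Metric.ball_mem_nhds a hε), self_mem_nhdsWithin]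
      with b hb hbE
    exact ⟨this b hbE hb, (this b hbE hb).symm⟩
  · intro a b c _ _ _ h1 h2
    exact h1.trans h2

/-- A nowhere vanishing continuous function on the plane has a continuous logarithm. -/
theorem exists_continuous_log {H : ℝ × ℝ → ℂ} (hH : Continuous H) (h0 : ∀ p, H p ≠ 0) (l : ℂ)
    (hl : Complex.exp l = H (0, 0)) :
    ∃ L : ℝ × ℝ → ℂ, Continuous L ∧ L (0, 0) = l ∧ ∀ p, Complex.exp (L p) = H p := by
  obtain ⟨F, hF, -⟩ := Complex.isCoveringMap_exp.existsUnique_continuousMap_lifts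
    (f := (⟨fun p => ⟨H p, h0 p⟩, by fun_prop⟩ : C(ℝ × ℝ, {z : ℂ // z ≠ 0}))) (a₀ := (0, 0)) (e₀ := l)
    (by exact Subtype.ext hl)
  refine ⟨F, F.continuous, hF.1, fun p => ?_⟩
  have := congrFun hF.2 p
  exact congrArg Subtype.val this

/-- In the triangle cut out by `re = 0`, `im = δ` and a line through the origin, a connected set
from a point `a` of the side `im = δ` to the side `re = 0` meets a connected set from a point `b` of
`im = δ`, on the left of `a`, to the third side. Otherwise paths close to the two sets are disjoint,
and the difference of their points has an argument that changes by `2 * π` around a square. -/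
theorem inter_nonempty_of_crossing {φ δ : ℝ} (hφ0 : 0 < φ) (hφ : φ < Real.pi / 2) {E F : Set ℂ}
    (hE : IsCompact E) (hF : IsCompact F) (hEc : IsPreconnected E) (hFc : IsPreconnected F)
    (hEQ : E ⊆ {z | 0 ≤ z.re ∧ z.im ≤ δ ∧ z.re * Real.cos φ ≤ z.im * Real.sin φ})
    (hFQ : F ⊆ {z | 0 ≤ z.re ∧ z.im ≤ δ ∧ z.re * Real.cos φ ≤ z.im * Real.sin φ})
    {a e b f : ℂ} (ha : a ∈ E) (he : e ∈ E) (hb : b ∈ F) (hf : f ∈ F) (ha1 : a.im = δ)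
    (he1 : e.re = 0) (hb1 : b.im = δ) (hf1 : f.re * Real.cos φ = f.im * Real.sin φ)
    (hab : b.re < a.re) : (E ∩ F).Nonempty := by
  by_contra hne
  have hdisj : Disjoint E F := Set.disjoint_iff_inter_eq_empty.2 (Set.not_nonempty_iff_eq_empty.1 hne)
  obtain ⟨ε, hε, hd⟩ := hdisj.exists_thickenings hE hF.isClosed
  set Q : Set ℂ := {z | 0 ≤ z.re ∧ z.im ≤ δ ∧ z.re * Real.cos φ ≤ z.im * Real.sin φ} with hQdef
  have hQ : Convex ℝ Q := by
    intro x hx y hy p q hp hq hpq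
    simp only [hQdef, Set.mem_ofPred_eq, Complex.add_re, Complex.add_im, Complex.real_smul,
      Complex.mul_re, Complex.mul_im, Complex.ofReal_re, Complex.ofReal_im, zero_mul, sub_zero,
      add_zero] at hx hy ⊢
    obtain ⟨h1, h2, h3⟩ := hx
    obtain ⟨h4, h5, h6⟩ := hy
    refine ⟨by positivity, ?_, ?_⟩
    · have : δ = p * δ + q * δ := by rw [← add_mul, hpq, one_mul]
      rw [this]; gcongr
    · have h7 := mul_le_mul_of_nonneg_left h3 hp
      have h8 := mul_le_mul_of_nonneg_left h6 hq
      linarith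
  obtain ⟨α, hα⟩ := joinedIn_thickening hEc hQ hEQ hε ha he
  obtain ⟨β, hβ⟩ := joinedIn_thickening hFc hQ hFQ hε hb hf
  have hαm : ∀ s, α.extend s ∈ Metric.thickening ε E ∩ Q := fun s => hα (Set.projIcc 0 1 zero_le_one s)
  have hβm : ∀ s, β.extend s ∈ Metric.thickening ε F ∩ Q := fun s => hβ (Set.projIcc 0 1 zero_le_one s)
  have hH0 : ∀ p : ℝ × ℝ, α.extend p.1 - β.extend p.2 ≠ 0 := by
    intro p h
    exact Set.disjoint_left.1 hd (hαm p.1).1 (sub_eq_zero.1 h ▸ (hβm p.2).1)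
  have hpos : 0 < a.re - b.re := sub_pos.2 hab
  have hlog : Complex.exp ((Real.log (a.re - b.re) : ℝ) : ℂ)
      = α.extend (0 : ℝ × ℝ).1 - β.extend (0 : ℝ × ℝ).2 := by
    rw [← Complex.ofReal_exp, Real.exp_log hpos]
    apply Complex.ext <;> simp [ha1, hb1]
  obtain ⟨L, hL, hL0, hLe⟩ := exists_continuous_log
    (H := fun p => α.extend p.1 - β.extend p.2)
    (by have h1 := α.continuous_extend; have h2 := β.continuous_extend; fun_prop) hH0 _ hlog
  have hre : ∀ p, (α.extend p.1).re - (β.extend p.2).re = Real.exp (L p).re * Real.cos (L p).im := by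
    intro p
    have := congrArg Complex.re (hLe p)
    rw [Complex.exp_re] at this
    simpa using this.symm
  have him : ∀ p, (α.extend p.1).im - (β.extend p.2).im = Real.exp (L p).re * Real.sin (L p).im := by
    intro p
    have := congrArg Complex.im (hLe p)
    rw [Complex.exp_im] at this
    simpa using this.symm
  have hα0 : α.extend 0 = a := by simp
  have hα1 : α.extend 1 = e := by simp
  have hβ0 : β.extend 0 = b := by simp
  have hβ1 : β.extend 1 = f := by simp
  have hexp : ∀ p, 0 < Real.exp (L p).re := fun p => Real.exp_pos _
  have hI0 : (0 : ℝ) ∈ Set.Icc (0 : ℝ) 1 := by simp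
  have hI1 : (1 : ℝ) ∈ Set.Icc (0 : ℝ) 1 := by simp
  have hsinφ : 0 < Real.sin φ := Real.sin_pos_of_pos_of_lt_pi hφ0 (by linarith)
  have hcosφ : 0 < Real.cos φ := Real.cos_pos_of_mem_Ioo ⟨by linarith, hφ⟩
  have hpi := Real.pi_pos
  have hθ0 : (L (0, 0)).im = 0 := by rw [hL0]; exact Complex.ofReal_im _
  -- the edge where the second point is `b`
  have hsin1 : ∀ s, Real.sin (L (s, 0)).im ≤ 0 := by
    intro s
    have h1 := him (s, 0)
    have h2 := (hαm s).2.2.1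
    rw [show (s, (0:ℝ)).1 = s from rfl, show (s, (0:ℝ)).2 = 0 from rfl, hβ0, hb1] at h1
    by_contra! h
    have := mul_pos (hexp (s, 0)) h
    linarith
  have e1 : |(L (1, 0)).im + Real.pi / 2| ≤ Real.pi / 2 := by
    refine angle_stays (g := fun s => (L (s, 0)).im + Real.pi / 2) (by fun_prop) (fun s _ => ?_)
      hI0 hI1 ?_
    · rw [Real.cos_add_pi_div_two]; linarith [hsin1 s]
    · show |(L (0, 0)).im + Real.pi / 2| ≤ _
      rw [hθ0, zero_add, abs_of_pos (by linarith)]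
  -- the edge where the first point is `e`
  have hcos2 : ∀ t, Real.cos (L (1, t)).im ≤ 0 := by
    intro t
    have h1 := hre (1, t)
    have h2 := (hβm t).2.1
    rw [show ((1:ℝ), t).1 = 1 from rfl, show ((1:ℝ), t).2 = t from rfl, hα1, he1] at h1
    by_contra! h
    have := mul_pos (hexp (1, t)) h
    linarith
  have e2 : |(L (1, 1)).im + Real.pi| ≤ Real.pi / 2 := by
    refine angle_stays (g := fun t => (L (1, t)).im + Real.pi) (by fun_prop) (fun t _ => ?_)
      hI0 hI1 ?_
    · rw [Real.cos_add_pi]; linarith [hcos2 t]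
    · show |(L (1, 0)).im + Real.pi| ≤ _
      rw [abs_le] at e1 ⊢
      refine ⟨by linarith [e1.1], ?_⟩
      by_contra! h
      have := Real.cos_pos_of_mem_Ioo (x := (L (1, 0)).im) ⟨by linarith, by linarith [e1.2]⟩
      linarith [hcos2 0]
  -- the edge where the second point is `f`
  have hcos3 : ∀ s, Real.cos ((L (s, 1)).im + φ) ≤ 0 := by
    intro s
    have h1 := hre (s, 1)
    have h3 := him (s, 1)
    have h2 := (hαm s).2.2.2
    rw [show (s, (1:ℝ)).1 = s from rfl, show (s, (1:ℝ)).2 = 1 from rfl, hβ1] at h1 h3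
    by_contra! h
    have := mul_pos (hexp (s, 1)) h
    rw [Real.cos_add] at this
    have h5 : Real.exp (L (s, 1)).re * (Real.cos (L (s, 1)).im * Real.cos φ
        - Real.sin (L (s, 1)).im * Real.sin φ)
        = ((α.extend s).re - f.re) * Real.cos φ - ((α.extend s).im - f.im) * Real.sin φ := by
      rw [h1, h3]; ring
    rw [h5] at this
    linarith
  have e3 : |(L (0, 1)).im + φ + Real.pi| ≤ Real.pi / 2 := by
    refine angle_stays (g := fun s => (L (s, 1)).im + φ + Real.pi) (by fun_prop) (fun s _ => ?_)
      hI1 hI0 ?_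
    · rw [Real.cos_add_pi]; linarith [hcos3 s]
    · show |(L (1, 1)).im + φ + Real.pi| ≤ _
      rw [abs_le] at e2 ⊢
      refine ⟨by linarith [e2.1], ?_⟩
      by_contra! h
      have := Real.cos_pos_of_mem_Ioo (x := (L (1, 1)).im + φ) ⟨by linarith, by linarith [e2.2]⟩
      linarith [hcos3 1]
  -- the edge where the first point is `a`
  have hsin4 : ∀ t, 0 ≤ Real.sin (L (0, t)).im := by
    intro t
    have h1 := him (0, t)
    have h2 := (hβm t).2.2.1
    rw [show ((0:ℝ), t).1 = 0 from rfl, show ((0:ℝ), t).2 = t from rfl, hα0, ha1] at h1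
    by_contra! h
    have := mul_neg_of_pos_of_neg (hexp (0, t)) h
    linarith
  have hc4 : ∀ x : ℝ, Real.cos (x + 3 * Real.pi / 2) = Real.sin x := by
    intro x
    rw [show x + 3 * Real.pi / 2 = (x + Real.pi / 2) + Real.pi by ring, Real.cos_add_pi,
      Real.cos_add_pi_div_two, neg_neg]
  have e4 : |(L (0, 0)).im + 3 * Real.pi / 2| ≤ Real.pi / 2 := by
    refine angle_stays (g := fun t => (L (0, t)).im + 3 * Real.pi / 2) (by fun_prop) (fun t _ => ?_)
      hI1 hI0 ?_
    · rw [hc4]; exact hsin4 t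
    · show |(L (0, 1)).im + 3 * Real.pi / 2| ≤ _
      rw [abs_le] at e3 ⊢
      refine ⟨by linarith [e3.1], ?_⟩
      by_contra! h
      have := Real.sin_neg_of_neg_of_neg_pi_lt (x := (L (0, 1)).im) (by linarith [e3.2]) (by linarith)
      linarith [hsin4 1]
  rw [hθ0, abs_le] at e4
  linarith [e4.2]

end PolygonCarpet

/-! ### The standard regular polygon -/

namespace PolygonCarpet

/-- The point of the unit circle with argument `π * j / N`. The even indices are the vertices of the
standard regular polygon with `N` vertices, the odd ones are the outer normals of its sides. -/
noncomputable def spin (N : ℕ) (j : ℤ) : ℂ := Complex.exp ((Real.pi * j / N : ℝ) * Complex.I)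

/-- The coordinate in the direction `spin N j`. -/
noncomputable def height (N : ℕ) (j : ℤ) : ℂ →ₗ[ℝ] ℝ :=
  Complex.reLm ∘ₗ (LinearMap.mulRight ℝ (spin N (-j)))

/-- The standard regular polygon, inscribed in the unit circle and with a vertex at `1`. -/
def stdBody (N : ℕ) : Set ℂ := convexHull ℝ (Set.range fun k : ℤ => spin N (2 * k))

/-- The side of the standard polygon from the vertex `k` to the vertex `k + 1`. -/
def stdSide (N : ℕ) (k : ℤ) : Set ℂ := segment ℝ (spin N (2 * k)) (spin N (2 * k + 2))

variable {N : ℕ}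

theorem height_apply (j : ℤ) (y : ℂ) : height N j y = (y * spin N (-j)).re := rfl

theorem spin_add (i j : ℤ) : spin N (i + j) = spin N i * spin N j := by
  rw [spin, spin, spin, ← Complex.exp_add]
  congr 1
  push_cast
  ring

@[simp] theorem spin_zero : spin N 0 = 1 := by simp [spin]

theorem spin_ne_zero (j : ℤ) : spin N j ≠ 0 := Complex.exp_ne_zero _

@[simp] theorem norm_spin (j : ℤ) : ‖spin N j‖ = 1 := by
  rw [spin]; exact Complex.norm_exp_ofReal_mul_I _

theorem conj_spin (j : ℤ) : (starRingEnd ℂ) (spin N j) = spin N (-j) := by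
  rw [spin, spin, ← Complex.exp_conj]
  congr 1
  simp only [map_mul, Complex.conj_ofReal, Complex.conj_I]
  push_cast
  ring

theorem spin_mul_neg (j : ℤ) : spin N j * spin N (-j) = 1 := by
  rw [← spin_add]; simp

theorem spin_re (j : ℤ) : (spin N j).re = Real.cos (Real.pi * j / N) := Complex.exp_ofReal_mul_I_re _

theorem spin_im (j : ℤ) : (spin N j).im = Real.sin (Real.pi * j / N) := Complex.exp_ofReal_mul_I_im _

theorem height_spin (i j : ℤ) : height N j (spin N i) = Real.cos (Real.pi * (i - j : ℤ) / N) := by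
  rw [height_apply, ← spin_add, spin_re, sub_eq_add_neg]

theorem spin_natCast (hN : N ≠ 0) : spin N N = -1 := by
  have h : (N : ℝ) ≠ 0 := Nat.cast_ne_zero.2 hN
  rw [spin, Int.cast_natCast, mul_div_assoc, div_self h, mul_one]
  exact Complex.exp_pi_mul_I

theorem spin_eq_iff (hN : N ≠ 0) (i j : ℤ) : spin N i = spin N j ↔ (2 * N : ℤ) ∣ i - j := by
  have h : (N : ℝ) ≠ 0 := Nat.cast_ne_zero.2 hN
  have hc : (N : ℂ) ≠ 0 := Nat.cast_ne_zero.2 hN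
  have hpi : (Real.pi : ℂ) ≠ 0 := Complex.ofReal_ne_zero.2 Real.pi_ne_zero
  rw [spin, spin, Complex.exp_eq_exp_iff_exists_int]
  constructor
  · rintro ⟨n, hn⟩
    refine ⟨n, ?_⟩
    have h1 : ((Real.pi * i / N : ℝ) : ℂ) = (Real.pi * j / N : ℝ) + n * (2 * Real.pi) := by
      have := Complex.I_ne_zero
      apply mul_right_cancel₀ this
      rw [hn]; ring
    have h2 : (Real.pi * i / N : ℝ) = (Real.pi * j / N : ℝ) + n * (2 * Real.pi) := by
      exact_mod_cast h1
    field_simp at h2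
    have h3 : (i : ℝ) = j + 2 * N * n := by linarith
    have h4 : i = j + 2 * N * n := by exact_mod_cast h3
    rw [h4]; ring
  · rintro ⟨n, hn⟩
    refine ⟨n, ?_⟩
    have h4 : i = j + 2 * N * n := by linarith
    rw [h4]
    push_cast
    field_simp

theorem spin_two_mul_eq_iff (hN : N ≠ 0) (i j : ℤ) :
    spin N (2 * i) = spin N (2 * j) ↔ (N : ℤ) ∣ i - j := by
  rw [spin_eq_iff hN, ← mul_sub]
  exact mul_dvd_mul_iff_left two_ne_zero

/-- `cos (π * x / N)` is at most `cos (π * a / N)` when `x` has distance at least `a` from the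
multiples of `2 * N`. -/
theorem cos_le_cos_of_far (hN : N ≠ 0) {x a : ℝ} (ha0 : 0 ≤ a)
    (h : ∀ m : ℤ, a ≤ |x - 2 * N * m|) :
    Real.cos (Real.pi * x / N) ≤ Real.cos (Real.pi * a / N) := by
  have hNp : (0 : ℝ) < N := Nat.cast_pos.2 (Nat.pos_of_ne_zero hN)
  set m := round (x / (2 * N)) with hm
  have h1 := h m
  have h2 : |x - 2 * N * m| ≤ N := by
    have := abs_sub_round (x / (2 * N))
    rw [← hm] at this
    have h3 : x - 2 * N * m = (2 * N) * (x / (2 * N) - m) := by field_simp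
    rw [h3, abs_mul, abs_of_pos (by positivity)]
    nlinarith
  have h3 : Real.cos (Real.pi * x / N) = Real.cos (Real.pi * |x - 2 * N * m| / N) := by
    have h4 : Real.pi * |x - 2 * N * m| / N = |Real.pi * x / N - m * (2 * Real.pi)| := by
      have : Real.pi * x / N - m * (2 * Real.pi) = (Real.pi / N) * (x - 2 * N * m) := by
        field_simp
      rw [this, abs_mul, abs_of_pos (div_pos Real.pi_pos hNp)]
      ring
    rw [h4, Real.cos_abs, Real.cos_sub_int_mul_two_pi]
  rw [h3]
  apply Real.cos_le_cos_of_nonneg_of_le_pi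
  · have := Real.pi_pos; positivity
  · rw [div_le_iff₀ hNp]; exact mul_le_mul_of_nonneg_left h2 Real.pi_pos.le
  · gcongr

theorem cos_lt_cos_of_near (hN : N ≠ 0) {x a : ℝ} (ha : a ≤ N) (h : |x| < a) :
    Real.cos (Real.pi * a / N) < Real.cos (Real.pi * x / N) := by
  have hNp : (0 : ℝ) < N := Nat.cast_pos.2 (Nat.pos_of_ne_zero hN)
  have h1 : Real.cos (Real.pi * x / N) = Real.cos (Real.pi * |x| / N) := by
    rw [← Real.cos_abs, abs_div, abs_mul, abs_of_pos Real.pi_pos, abs_of_pos hNp]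
  rw [h1]
  apply Real.cos_lt_cos_of_nonneg_of_le_pi
  · have := Real.pi_pos; positivity
  · rw [div_le_iff₀ hNp]; exact mul_le_mul_of_nonneg_left ha Real.pi_pos.le
  · have := Real.pi_pos; gcongr

theorem cos_eq_cos_one (hN : N ≠ 0) {j : ℤ}
    (h : Real.cos (Real.pi * j / N) = Real.cos (Real.pi / N)) :
    (2 * N : ℤ) ∣ j - 1 ∨ (2 * N : ℤ) ∣ j + 1 := by
  have hNp : (N : ℝ) ≠ 0 := Nat.cast_ne_zero.2 hN
  have hpi := Real.pi_ne_zero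
  rw [Real.cos_eq_cos_iff] at h
  obtain ⟨k, hk | hk⟩ := h
  · left
    refine ⟨-k, ?_⟩
    field_simp at hk
    have : (1 : ℤ) = 2 * N * k + j := by exact_mod_cast (by linarith : (1 : ℝ) = 2 * N * k + j)
    linarith
  · right
    refine ⟨k, ?_⟩
    field_simp at hk
    have : (1 : ℤ) = 2 * N * k - j := by exact_mod_cast (by linarith : (1 : ℝ) = 2 * N * k - j)
    linarith

theorem cos_odd_le (hN : N ≠ 0) {j : ℤ} (hj : Odd j) :
    Real.cos (Real.pi * j / N) ≤ Real.cos (Real.pi / N) := by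
  have := cos_le_cos_of_far (x := j) (a := 1) hN zero_le_one (fun m => by
    obtain ⟨i, hi⟩ := hj
    have : (1 : ℤ) ≤ |j - 2 * N * m| := by
      apply Int.one_le_abs
      intro h
      have h2 : 2 * i + 1 = 2 * (N * m) := by rw [← hi]; linarith
      omega
    exact_mod_cast this)
  simpa using this

/-- A point of a convex hull where a linear functional is maximal lies in the convex hull of the
generators where it is maximal. -/
theorem mem_convexHull_of_maximal {s : Set ℂ} (f : ℂ →ₗ[ℝ] ℝ) {c : ℝ} (h : ∀ v ∈ s, f v ≤ c) {y : ℂ}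
    (hy : y ∈ convexHull ℝ s) : f y ≤ c ∧ (f y = c → y ∈ convexHull ℝ {v ∈ s | f v = c}) := by
  have hconv : Convex ℝ {y : ℂ | f y ≤ c ∧ (f y = c → y ∈ convexHull ℝ {v ∈ s | f v = c})} := by
    rintro x ⟨hx1, hx2⟩ z ⟨hz1, hz2⟩ p q hp hq hpq
    have e : f (p • x + q • z) = p * f x + q * f z := by
      simp only [map_add, map_smul, smul_eq_mul]
    have hc : c = p * c + q * c := by rw [← add_mul, hpq, one_mul]
    have h1 := mul_le_mul_of_nonneg_left hx1 hp
    have h2 := mul_le_mul_of_nonneg_left hz1 hq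
    refine ⟨by rw [e]; linarith, fun he => ?_⟩
    rw [e] at he
    have h3 : p * f x = p * c := by linarith
    have h4 : q * f z = q * c := by linarith
    rcases hp.eq_or_lt with rfl | hp'
    · have hq1 : q = 1 := by linarith
      subst hq1
      simpa using hz2 (by linarith)
    rcases hq.eq_or_lt with rfl | hq'
    · have hp1 : p = 1 := by linarith
      subst hp1
      simpa using hx2 (by linarith)
    exact convex_convexHull ℝ _ (hx2 (mul_left_cancel₀ hp'.ne' h3)) (hz2 (mul_left_cancel₀ hq'.ne' h4))
      hp hq hpq
  refine convexHull_min (fun v hv => ?_) hconv hy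
  exact ⟨h v hv, fun he => subset_convexHull ℝ _ ⟨hv, he⟩⟩

theorem convex_stdBody : Convex ℝ (stdBody N) := convex_convexHull ℝ _

theorem spin_mem_stdBody (k : ℤ) : spin N (2 * k) ∈ stdBody N := subset_convexHull ℝ _ ⟨k, rfl⟩

theorem stdSide_subset (k : ℤ) : stdSide N k ⊆ stdBody N := by
  apply convex_stdBody.segment_subset (spin_mem_stdBody k)
  rw [show 2 * k + 2 = 2 * (k + 1) by ring]
  exact spin_mem_stdBody _

theorem left_mem_stdSide (k : ℤ) : spin N (2 * k) ∈ stdSide N k := left_mem_segment ℝ _ _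

theorem right_mem_stdSide (k : ℤ) : spin N (2 * k + 2) ∈ stdSide N k := right_mem_segment ℝ _ _

theorem height_le_of_mem_stdBody (hN : N ≠ 0) {y : ℂ} (hy : y ∈ stdBody N) (k : ℤ) :
    height N (2 * k + 1) y ≤ Real.cos (Real.pi / N) := by
  refine (mem_convexHull_of_maximal (height N (2 * k + 1)) ?_ hy).1
  rintro _ ⟨i, rfl⟩
  rw [height_spin]
  exact cos_odd_le hN ⟨i - k - 1, by ring⟩

theorem height_of_mem_stdSide {k : ℤ} {y : ℂ} (hy : y ∈ stdSide N k) :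
    height N (2 * k + 1) y = Real.cos (Real.pi / N) := by
  obtain ⟨p, q, hp, hq, hpq, rfl⟩ := hy
  rw [map_add, map_smul, map_smul, height_spin, height_spin]
  have h1 : Real.cos (Real.pi * (2 * k - (2 * k + 1) : ℤ) / N) = Real.cos (Real.pi / N) := by
    rw [← Real.cos_neg]; congr 1; push_cast; ring
  have h2 : Real.cos (Real.pi * (2 * k + 2 - (2 * k + 1) : ℤ) / N) = Real.cos (Real.pi / N) := by
    congr 1; push_cast; ring
  rw [h1, h2, smul_eq_mul, smul_eq_mul, ← add_mul, hpq, one_mul]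

theorem mem_stdSide_of_height (hN : N ≠ 0) {k : ℤ} {y : ℂ} (hy : y ∈ stdBody N)
    (h : height N (2 * k + 1) y = Real.cos (Real.pi / N)) : y ∈ stdSide N k := by
  have h1 := (mem_convexHull_of_maximal (height N (2 * k + 1)) (c := Real.cos (Real.pi / N)) (by
    rintro _ ⟨i, rfl⟩
    rw [height_spin]
    exact cos_odd_le hN ⟨i - k - 1, by ring⟩) hy).2 h
  rw [stdSide, ← convexHull_pair]
  refine convexHull_mono ?_ h1
  rintro _ ⟨⟨i, rfl⟩, hi⟩
  simp only at hi ⊢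
  rw [height_spin] at hi
  rcases cos_eq_cos_one hN hi with h | h
  · right
    exact (spin_eq_iff hN _ _).2 (by convert h using 1; ring)
  · left
    exact (spin_eq_iff hN _ _).2 (by convert h using 1; ring)

theorem norm_le_of_mem_stdBody {y : ℂ} (hy : y ∈ stdBody N) : ‖y‖ ≤ 1 := by
  have : stdBody N ⊆ Metric.closedBall 0 1 := by
    refine convexHull_min ?_ (convex_closedBall _ _)
    rintro _ ⟨k, rfl⟩
    simp
  simpa using this hy

theorem eq_spin_of_norm_eq_one {y : ℂ} (hy : y ∈ stdBody N) (h : ‖y‖ = 1) :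
    ∃ k : ℤ, y = spin N (2 * k) := by
  let f : ℂ →ₗ[ℝ] ℝ := Complex.reLm ∘ₗ (LinearMap.mulRight ℝ ((starRingEnd ℂ) y))
  have hf : ∀ z, f z = (z * (starRingEnd ℂ) y).re := fun z => rfl
  have h1 := (mem_convexHull_of_maximal f (c := 1) (by
    rintro _ ⟨i, rfl⟩
    rw [hf]
    refine (Complex.re_le_norm _).trans ?_
    simp [h]) hy).2 (by rw [hf, Complex.mul_conj, Complex.ofReal_re, Complex.normSq_eq_norm_sq, h]; norm_num)
  obtain ⟨v, ⟨⟨k, hk⟩, hv⟩⟩ := convexHull_nonempty_iff.1 ⟨y, h1⟩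
  refine ⟨k, ?_⟩
  simp only at hk
  have hvn : ‖v‖ = 1 := by rw [← hk]; simp
  rw [hk]
  rw [hf] at hv
  have h2 : ‖y - v‖ ^ 2 = 0 := by
    rw [← Complex.normSq_eq_norm_sq, Complex.normSq_sub, Complex.normSq_eq_norm_sq,
      Complex.normSq_eq_norm_sq, h, hvn]
    have : (y * (starRingEnd ℂ) v).re = (v * (starRingEnd ℂ) y).re := by
      simp [Complex.mul_re]; ring
    rw [this, hv]; norm_num
  exact sub_eq_zero.1 (norm_eq_zero.1 (pow_eq_zero_iff (two_ne_zero)|>.1 h2))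

theorem isCompact_stdBody (hN : N ≠ 0) : IsCompact (stdBody N) := by
  have : (Set.range fun k : ℤ => spin N (2 * k)) ⊆
      (fun k : ℕ => spin N (2 * k)) '' (Set.Iio N) := by
    rintro _ ⟨k, rfl⟩
    have hpos : (0 : ℤ) < N := by exact_mod_cast Nat.pos_of_ne_zero hN
    refine ⟨(k % N).toNat, ?_, ?_⟩
    · have := Int.emod_lt_of_pos k hpos
      simp only [Set.mem_Iio]; have := Int.emod_nonneg k hpos.ne'; omega
    · simp only
      rw [Int.toNat_of_nonneg (Int.emod_nonneg k hpos.ne'), spin_two_mul_eq_iff hN]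
      exact (Int.mod_modEq k N).symm.dvd
  exact (((Set.finite_Iio N).image _).subset this).isCompact_convexHull ℝ

theorem height_le_norm (j : ℤ) (y : ℂ) : height N j y ≤ ‖y‖ := by
  rw [height_apply]
  refine (Complex.re_le_norm _).trans ?_
  simp

theorem eq_spin_of_height_eq_one {j : ℤ} {y : ℂ} (hy : ‖y‖ ≤ 1) (h : height N j y = 1) :
    y = spin N j := by
  have h2 : ‖y - spin N j‖ ^ 2 ≤ 0 := by
    rw [← Complex.normSq_eq_norm_sq, Complex.normSq_sub, Complex.normSq_eq_norm_sq,
      Complex.normSq_eq_norm_sq, norm_spin, conj_spin, ← height_apply, h]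
    nlinarith [norm_nonneg y]
  have h3 : ‖y - spin N j‖ = 0 := by nlinarith [norm_nonneg (y - spin N j)]
  exact sub_eq_zero.1 (norm_eq_zero.1 h3)

theorem cos_pi_div_pos (hN : 3 ≤ N) : 0 < Real.cos (Real.pi / N) := by
  have hNp : (3 : ℝ) ≤ N := by exact_mod_cast hN
  apply Real.cos_pos_of_mem_Ioo
  have := Real.pi_pos
  constructor
  · have : 0 < Real.pi / N := by positivity
    linarith
  · rw [div_lt_div_iff₀ (by linarith) (by norm_num)]; nlinarith

theorem norm_ge_of_mem_stdSide {k : ℤ} {y : ℂ} (hy : y ∈ stdSide N k) :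
    Real.cos (Real.pi / N) ≤ ‖y‖ := by
  rw [← height_of_mem_stdSide hy]; exact height_le_norm _ _

theorem sum_spin (hN : 2 ≤ N) : ∑ k ∈ Finset.range N, spin N (2 * k) = 0 := by
  have h : ∀ k : ℕ, spin N (2 * k) = (spin N 2) ^ k := by
    intro k
    induction k with
    | zero => simp
    | succ k ih => rw [pow_succ, ← ih, ← spin_add]; rfl
  simp_rw [h]
  have h1 : spin N 2 ≠ 1 := by
    rw [← spin_zero (N := N), Ne, spin_eq_iff (by omega)]
    intro h
    have := Int.le_of_dvd (by norm_num) h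
    omega
  rw [geom_sum_eq h1, ← h]
  have : spin N (2 * N) = spin N 0 := (spin_eq_iff (by omega) _ _).2 (by simp)
  rw [this]; simp

/-- If a tile `ε A + b` is contained in the polygon `A` with `ε = ± 1`, then `b = 0`. -/
theorem eq_zero_of_translate_subset (hN : 3 ≤ N) {ε : ℝ} (hε : ε = 1 ∨ ε = -1) {b : ℂ}
    (h : ∀ k : ℤ, (ε : ℂ) * spin N (2 * k) + b ∈ stdBody N) : b = 0 := by
  have h1 : ∀ k : ℤ, ε * (spin N (2 * k) * (starRingEnd ℂ) b).re * 2 + ‖b‖ ^ 2 ≤ 0 := by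
    intro k
    have h2 := norm_le_of_mem_stdBody (h k)
    have h3 : ‖(ε : ℂ) * spin N (2 * k) + b‖ ^ 2 ≤ 1 := by nlinarith [norm_nonneg ((ε : ℂ) * spin N (2 * k) + b)]
    rw [← Complex.normSq_eq_norm_sq, Complex.normSq_add, Complex.normSq_eq_norm_sq,
      Complex.normSq_eq_norm_sq, norm_mul, norm_spin, Complex.norm_real, mul_assoc,
      Complex.re_ofReal_mul] at h3
    have h4 : ‖ε‖ = 1 := by rcases hε with rfl | rfl <;> simp
    rw [h4] at h3
    linarith
  have h2 := Finset.sum_nonpos (s := Finset.range N) (fun k _ => h1 k)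
  rw [Finset.sum_add_distrib, ← Finset.sum_mul, ← Finset.mul_sum, ← Complex.re_sum, ← Finset.sum_mul] at h2
  rw [sum_spin (by omega)] at h2
  simp only [zero_mul, Complex.zero_re, mul_zero, Finset.sum_const, Finset.card_range, nsmul_eq_mul,
    zero_add] at h2
  have hNp : (0 : ℝ) < N := by exact_mod_cast (by omega : 0 < N)
  have h3 : ‖b‖ ^ 2 ≤ 0 := by by_contra! h; nlinarith
  exact norm_eq_zero.1 (by nlinarith [norm_nonneg b])

/-- The polygon contains a neighbourhood of its center: otherwise a half-plane bounded by a line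
through the center contains it, and as the vertices have sum `0` they are all on that line. -/
theorem exists_ball_subset_stdBody (hN : 3 ≤ N) : ∃ r > 0, Metric.ball (0 : ℂ) r ⊆ stdBody N := by
  have hint : (0 : ℂ) ∈ interior (stdBody N) := by
    by_contra h0
    have hne : (interior (stdBody N)).Nonempty := by
      rw [stdBody, interior_convexHull_nonempty_iff_affineSpan_eq_top]
      rw [← top_le_iff]
      have hN0 : N ≠ 0 := by omega
      set D := affineSpan ℝ (Set.range fun k : ℤ => spin N (2 * k)) with hD
      have hm : ∀ k : ℤ, spin N (2 * k) ∈ D := fun k => subset_affineSpan ℝ _ ⟨k, rfl⟩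
      have hdir : D.direction = ⊤ := by
        rw [← top_le_iff]
        intro z _
        have h1 : spin N 2 - 1 ∈ D.direction := by
          have := AffineSubspace.vsub_mem_direction (hm 1) (hm 0)
          simpa using this
        have h2 : spin N (-2) - 1 ∈ D.direction := by
          have := AffineSubspace.vsub_mem_direction (hm (-1)) (hm 0)
          simpa using this
        have hpi := Real.pi_pos
        have hN3 : (3 : ℝ) ≤ N := by exact_mod_cast hN
        have hang : Real.pi * (2 : ℤ) / N < Real.pi := by
          rw [div_lt_iff₀ (by linarith)]; push_cast; nlinarith
        have hs : 0 < (spin N 2).im := by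
          rw [spin_im]
          exact Real.sin_pos_of_pos_of_lt_pi (by positivity) hang
        have hc : (spin N 2).re < 1 := by
          rw [spin_re, ← Real.cos_zero]
          exact Real.cos_lt_cos_of_nonneg_of_le_pi le_rfl hang.le (by positivity)
        have h3 : spin N (-2) = (starRingEnd ℂ) (spin N 2) := (conj_spin 2).symm
        have e : z = ((z.re / ((spin N 2).re - 1) + z.im / (spin N 2).im) / 2) • (spin N 2 - 1) +
            ((z.re / ((spin N 2).re - 1) - z.im / (spin N 2).im) / 2) • (spin N (-2) - 1) := by
          have : (spin N 2).re - 1 ≠ 0 := by linarith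
          have key : ∀ (w : ℂ) (p q : ℝ), p • (w - 1) + q • ((starRingEnd ℂ) w - 1)
              = ⟨(p + q) * (w.re - 1), (p - q) * w.im⟩ := by
            intro w p q
            apply Complex.ext
            · simp only [Complex.add_re, Complex.smul_re, Complex.sub_re, Complex.conj_re,
                Complex.one_re, smul_eq_mul]
              ring
            · simp only [Complex.add_im, Complex.smul_im, Complex.sub_im, Complex.conj_im,
                Complex.one_im, smul_eq_mul]
              ring
          rw [h3, key]
          apply Complex.ext
          · simp only; field_simp; ring
          · simp only; field_simp; ring
        rw [e]
        exact D.direction.add_mem (D.direction.smul_mem _ h1) (D.direction.smul_mem _ h2)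
      rw [(AffineSubspace.direction_eq_top_iff_of_nonempty ⟨_, hm 0⟩).1 hdir]
    obtain ⟨f, hf⟩ := geometric_hahn_banach_point_open convex_stdBody.interior isOpen_interior h0
    obtain ⟨z, hz⟩ := hne
    have hrot : ∀ k : ℤ, spin N (2 * k) * z ∈ interior (stdBody N) := by
      intro k
      have hsub : (fun y => spin N (2 * k) * y) '' stdBody N ⊆ stdBody N := by
        rw [stdBody, show (fun y => spin N (2 * k) * y) = (LinearMap.mulLeft ℝ (spin N (2 * k))) from rfl,
          LinearMap.image_convexHull]
        refine convexHull_mono ?_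
        rintro _ ⟨_, ⟨i, rfl⟩, rfl⟩
        refine ⟨k + i, ?_⟩
        simp only [LinearMap.mulLeft_apply]
        rw [← spin_add]; ring_nf
      have ho : IsOpenMap (fun y => spin N (2 * k) * y) := (Homeomorph.mulLeft₀ _ (spin_ne_zero _)).isOpenMap
      have := ho.image_interior_subset (stdBody N)
      exact interior_mono hsub (this ⟨z, hz, rfl⟩)
    have hpos : 0 < ∑ k ∈ Finset.range N, f (spin N (2 * k) * z) := by
      refine Finset.sum_pos (fun k _ => ?_) ⟨0, by simp; omega⟩
      have := hf _ (hrot k)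
      rwa [map_zero] at this
    rw [← map_sum, ← Finset.sum_mul, sum_spin (by omega)] at hpos
    simp at hpos
  obtain ⟨r, hr, h⟩ := Metric.isOpen_iff.1 isOpen_interior _ hint
  exact ⟨r, hr, h.trans interior_subset⟩

end PolygonCarpet

/-! ### The symmetry group of the standard polygon -/

namespace PolygonCarpet

variable {N : ℕ}

/-- The symmetry group of the standard polygon, a group of linear isometries since the center of the
polygon is `0`. -/
noncomputable def polygonGroup (N : ℕ) : Subgroup (ℂ ≃ₗᵢ[ℝ] ℂ) where
  carrier := {g | g '' stdBody N = stdBody N}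
  one_mem' := by simp
  mul_mem' := by
    intro a b ha hb
    simp only [Set.mem_ofPred_eq] at ha hb ⊢
    rw [LinearIsometryEquiv.coe_mul, Set.image_comp, hb, ha]
  inv_mem' := by
    intro a ha
    simp only [Set.mem_ofPred_eq] at ha ⊢
    conv_lhs => rw [← ha]
    rw [← Set.image_comp]
    have : (⇑a⁻¹ ∘ ⇑a) = id := by
      ext1 x
      exact a.symm_apply_apply x
    rw [this, Set.image_id]

theorem mem_polygonGroup {g : ℂ ≃ₗᵢ[ℝ] ℂ} : g ∈ polygonGroup N ↔ g '' stdBody N = stdBody N := Iff.rfl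

theorem mem_polygonGroup_of_spin {g : ℂ ≃ₗᵢ[ℝ] ℂ} (h : ∀ k : ℤ, ∃ i : ℤ, g (spin N (2 * k)) = spin N (2 * i))
    (h' : ∀ k : ℤ, ∃ i : ℤ, g (spin N (2 * i)) = spin N (2 * k)) : g ∈ polygonGroup N := by
  rw [mem_polygonGroup, stdBody]
  have : ⇑g = (g.toLinearEquiv : ℂ →ₗ[ℝ] ℂ) := rfl
  rw [this, LinearMap.image_convexHull]
  congr 1
  ext y
  constructor
  · rintro ⟨_, ⟨k, rfl⟩, rfl⟩
    obtain ⟨i, hi⟩ := h k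
    exact ⟨i, hi.symm⟩
  · rintro ⟨k, rfl⟩
    obtain ⟨i, hi⟩ := h' k
    exact ⟨_, ⟨i, rfl⟩, hi⟩

/-- The rotation that takes each vertex `i` to the vertex `i + k`. -/
noncomputable def rot (N : ℕ) (k : ℤ) : ℂ ≃ₗᵢ[ℝ] ℂ :=
  rotation ⟨spin N (2 * k), by simp [Submonoid.unitSphere]⟩

/-- The reflection that exchanges the vertices `a` and `b` whenever `a + b = k`. -/
noncomputable def refl (N : ℕ) (k : ℤ) : ℂ ≃ₗᵢ[ℝ] ℂ :=
  Complex.conjLIE.trans (rot N k)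

@[simp] theorem rot_apply (k : ℤ) (y : ℂ) : rot N k y = spin N (2 * k) * y := rfl

@[simp] theorem refl_apply (k : ℤ) (y : ℂ) : refl N k y = spin N (2 * k) * (starRingEnd ℂ) y := rfl

theorem rot_mem (k : ℤ) : rot N k ∈ polygonGroup N := by
  apply mem_polygonGroup_of_spin
  · intro i
    refine ⟨k + i, ?_⟩
    rw [rot_apply, ← spin_add, mul_add]
  · intro i
    refine ⟨i - k, ?_⟩
    rw [rot_apply, ← spin_add, mul_sub, add_sub_cancel]

theorem refl_mem (k : ℤ) : refl N k ∈ polygonGroup N := by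
  apply mem_polygonGroup_of_spin
  · intro i
    refine ⟨k - i, ?_⟩
    rw [refl_apply, conj_spin, ← spin_add]; ring_nf
  · intro i
    refine ⟨k - i, ?_⟩
    rw [refl_apply, conj_spin, ← spin_add]; ring_nf

theorem eq_rot_or_refl {g : ℂ ≃ₗᵢ[ℝ] ℂ} (hg : g ∈ polygonGroup N) :
    ∃ k : ℤ, g = rot N k ∨ g = refl N k := by
  obtain ⟨a, ha⟩ := linear_isometry_complex g
  have h1 : g 1 = a := by
    rcases ha with rfl | rfl
    · simp
    · show (rotation a) (Complex.conjLIE 1) = a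
      simp
  have h2 : g 1 ∈ stdBody N := by
    rw [mem_polygonGroup] at hg
    rw [← hg]
    exact ⟨1, by simpa using spin_mem_stdBody (N := N) 0, rfl⟩
  obtain ⟨k, hk⟩ := eq_spin_of_norm_eq_one h2 (by rw [g.norm_map]; simp)
  refine ⟨k, ?_⟩
  have h3 : a = ⟨spin N (2 * k), by simp [Submonoid.unitSphere]⟩ := by
    apply Subtype.ext; exact h1.symm.trans hk
  rw [h3] at ha
  exact ha

theorem rot_eq_of_dvd (hN : N ≠ 0) {i k : ℤ} (h : (N : ℤ) ∣ i - k) : rot N i = rot N k := by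
  ext y
  simp only [rot_apply]
  rw [(spin_two_mul_eq_iff hN i k).2 h]

theorem finite_polygonGroup (hN : N ≠ 0) : Finite (polygonGroup N) := by
  have : ((polygonGroup N : Set (ℂ ≃ₗᵢ[ℝ] ℂ))).Finite := by
    refine (((Set.finite_Ico (0 : ℤ) N).image (rot N)).union
      ((Set.finite_Ico (0 : ℤ) N).image (refl N))).subset ?_
    intro g hg
    have hpos : (0 : ℤ) < N := by exact_mod_cast Nat.pos_of_ne_zero hN
    obtain ⟨k, rfl | rfl⟩ := eq_rot_or_refl hg
    · exact Or.inl ⟨k % N, ⟨Int.emod_nonneg k hpos.ne', Int.emod_lt_of_pos k hpos⟩,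
        rot_eq_of_dvd hN (Int.mod_modEq k N).symm.dvd⟩
    · refine Or.inr ⟨k % N, ⟨Int.emod_nonneg k hpos.ne', Int.emod_lt_of_pos k hpos⟩, ?_⟩
      rw [refl, refl, rot_eq_of_dvd hN (Int.mod_modEq k N).symm.dvd]
  exact this.to_subtype

/-- A set of symmetries that contains `1` and is stable under right multiplication by two adjacent
reflections contains the whole group. -/
theorem polygonGroup_induction {P : (ℂ ≃ₗᵢ[ℝ] ℂ) → Prop} (h1 : P 1)
    (h0 : ∀ g ∈ polygonGroup N, P g → P (g * refl N 0)) (h2 : ∀ g ∈ polygonGroup N, P g → P (g * refl N 1))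
    {g : ℂ ≃ₗᵢ[ℝ] ℂ} (hg : g ∈ polygonGroup N) : P g := by
  have hsucc : ∀ k : ℤ, P (rot N k) → P (rot N (k + 1)) := by
    intro k hk
    have := h0 _ (mul_mem (rot_mem k) (refl_mem 1)) (h2 _ (rot_mem k) hk)
    convert! this using 1
    ext y
    simp only [LinearIsometryEquiv.coe_mul, Function.comp_apply, rot_apply, refl_apply]
    simp only [mul_add, spin_add]
    simp
    ring
  have hpred : ∀ k : ℤ, P (rot N k) → P (rot N (k - 1)) := by
    intro k hk
    have := h2 _ (mul_mem (rot_mem k) (refl_mem 0)) (h0 _ (rot_mem k) hk)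
    convert! this using 1
    ext y
    simp only [LinearIsometryEquiv.coe_mul, Function.comp_apply, rot_apply, refl_apply]
    rw [show 2 * (k - 1) = 2 * k + -2 by ring, spin_add]
    simp [conj_spin]
    ring
  have hrot : ∀ k : ℤ, P (rot N k) := by
    intro k
    induction k using Int.induction_on with
    | zero =>
      convert! h1 using 1
      ext y
      simp
    | succ k ih => exact hsucc _ ih
    | pred k ih => exact hpred _ ih
  obtain ⟨k, rfl | rfl⟩ := eq_rot_or_refl hg
  · exact hrot k
  · have := h0 _ (rot_mem k) (hrot k)
    convert! this using 1
    ext y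
    simp

/-- A symmetry takes each side, with its two end points in one of the two orders, to a side. -/
theorem exists_map_stdSide {g : ℂ ≃ₗᵢ[ℝ] ℂ} (hg : g ∈ polygonGroup N) (k : ℤ) :
    ∃ i : ℤ, g '' stdSide N k = stdSide N i := by
  have himg : ∀ a b : ℂ, g '' segment ℝ a b = segment ℝ (g a) (g b) := fun a b =>
    image_segment ℝ (g.toLinearEquiv : ℂ →ₗ[ℝ] ℂ).toAffineMap a b
  obtain ⟨j, rfl | rfl⟩ := eq_rot_or_refl hg
  · refine ⟨j + k, ?_⟩
    rw [stdSide, stdSide, himg, rot_apply, rot_apply, ← spin_add, ← spin_add]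
    ring_nf
  · refine ⟨j - k - 1, ?_⟩
    rw [stdSide, stdSide, himg, refl_apply, refl_apply, conj_spin, conj_spin, ← spin_add, ← spin_add,
      segment_symm]
    ring_nf

/-- The symmetries realize every isometry between two sides. -/
theorem exists_symmetry_of_side (k i : ℤ) {f : ℂ → ℂ} (hf : ∀ a b : ℂ, ∀ p q : ℝ, p + q = 1 →
      f (p • a + q • b) = p • f a + q • f b)
    (h : (f (spin N (2 * k)) = spin N (2 * i) ∧ f (spin N (2 * k + 2)) = spin N (2 * i + 2)) ∨
      (f (spin N (2 * k)) = spin N (2 * i + 2) ∧ f (spin N (2 * k + 2)) = spin N (2 * i))) :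
    ∃ g ∈ polygonGroup N, ∀ z ∈ stdSide N k, f z = g z := by
  have key : ∀ g : ℂ ≃ₗᵢ[ℝ] ℂ, f (spin N (2 * k)) = g (spin N (2 * k)) →
      f (spin N (2 * k + 2)) = g (spin N (2 * k + 2)) → ∀ z ∈ stdSide N k, f z = g z := by
    rintro g h1 h2 z ⟨p, q, -, -, hpq, rfl⟩
    rw [hf _ _ _ _ hpq, h1, h2, map_add, map_smul, map_smul]
  rcases h with ⟨h1, h2⟩ | ⟨h1, h2⟩
  · refine ⟨rot N (i - k), rot_mem _, key _ ?_ ?_⟩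
    · rw [h1, rot_apply, ← spin_add]; ring_nf
    · rw [h2, rot_apply, ← spin_add]; ring_nf
  · refine ⟨refl N (i + k + 1), refl_mem _, key _ ?_ ?_⟩
    · rw [h1, refl_apply, conj_spin, ← spin_add]; ring_nf
    · rw [h2, refl_apply, conj_spin, ← spin_add]; ring_nf

theorem exists_map_spin {g : ℂ ≃ₗᵢ[ℝ] ℂ} (hg : g ∈ polygonGroup N) (k : ℤ) :
    ∃ i : ℤ, g (spin N (2 * k)) = spin N (2 * i) := by
  obtain ⟨j, rfl | rfl⟩ := eq_rot_or_refl hg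
  · exact ⟨j + k, by rw [rot_apply, ← spin_add]; ring_nf⟩
  · exact ⟨j - k, by rw [refl_apply, conj_spin, ← spin_add]; ring_nf⟩

theorem map_mem_stdBody {g : ℂ ≃ₗᵢ[ℝ] ℂ} (hg : g ∈ polygonGroup N) {y : ℂ} (hy : y ∈ stdBody N) :
    g y ∈ stdBody N := by
  rw [← mem_polygonGroup.1 hg]; exact ⟨y, hy, rfl⟩

/-- Symmetries exchange the vertices transitively. -/
theorem exists_spin_to_spin (k i : ℤ) : ∃ g ∈ polygonGroup N, g (spin N (2 * k)) = spin N (2 * i) :=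
  ⟨rot N (i - k), rot_mem _, by rw [rot_apply, ← spin_add]; ring_nf⟩

theorem exists_side_to_side (k i : ℤ) : ∃ g ∈ polygonGroup N, g '' stdSide N k = stdSide N i := by
  have himg : ∀ (g : ℂ ≃ₗᵢ[ℝ] ℂ) (a b : ℂ), g '' segment ℝ a b = segment ℝ (g a) (g b) := fun g a b =>
    image_segment ℝ (g.toLinearEquiv : ℂ →ₗ[ℝ] ℂ).toAffineMap a b
  refine ⟨rot N (i - k), rot_mem _, ?_⟩
  rw [stdSide, stdSide, himg, rot_apply, rot_apply, ← spin_add, ← spin_add]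
  ring_nf

/-! ### Nearest vertices and nearest sides -/

/-- Among the `N` points `spin N (2 * i + b)`, the vertices for `b = 0` and the directions of the
sides for `b = 1`, the one with `i = k` is the strictly nearest one to `y`. -/
def IsNearest (N : ℕ) (b k : ℤ) (y : ℂ) : Prop :=
  ∀ i : ℤ, ¬ (N : ℤ) ∣ i - k → height N (2 * i + b) y < height N (2 * k + b) y

theorem height_congr (hN : N ≠ 0) {i k b : ℤ} (h : (N : ℤ) ∣ i - k) :
    height N (2 * i + b) = height N (2 * k + b) := by
  ext y
  rw [height_apply, height_apply]
  have : spin N (-(2 * i + b)) = spin N (-(2 * k + b)) := by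
    obtain ⟨c, hc⟩ := h
    exact (spin_eq_iff hN _ _).2 ⟨-c, by linear_combination -2 * hc⟩
  rw [this]

theorem IsNearest.congr (hN : N ≠ 0) {b k k' : ℤ} {y : ℂ} (h : IsNearest N b k y)
    (hk : (N : ℤ) ∣ k' - k) : IsNearest N b k' y := by
  intro i hi
  rw [height_congr hN hk]
  refine h i fun h' => hi ?_
  have := dvd_sub h' hk
  simpa using this

theorem IsNearest.unique {b k k' : ℤ} {y : ℂ} (h : IsNearest N b k y) (h' : IsNearest N b k' y) :
    (N : ℤ) ∣ k' - k := by
  by_contra hk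
  have h1 := h k' hk
  have h2 := h' k (fun h3 => hk (by rw [← neg_sub]; exact (dvd_neg).2 h3))
  exact lt_asymm h1 h2

theorem isOpen_isNearest (hN : N ≠ 0) (b k : ℤ) : IsOpen {y | IsNearest N b k y} := by
  have hcont : ∀ j, Continuous (height N j) := fun j => LinearMap.continuous_of_finiteDimensional _
  have : {y | IsNearest N b k y} = ⋂ i ∈ {i ∈ Finset.Ico (0 : ℤ) N | ¬ (N : ℤ) ∣ i - k},
      {y | height N (2 * i + b) y < height N (2 * k + b) y} := by
    ext y
    simp only [Set.mem_ofPred_eq, Set.mem_iInter, Finset.mem_filter]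
    constructor
    · exact fun h i hi => h i hi.2
    · intro h i hi
      have hpos : (0 : ℤ) < N := by exact_mod_cast Nat.pos_of_ne_zero hN
      have hd : (N : ℤ) ∣ i - i % N := (Int.mod_modEq i N).dvd
      rw [height_congr hN hd]
      refine h (i % N) ⟨Finset.mem_Ico.2 ⟨Int.emod_nonneg i hpos.ne', Int.emod_lt_of_pos i hpos⟩, ?_⟩
      intro h'
      apply hi
      have := dvd_add hd h'
      simpa using this
  rw [this]
  exact isOpen_biInter_finset fun i _ => isOpen_lt (hcont _) (hcont _)

/-- Off the rays half-way between them, one of the points is the nearest. -/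
theorem exists_isNearest (hN : 2 ≤ N) (b : ℤ) {y : ℂ}
    (hy : ∀ (r : ℝ) (i : ℤ), 0 ≤ r → y ≠ r * spin N (2 * i + b + 1)) : ∃ k, IsNearest N b k y := by
  have hN0 : N ≠ 0 := by omega
  have hNp : (0 : ℝ) < N := by exact_mod_cast (by omega : 0 < N)
  have hpi := Real.pi_pos
  set t : ℝ := y.arg * N / Real.pi with ht
  have hyt : y = ‖y‖ * Complex.exp ((Real.pi * t / N : ℝ) * Complex.I) := by
    have : Real.pi * t / N = y.arg := by rw [ht]; field_simp
    rw [this]; exact (Complex.norm_mul_exp_arg_mul_I y).symm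
  have hh : ∀ j : ℤ, height N j y = ‖y‖ * Real.cos (Real.pi * (t - j) / N) := by
    intro j
    rw [height_apply]
    conv_lhs => rw [hyt]
    rw [spin, mul_assoc, ← Complex.exp_add, Complex.re_ofReal_mul]
    congr 1
    have : ((Real.pi * t / N : ℝ) : ℂ) * Complex.I + (Real.pi * (-j : ℤ) / N : ℝ) * Complex.I
        = ((Real.pi * (t - j) / N : ℝ) : ℂ) * Complex.I := by push_cast; ring
    rw [this, Complex.exp_ofReal_mul_I_re]
  have hy0 : 0 < ‖y‖ := by
    rw [norm_pos_iff]
    intro h0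
    exact hy 0 0 le_rfl (by simp [h0])
  set k := round ((t - b) / 2) with hk
  have h1 : |t - b - 2 * k| ≤ 1 := by
    have := abs_sub_round ((t - b) / 2)
    rw [← hk] at this
    rw [show t - b - 2 * k = 2 * ((t - b) / 2 - k) by ring, abs_mul, abs_two]
    linarith
  have h2 : |t - b - 2 * k| ≠ 1 := by
    intro h
    have h3 : ∃ i : ℤ, t = ((2 * i + b + 1 : ℤ) : ℝ) := by
      rcases eq_or_eq_neg_of_abs_eq h with h | h
      · exact ⟨k, by push_cast; linarith⟩
      · exact ⟨k - 1, by push_cast; linarith⟩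
    obtain ⟨i, hi⟩ := h3
    refine hy ‖y‖ i (norm_nonneg _) ?_
    rw [hi] at hyt
    exact hyt
  have h3 := lt_of_le_of_ne h1 h2
  refine ⟨k, fun i hi => ?_⟩
  rw [hh, hh]
  apply mul_lt_mul_of_pos_left _ hy0
  refine (cos_le_cos_of_far hN0 (a := 1) zero_le_one fun m => ?_).trans_lt
    (cos_lt_cos_of_near hN0 (by exact_mod_cast (by omega : 1 ≤ N)) ?_)
  · have h4 : (1 : ℝ) ≤ |((k - i - N * m : ℤ) : ℝ)| := by
      have : (1 : ℤ) ≤ |k - i - N * m| := by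
        apply Int.one_le_abs
        intro h
        apply hi
        exact ⟨-m, by linear_combination -h⟩
      exact_mod_cast this
    have h5 : t - ((2 * i + b : ℤ) : ℝ) - 2 * N * m = (t - b - 2 * k) + 2 * ((k - i - N * m : ℤ) : ℝ) := by
      push_cast; ring
    rw [h5]
    have h6 := abs_sub_abs_le_abs_sub (2 * ((k - i - N * m : ℤ) : ℝ)) (-(t - b - 2 * k))
    rw [abs_neg, abs_mul, abs_two, sub_neg_eq_add, add_comm] at h6
    linarith
  · have : t - ((2 * k + b : ℤ) : ℝ) = t - b - 2 * k := by push_cast; ring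
    rw [this]; exact h3

/-- On a connected set that avoids the rays half-way between them, the nearest point is constant. -/
theorem exists_forall_isNearest (hN : 2 ≤ N) (b : ℤ) {C : Set ℂ} (hC : IsPreconnected C)
    (hy : ∀ y ∈ C, ∀ (r : ℝ) (i : ℤ), 0 ≤ r → y ≠ r * spin N (2 * i + b + 1)) :
    ∃ k, ∀ y ∈ C, IsNearest N b k y := by
  have hN0 : N ≠ 0 := by omega
  rcases C.eq_empty_or_nonempty with rfl | ⟨y0, hy0⟩
  · exact ⟨0, by simp⟩
  obtain ⟨k, hk⟩ := exists_isNearest hN b (hy y0 hy0)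
  refine ⟨k, ?_⟩
  have := hC.subset_left_of_subset_union (isOpen_isNearest hN0 b k)
    (isOpen_biUnion (s := {i : ℤ | ¬ (N : ℤ) ∣ i - k}) fun i _ => isOpen_isNearest hN0 b i) ?_ ?_ ⟨y0, hy0, hk⟩
  · exact this
  · rw [Set.disjoint_left]
    intro z hz hz'
    simp only [Set.mem_iUnion] at hz'
    obtain ⟨i, hi, hz'⟩ := hz'
    exact hi (IsNearest.unique hz hz')
  · intro z hz
    obtain ⟨i, hi⟩ := exists_isNearest hN b (hy z hz)
    by_cases h : (N : ℤ) ∣ i - k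
    · exact Or.inl (hi.congr hN0 (by rw [← neg_sub]; exact (dvd_neg).2 h))
    · exact Or.inr (Set.mem_biUnion h hi)

/-- The nearest vertex to a point of a side is one of its end points. -/
theorem IsNearest.of_mem_stdSide_zero (hN : 3 ≤ N) {i k : ℤ} {y : ℂ} (hy : y ∈ stdSide N i)
    (h : IsNearest N 0 k y) : (N : ℤ) ∣ k - i ∨ (N : ℤ) ∣ k - (i + 1) := by
  have hN0 : N ≠ 0 := by omega
  by_contra! hcon
  obtain ⟨h1, h2⟩ := hcon
  have hcos : ∀ j : ℤ, ¬ (N : ℤ) ∣ j → Real.cos (Real.pi * (2 * j : ℤ) / N) ≤ Real.cos (Real.pi * 2 / N) := by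
    intro j hj
    apply cos_le_cos_of_far hN0 (by norm_num)
    intro m
    have : (1 : ℤ) ≤ |j - N * m| := by
      apply Int.one_le_abs
      intro h
      exact hj ⟨m, by linarith⟩
    have h3 : (1 : ℝ) ≤ |((j - N * m : ℤ) : ℝ)| := by exact_mod_cast this
    have h4 : ((2 * j : ℤ) : ℝ) - 2 * N * m = 2 * ((j - N * m : ℤ) : ℝ) := by push_cast; ring
    rw [h4, abs_mul, abs_two]; linarith
  obtain ⟨p, q, hp, hq, hpq, rfl⟩ := hy
  have h3 := h i (fun h' => h1 (by rw [← neg_sub]; exact (dvd_neg).2 h'))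
  simp only [map_add, map_smul, smul_eq_mul, height_spin, add_zero] at h3
  have e1 : (2 * i - 2 * i : ℤ) = 0 := by ring
  have e2 : (2 * i + 2 - 2 * i : ℤ) = 2 := by ring
  have e3 : (2 * i - 2 * k : ℤ) = 2 * (i - k) := by ring
  have e4 : (2 * i + 2 - 2 * k : ℤ) = 2 * (i + 1 - k) := by ring
  rw [e1, e2, e3, e4] at h3
  have h4 := hcos (i - k) (fun h' => h1 (by rw [← neg_sub]; exact (dvd_neg).2 h'))
  have h5 := hcos (i + 1 - k) (fun h' => h2 (by rw [← neg_sub]; exact (dvd_neg).2 h'))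
  have h6 : Real.cos (Real.pi * 2 / N) ≤ 1 := Real.cos_le_one _
  have h7 := mul_le_mul_of_nonneg_left h4 hp
  have h8 := mul_le_mul_of_nonneg_left h5 hq
  have h9 := mul_le_mul_of_nonneg_left h6 hp
  simp only [Int.cast_zero, mul_zero, zero_div, Real.cos_zero, mul_one, Int.cast_ofNat] at h3
  linarith

/-- The nearest side to a point of a side is that side. -/
theorem IsNearest.of_mem_stdSide_one (hN : N ≠ 0) {i k : ℤ} {y : ℂ} (hy : y ∈ stdSide N i)
    (h : IsNearest N 1 k y) : (N : ℤ) ∣ i - k := by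
  by_contra hcon
  have h1 := h i hcon
  rw [height_of_mem_stdSide hy] at h1
  exact absurd h1 (not_lt.2 (height_le_of_mem_stdBody hN (stdSide_subset i hy) k))

theorem stdSide_congr (hN : N ≠ 0) {i k : ℤ} (h : (N : ℤ) ∣ i - k) : stdSide N i = stdSide N k := by
  have h1 := (spin_two_mul_eq_iff hN i k).2 h
  rw [stdSide, stdSide, spin_add, spin_add, h1]

/-- Symmetries permute the vertices and respect the nearest one. -/
theorem IsNearest.map {k : ℤ} {y : ℂ} (h : IsNearest N 0 k y) {g : ℂ ≃ₗᵢ[ℝ] ℂ}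
    (hg : g ∈ polygonGroup N) :
    ∃ k', g (spin N (2 * k)) = spin N (2 * k') ∧ IsNearest N 0 k' (g y) := by
  obtain ⟨j, rfl | rfl⟩ := eq_rot_or_refl hg
  · refine ⟨j + k, by rw [rot_apply, ← spin_add]; ring_nf, fun i hi => ?_⟩
    have := h (i - j) (fun h' => hi (by convert h' using 1; ring))
    have key : ∀ i, height N (2 * i + 0) (rot N j y) = height N (2 * (i - j) + 0) y := by
      intro i
      rw [height_apply, height_apply, rot_apply, mul_comm (spin N _), mul_assoc, ← spin_add]
      ring_nf
    rw [key, key]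
    simpa using this
  · refine ⟨j - k, by rw [refl_apply, conj_spin, ← spin_add]; ring_nf, fun i hi => ?_⟩
    have := h (j - i) (fun h' => hi (by
      rw [← dvd_neg, show -(i - (j - k)) = j - i - k by ring]; exact h'))
    have key : ∀ i, height N (2 * i + 0) (refl N j y) = height N (2 * (j - i) + 0) y := by
      intro i
      rw [height_apply, height_apply, refl_apply, mul_comm (spin N _), mul_assoc, ← spin_add,
        ← Complex.conj_re, map_mul, Complex.conj_conj, conj_spin]
      ring_nf
    rw [key, key]
    simpa using this

end PolygonCarpet

/-! ### The fundamental sector -/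

namespace PolygonCarpet

variable {N : ℕ}

/-- The sector of the unit disk between the directions of the vertex `0` and of the midpoint of the
side `0`, a fundamental domain of the symmetry group. -/
def sector (N : ℕ) : Set ℂ :=
  (fun p : ℝ × ℝ => (p.1 : ℂ) * Complex.exp (p.2 * Complex.I)) '' (Set.Icc 0 1 ×ˢ Set.Icc 0 (Real.pi / N))

theorem isCompact_sector : IsCompact (sector N) :=
  (isCompact_Icc.prod isCompact_Icc).image (by fun_prop)

theorem ofReal_mem_sector {r : ℝ} (h0 : 0 ≤ r) (h1 : r ≤ 1) : (r : ℂ) ∈ sector N :=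
  ⟨(r, 0), ⟨⟨h0, h1⟩, ⟨le_rfl, by have := Real.pi_pos; positivity⟩⟩, by simp⟩

theorem mul_spin_one_mem_sector {r : ℝ} (h0 : 0 ≤ r) (h1 : r ≤ 1) : (r : ℂ) * spin N 1 ∈ sector N :=
  ⟨(r, Real.pi / N), ⟨⟨h0, h1⟩, ⟨by have := Real.pi_pos; positivity, le_rfl⟩⟩, by simp [spin]⟩

/-- Every orbit in the unit disk meets the sector. -/
theorem exists_map_mem_sector (hN : N ≠ 0) {y : ℂ} (hy : ‖y‖ ≤ 1) :
    ∃ g ∈ polygonGroup N, g y ∈ sector N := by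
  have hNp : (0 : ℝ) < N := Nat.cast_pos.2 (Nat.pos_of_ne_zero hN)
  have hpi := Real.pi_pos
  set k := round (y.arg * N / (2 * Real.pi)) with hk
  set θ := y.arg - 2 * Real.pi * k / N with hθ
  have h1 : |θ| ≤ Real.pi / N := by
    have := abs_sub_round (y.arg * N / (2 * Real.pi))
    rw [← hk] at this
    have e : θ = (2 * Real.pi / N) * (y.arg * N / (2 * Real.pi) - k) := by rw [hθ]; field_simp
    rw [e, abs_mul, abs_of_pos (by positivity)]
    calc 2 * Real.pi / N * |y.arg * N / (2 * Real.pi) - k| ≤ 2 * Real.pi / N * (1 / 2) := by gcongr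
      _ = Real.pi / N := by ring
  have h2 : rot N (-k) y = ‖y‖ * Complex.exp (θ * Complex.I) := by
    rw [rot_apply]
    conv_lhs => rw [← Complex.norm_mul_exp_arg_mul_I y]
    rw [mul_left_comm, spin, ← Complex.exp_add, hθ]
    congr 2
    push_cast
    ring
  rcases le_total 0 θ with h | h
  · refine ⟨_, rot_mem (-k), (‖y‖, θ), ⟨⟨norm_nonneg _, hy⟩, ⟨h, (le_abs_self _).trans h1⟩⟩, ?_⟩
    rw [h2]
  · refine ⟨_, mul_mem (refl_mem 0) (rot_mem (-k)), (‖y‖, -θ),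
      ⟨⟨norm_nonneg _, hy⟩, ⟨by simpa using h, (neg_le_abs _).trans h1⟩⟩, ?_⟩
    rw [LinearIsometryEquiv.coe_mul, Function.comp_apply, h2, refl_apply]
    simp [← Complex.exp_conj]

/-- Every orbit meets the sector in at most one point, since its points have the same absolute value
and the same real part of the `N`-th power. -/
theorem eq_of_mem_sector (hN : N ≠ 0) {g : ℂ ≃ₗᵢ[ℝ] ℂ} (hg : g ∈ polygonGroup N) {y : ℂ}
    (hy : y ∈ sector N) (hgy : g y ∈ sector N) : g y = y := by
  have hNp : (0 : ℝ) < N := Nat.cast_pos.2 (Nat.pos_of_ne_zero hN)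
  have hnorm : ‖g y‖ = ‖y‖ := g.norm_map y
  have hpow : ((g y) ^ N).re = (y ^ N).re := by
    have hs : ∀ k : ℤ, spin N (2 * k) ^ N = 1 := by
      intro k
      rw [spin, ← Complex.exp_nat_mul, Complex.exp_eq_one_iff]
      refine ⟨k, ?_⟩
      have : (N : ℂ) ≠ 0 := Nat.cast_ne_zero.2 hN
      push_cast
      field_simp
    obtain ⟨k, rfl | rfl⟩ := eq_rot_or_refl hg
    · rw [rot_apply, mul_pow, hs, one_mul]
    · rw [refl_apply, mul_pow, hs, one_mul, ← map_pow, Complex.conj_re]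
  obtain ⟨⟨r, θ⟩, ⟨⟨hr0, hr1⟩, hθ0, hθ1⟩, rfl⟩ := hy
  obtain ⟨⟨r', θ'⟩, ⟨⟨hr0', hr1'⟩, hθ0', hθ1'⟩, he⟩ := hgy
  simp only at *
  rw [← he] at hnorm hpow ⊢
  rw [norm_mul, norm_mul, Complex.norm_exp_ofReal_mul_I, Complex.norm_exp_ofReal_mul_I, Complex.norm_real,
    Complex.norm_real, mul_one, mul_one, Real.norm_of_nonneg hr0, Real.norm_of_nonneg hr0'] at hnorm
  subst hnorm
  rcases hr0.eq_or_lt with h0 | h0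
  · rw [← h0]; simp
  have hc : ∀ t : ℝ, (((r' : ℂ) * Complex.exp (t * Complex.I)) ^ N).re = r' ^ N * Real.cos (N * t) := by
    intro t
    rw [mul_pow, ← Complex.exp_nat_mul, ← Complex.ofReal_pow, Complex.re_ofReal_mul,
      show (N : ℂ) * (t * Complex.I) = ((N * t : ℝ) : ℂ) * Complex.I by push_cast; ring,
      Complex.exp_ofReal_mul_I_re]
  rw [hc, hc] at hpow
  have h2 := mul_left_cancel₀ (pow_pos h0 N).ne' hpow
  have h3 := Real.injOn_cos (x₁ := N * θ') (x₂ := N * θ)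
    ⟨by positivity, by rw [le_div_iff₀ hNp] at hθ1'; linarith⟩
    ⟨by positivity, by rw [le_div_iff₀ hNp] at hθ1; linarith⟩ h2
  rw [mul_left_cancel₀ hNp.ne' h3]

/-- The part in the sector of the orbit of a connected set is connected. -/
theorem isPreconnected_orbit_inter_sector (hN : N ≠ 0) {C : Set ℂ} (hC : IsPreconnected C)
    (hC1 : ∀ y ∈ C, ‖y‖ ≤ 1) {X : Set ℂ} (hX : ∀ y, y ∈ X ↔ ∃ g ∈ polygonGroup N, g y ∈ C) :
    IsPreconnected (X ∩ sector N) := by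
  have hfin := finite_polygonGroup hN
  rw [isPreconnected_closed_iff]
  intro t t' ht ht' hsub h1 h2
  have hclosed : ∀ s : Set ℂ, IsClosed s →
      IsClosed (⋃ g : polygonGroup N, (g : ℂ ≃ₗᵢ[ℝ] ℂ) '' (sector N ∩ s)) := fun s hs =>
    isClosed_iUnion_of_finite fun g =>
      ((isCompact_sector.inter_right hs).image (g : ℂ ≃ₗᵢ[ℝ] ℂ).continuous).isClosed
  have hmeet : ∀ s : Set ℂ, ((X ∩ sector N) ∩ s).Nonempty →
      (C ∩ ⋃ g : polygonGroup N, (g : ℂ ≃ₗᵢ[ℝ] ℂ) '' (sector N ∩ s)).Nonempty := by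
    rintro s ⟨x, ⟨hxX, hxs⟩, hxt⟩
    obtain ⟨g, hg, hgx⟩ := (hX x).1 hxX
    exact ⟨g x, hgx, Set.mem_iUnion.2 ⟨⟨g, hg⟩, x, ⟨hxs, hxt⟩, rfl⟩⟩
  obtain ⟨c, hc, hct, hct'⟩ := (isPreconnected_closed_iff.1 hC) _ _ (hclosed t ht) (hclosed t' ht')
    (by
      intro c hc
      obtain ⟨g, hg, hgc⟩ := exists_map_mem_sector hN (hC1 c hc)
      have hinv : g⁻¹ (g c) = c := g.symm_apply_apply c
      have hX' : g c ∈ X := (hX _).2 ⟨g⁻¹, inv_mem hg, by rw [hinv]; exact hc⟩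
      rcases hsub ⟨hX', hgc⟩ with h | h
      · exact Or.inl (Set.mem_iUnion.2 ⟨⟨g⁻¹, inv_mem hg⟩, g c, ⟨hgc, h⟩, hinv⟩)
      · exact Or.inr (Set.mem_iUnion.2 ⟨⟨g⁻¹, inv_mem hg⟩, g c, ⟨hgc, h⟩, hinv⟩))
    (hmeet t h1) (hmeet t' h2)
  obtain ⟨⟨g, hg⟩, a, ⟨haΔ, hat⟩, hga⟩ := Set.mem_iUnion.1 hct
  obtain ⟨⟨g', hg'⟩, b, ⟨hbΔ, hbt⟩, hgb⟩ := Set.mem_iUnion.1 hct'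
  simp only at hga hgb
  have hab : (g'⁻¹ * g) a = b := by
    rw [LinearIsometryEquiv.coe_mul, Function.comp_apply, hga, ← hgb]
    exact g'.symm_apply_apply b
  have hab' := eq_of_mem_sector hN (mul_mem (inv_mem hg') hg) haΔ (by rw [hab]; exact hbΔ)
  rw [hab] at hab'
  subst hab'
  exact ⟨b, ⟨(hX _).2 ⟨g, hg, by rw [hga]; exact hc⟩, haΔ⟩, hat, hbt⟩

/-- The orbit of a connected set is connected as soon as it meets the rays through the vertices and
the rays through the midpoints of the sides: the copies of its part in the sector are then linked
across these rays. -/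
theorem isPreconnected_orbit (hN : N ≠ 0) {C : Set ℂ} (hC : IsPreconnected C)
    (hC1 : ∀ y ∈ C, ‖y‖ ≤ 1) {X : Set ℂ} (hX : ∀ y, y ∈ X ↔ ∃ g ∈ polygonGroup N, g y ∈ C)
    {r s : ℝ} {i j : ℤ} (hr : 0 ≤ r) (hs : 0 ≤ s) (hrX : r * spin N (2 * i) ∈ X)
    (hsX : s * spin N (2 * j + 1) ∈ X) : IsPreconnected X := by
  have hΔ := isPreconnected_orbit_inter_sector hN hC hC1 hX
  have hinv : ∀ g ∈ polygonGroup N, ∀ y ∈ X, g y ∈ X := by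
    intro g hg y hy
    obtain ⟨h, hh, hhy⟩ := (hX y).1 hy
    refine (hX _).2 ⟨h * g⁻¹, mul_mem hh (inv_mem hg), ?_⟩
    have : (h * g⁻¹) (g y) = h y := congrArg h (g.symm_apply_apply y)
    rw [this]; exact hhy
  have hX1 : ∀ y ∈ X, ‖y‖ ≤ 1 := by
    intro y hy
    obtain ⟨h, hh, hhy⟩ := (hX y).1 hy
    rw [← h.norm_map]; exact hC1 _ hhy
  have hr1 : (r : ℂ) ∈ X := by
    have := hinv _ (rot_mem (-i)) _ hrX
    rw [rot_apply, mul_left_comm, ← spin_add] at this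
    simpa using this
  have hs1 : (s : ℂ) * spin N 1 ∈ X := by
    have := hinv _ (rot_mem (-j)) _ hsX
    rw [rot_apply, mul_left_comm, ← spin_add] at this
    ring_nf at this
    exact this
  have hrΔ : (r : ℂ) ∈ X ∩ sector N := ⟨hr1, ofReal_mem_sector hr (by
    have := hX1 _ hr1; rwa [Complex.norm_real, Real.norm_of_nonneg hr] at this)⟩
  have hsΔ : (s : ℂ) * spin N 1 ∈ X ∩ sector N := ⟨hs1, mul_spin_one_mem_sector hs (by
    have := hX1 _ hs1; rwa [norm_mul, norm_spin, mul_one, Complex.norm_real, Real.norm_of_nonneg hs] at this)⟩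
  have hsubX : ∀ g ∈ polygonGroup N, g '' (X ∩ sector N) ⊆ X := by
    rintro g hg _ ⟨y, hy, rfl⟩
    exact hinv g hg y hy.1
  have key : ∀ g ∈ polygonGroup N, ∃ t ⊆ X, (r : ℂ) ∈ t ∧ g '' (X ∩ sector N) ⊆ t ∧ IsPreconnected t := by
    intro g hg
    have hstep : ∀ (k : ℤ) (z : ℂ), z ∈ X ∩ sector N → refl N k z = z → ∀ g ∈ polygonGroup N,
        (∃ t ⊆ X, (r : ℂ) ∈ t ∧ g '' (X ∩ sector N) ⊆ t ∧ IsPreconnected t) →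
        ∃ t ⊆ X, (r : ℂ) ∈ t ∧ (g * refl N k) '' (X ∩ sector N) ⊆ t ∧ IsPreconnected t := by
      rintro k z hz hkz g hg ⟨t, htX, hrt, hgt, ht⟩
      refine ⟨t ∪ (g * refl N k) '' (X ∩ sector N),
        Set.union_subset htX (hsubX _ (mul_mem hg (refl_mem k))), Or.inl hrt,
        Set.subset_union_right, ?_⟩
      refine ht.union (g z) (hgt ⟨z, hz, rfl⟩) ⟨z, hz, ?_⟩
        (hΔ.image _ (g * refl N k).continuous.continuousOn)
      rw [LinearIsometryEquiv.coe_mul, Function.comp_apply, hkz]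
    refine polygonGroup_induction (P := fun g => ∃ t ⊆ X, (r : ℂ) ∈ t ∧ g '' (X ∩ sector N) ⊆ t ∧
      IsPreconnected t) ?_ ?_ ?_ hg
    · exact ⟨X ∩ sector N, Set.inter_subset_left, hrΔ, by simp, hΔ⟩
    · exact hstep 0 r hrΔ (by simp)
    · refine hstep 1 _ hsΔ ?_
      rw [refl_apply, map_mul, Complex.conj_ofReal, conj_spin, mul_left_comm, ← spin_add]
      norm_num
  refine isPreconnected_of_forall (r : ℂ) fun y hy => ?_
  obtain ⟨g, hg, hgy⟩ := exists_map_mem_sector hN (hX1 y hy)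
  obtain ⟨t, htX, hrt, hgt, ht⟩ := key g⁻¹ (inv_mem hg)
  exact ⟨t, htX, hrt, hgt ⟨g y, ⟨hinv g hg y hy, hgy⟩, g.symm_apply_apply y⟩, ht⟩

/-- An invariant connected set meets the rays of both types. -/
theorem exists_ray_mem (hN : 3 ≤ N) (b : ℤ) {X : Set ℂ} (hX : IsPreconnected X) (hne : X.Nonempty)
    (hinv : ∀ g ∈ polygonGroup N, ∀ y ∈ X, g y ∈ X) :
    ∃ (r : ℝ) (i : ℤ), 0 ≤ r ∧ r * spin N (2 * i + b + 1) ∈ X := by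
  by_contra! hcon
  obtain ⟨k, hk⟩ := exists_forall_isNearest (by omega) b hX
    (fun y hy r i hr h => hcon r i hr (h ▸ hy))
  obtain ⟨y, hy⟩ := hne
  have h1 := hk y hy
  have h2 := hk _ (hinv _ (rot_mem 1) y hy)
  have h3 : IsNearest N b (k - 1) y := by
    intro i hi
    have := h2 (i + 1) (fun h' => hi (by convert h' using 1; ring))
    have key : ∀ i, height N (2 * i + b) (rot N 1 y) = height N (2 * (i - 1) + b) y := by
      intro i
      rw [height_apply, height_apply, rot_apply, mul_comm (spin N _), mul_assoc, ← spin_add]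
      ring_nf
    rw [key, key] at this
    simpa using this
  have h4 := h3.unique h1
  rw [sub_sub_cancel] at h4
  have := Int.le_of_dvd (by norm_num) h4
  omega

/-- Two invariant connected subsets of the polygon that touch the boundary intersect. Both meet all
three sides of the triangle that is the part of the polygon in the sector. -/
theorem inter_nonempty_of_invariant (hN : 3 ≤ N) {X Y : Set ℂ} (hXc : IsCompact X) (hYc : IsCompact Y)
    (hX : IsPreconnected X) (hY : IsPreconnected Y) (hXA : X ⊆ stdBody N) (hYA : Y ⊆ stdBody N)
    (hXinv : ∀ g ∈ polygonGroup N, ∀ y ∈ X, g y ∈ X) (hYinv : ∀ g ∈ polygonGroup N, ∀ y ∈ Y, g y ∈ Y)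
    (hXb : ∃ k, (X ∩ stdSide N k).Nonempty) (hYb : ∃ k, (Y ∩ stdSide N k).Nonempty) :
    (X ∩ Y).Nonempty := by
  have hN0 : N ≠ 0 := by omega
  have hNp : (3 : ℝ) ≤ N := by exact_mod_cast hN
  have hpi := Real.pi_pos
  set φ := Real.pi / N with hφ
  have hφ0 : 0 < φ := by positivity
  have hφ1 : φ < Real.pi / 2 := by
    rw [hφ, div_lt_div_iff₀ (by linarith) (by norm_num)]; nlinarith
  set δ := Real.cos φ with hδ
  let T : ℂ → ℂ := fun y => Complex.I * (y * spin N (-1))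
  have hTinj : Function.Injective T := by
    intro a b h
    exact mul_right_cancel₀ (spin_ne_zero _) (mul_left_cancel₀ Complex.I_ne_zero h)
  have hTc : Continuous T := by fun_prop
  have hTpol : ∀ r θ : ℝ, (T (r * Complex.exp (θ * Complex.I))).re = r * Real.sin (φ - θ) ∧
      (T (r * Complex.exp (θ * Complex.I))).im = r * Real.cos (φ - θ) := by
    intro r θ
    have : (r : ℂ) * Complex.exp (θ * Complex.I) * spin N (-1) = r * Complex.exp ((-(φ - θ) : ℝ) * Complex.I) := by
      rw [spin, mul_assoc, ← Complex.exp_add, hφ]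
      congr 2
      push_cast
      ring
    simp only [T, this]
    rw [Complex.I_mul_re, Complex.I_mul_im, Complex.im_ofReal_mul, Complex.re_ofReal_mul,
      Complex.exp_ofReal_mul_I_re, Complex.exp_ofReal_mul_I_im, Real.sin_neg, Real.cos_neg]
    constructor <;> ring
  have hTim : ∀ y, (T y).im = height N 1 y := by
    intro y
    simp only [T]
    rw [Complex.I_mul_im, height_apply]
  -- the properties of the part in the sector
  have main : ∀ X : Set ℂ, IsCompact X → IsPreconnected X → X ⊆ stdBody N →
      (∀ g ∈ polygonGroup N, ∀ y ∈ X, g y ∈ X) → (∃ k, (X ∩ stdSide N k).Nonempty) →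
      IsCompact (T '' (X ∩ sector N)) ∧ IsPreconnected (T '' (X ∩ sector N)) ∧
      T '' (X ∩ sector N) ⊆ {z | 0 ≤ z.re ∧ z.im ≤ δ ∧ z.re * Real.cos φ ≤ z.im * Real.sin φ} ∧
      (∃ a ∈ T '' (X ∩ sector N), a.im = δ) ∧ (∃ e ∈ T '' (X ∩ sector N), e.re = 0) ∧
      (∃ f ∈ T '' (X ∩ sector N), f.re * Real.cos φ = f.im * Real.sin φ) := by
    intro X hXc hX hXA hinv hb
    have hX1 : ∀ y ∈ X, ‖y‖ ≤ 1 := fun y hy => norm_le_of_mem_stdBody (hXA hy)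
    obtain ⟨k, z, hzX, hzk⟩ := hb
    refine ⟨(hXc.inter isCompact_sector).image hTc, ?_, ?_, ?_, ?_, ?_⟩
    · refine (isPreconnected_orbit_inter_sector hN0 hX hX1 (X := X) fun y => ?_).image _ hTc.continuousOn
      constructor
      · exact fun hy => ⟨1, one_mem _, hy⟩
      · rintro ⟨g, hg, hgy⟩
        have := hinv g⁻¹ (inv_mem hg) _ hgy
        rwa [show g⁻¹ (g y) = y from g.symm_apply_apply y] at this
    · rintro _ ⟨y, ⟨hyX, hyΔ⟩, rfl⟩
      refine ⟨?_, ?_, ?_⟩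
      · obtain ⟨⟨r, θ⟩, ⟨⟨hr0, hr1⟩, hθ0, hθ1⟩, rfl⟩ := hyΔ
        rw [(hTpol r θ).1]
        exact mul_nonneg hr0 (Real.sin_nonneg_of_nonneg_of_le_pi (by linarith) (by simp only at hθ0; linarith))
      · rw [hTim]
        simpa using height_le_of_mem_stdBody hN0 (hXA hyX) 0
      · obtain ⟨⟨r, θ⟩, ⟨⟨hr0, hr1⟩, hθ0, hθ1⟩, rfl⟩ := hyΔ
        simp only at hr0 hr1 hθ0 hθ1
        rw [(hTpol r θ).1, (hTpol r θ).2]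
        have h1 : 0 ≤ Real.sin (φ - (φ - θ)) :=
          Real.sin_nonneg_of_nonneg_of_le_pi (by linarith) (by linarith)
        rw [Real.sin_sub] at h1
        have := mul_nonneg hr0 h1
        nlinarith
    · obtain ⟨g, hg, hgz⟩ := exists_map_mem_sector hN0 (hX1 z hzX)
      obtain ⟨i, hi⟩ := exists_map_stdSide hg k
      refine ⟨_, ⟨g z, ⟨hinv g hg z hzX, hgz⟩, rfl⟩, ?_⟩
      have h1 : height N (2 * i + 1) (g z) = δ := height_of_mem_stdSide (hi ▸ ⟨z, hzk, rfl⟩)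
      rw [hTim]
      refine le_antisymm (by simpa using height_le_of_mem_stdBody hN0 (hXA (hinv g hg z hzX)) 0) ?_
      rw [← h1]
      obtain ⟨⟨r, θ⟩, ⟨⟨hr0, hr1⟩, hθ0, hθ1⟩, he⟩ := hgz
      simp only at hr0 hr1 hθ0 hθ1 he
      have hh : ∀ j : ℤ, height N j (g z) = r * Real.cos (Real.pi * (θ * N / Real.pi - j) / N) := by
        intro j
        rw [height_apply, ← he, spin, mul_assoc, ← Complex.exp_add, Complex.re_ofReal_mul]
        congr 1
        have : (θ : ℂ) * Complex.I + (Real.pi * (-j : ℤ) / N : ℝ) * Complex.I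
            = ((Real.pi * (θ * N / Real.pi - j) / N : ℝ) : ℂ) * Complex.I := by
          have h1 : (N : ℂ) ≠ 0 := Nat.cast_ne_zero.2 hN0
          have h2 : (Real.pi : ℂ) ≠ 0 := Complex.ofReal_ne_zero.2 hpi.ne'
          push_cast
          field_simp
          ring
        rw [this, Complex.exp_ofReal_mul_I_re]
      rw [hh, hh]
      refine mul_le_mul_of_nonneg_left ?_ hr0
      set t := θ * N / Real.pi with ht
      have ht0 : 0 ≤ t := by positivity
      have ht1 : t ≤ 1 := by
        rw [ht, div_le_one hpi]; rw [le_div_iff₀ (by linarith)] at hθ1; exact hθ1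
      have e1 : Real.cos (Real.pi * (t - (1 : ℤ)) / N) = Real.cos (Real.pi * (1 - t) / N) := by
        rw [← Real.cos_neg]; congr 1; push_cast; ring
      rw [e1]
      refine cos_le_cos_of_far hN0 (by linarith) fun m => ?_
      have h2 : 1 ≤ i + N * m + 1 ∨ i + N * m + 1 ≤ 0 := by omega
      rcases h2 with h2 | h2
      · have h3 : (1 : ℝ) ≤ i + N * m + 1 := by exact_mod_cast h2
        refine le_trans ?_ (neg_le_abs _)
        push_cast; linarith
      · have h3 : (i : ℝ) + N * m + 1 ≤ 0 := by exact_mod_cast h2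
        refine le_trans ?_ (le_abs_self _)
        push_cast; linarith
    · obtain ⟨r, i, hr, hri⟩ := exists_ray_mem hN 0 hX ⟨z, hzX⟩ hinv
      have h1 := hinv _ (rot_mem (-i)) _ hri
      rw [rot_apply, mul_left_comm, ← spin_add, show 2 * -i + (2 * i + 0 + 1) = 1 by ring] at h1
      have hr1 : r ≤ 1 := by
        have := hX1 _ h1
        rwa [norm_mul, norm_spin, mul_one, Complex.norm_real, Real.norm_of_nonneg hr] at this
      refine ⟨_, ⟨_, ⟨h1, mul_spin_one_mem_sector hr hr1⟩, rfl⟩, ?_⟩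
      simp only [T]
      rw [mul_assoc, spin_mul_neg]
      simp
    · obtain ⟨r, i, hr, hri⟩ := exists_ray_mem hN (-1) hX ⟨z, hzX⟩ hinv
      have h1 := hinv _ (rot_mem (-i)) _ hri
      rw [rot_apply, mul_left_comm, ← spin_add, show 2 * -i + (2 * i + -1 + 1) = 0 by ring, spin_zero,
        mul_one] at h1
      have hr1 : r ≤ 1 := by
        have := hX1 _ h1
        rwa [Complex.norm_real, Real.norm_of_nonneg hr] at this
      refine ⟨_, ⟨_, ⟨h1, ofReal_mem_sector hr hr1⟩, rfl⟩, ?_⟩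
      have := hTpol r 0
      rw [Complex.ofReal_zero, zero_mul, Complex.exp_zero, mul_one, sub_zero] at this
      rw [this.1, this.2]
      ring
  obtain ⟨c1, c2, c3, ⟨a, ha, ha1⟩, ⟨e, he, he1⟩, ⟨f, hf, hf1⟩⟩ := main X hXc hX hXA hXinv hXb
  obtain ⟨d1, d2, d3, ⟨a', ha', ha1'⟩, ⟨e', he', he1'⟩, ⟨f', hf', hf1'⟩⟩ := main Y hYc hY hYA hYinv hYb
  have hTXY : (T '' (X ∩ sector N) ∩ T '' (Y ∩ sector N)).Nonempty := by
    rcases lt_trichotomy a.re a'.re with h | h | h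
    · rw [Set.inter_comm]
      exact inter_nonempty_of_crossing hφ0 hφ1 d1 c1 d2 c2 d3 c3 ha' he' ha hf ha1' he1' ha1 hf1 h
    · have : a = a' := Complex.ext h (ha1.trans ha1'.symm)
      exact ⟨a, ha, this ▸ ha'⟩
    · exact inter_nonempty_of_crossing hφ0 hφ1 c1 d1 c2 d2 c3 d3 ha he ha' hf' ha1 he1 ha1' hf1' h
  obtain ⟨_, ⟨x, hx, rfl⟩, ⟨y, hy, hxy⟩⟩ := hTXY
  rw [hTinj hxy] at hy
  exact ⟨x, hx.1, hy.1⟩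

end PolygonCarpet

/-! ### Tiles -/

namespace PolygonCarpet

variable {N : ℕ} {r : ℝ} {f f' : ℂ → ℂ}

/-- A similarity `y ↦ ± r * y + b`; a tile is the image of the standard polygon under such a map. -/
def IsTile (r : ℝ) (f : ℂ → ℂ) : Prop :=
  ∃ (ε : ℝ) (b : ℂ), (ε = 1 ∨ ε = -1) ∧ ∀ y, f y = (ε : ℂ) * r * y + b

/-- The tiles of `f` and `f'` meet exactly in a common side. -/
def SideTouching (N : ℕ) (f f' : ℂ → ℂ) : Prop :=
  ∃ k k' : ℤ, f '' stdBody N ∩ f' '' stdBody N = f '' stdSide N k ∧ f '' stdSide N k = f' '' stdSide N k'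

/-- The tiles of `f` and `f'` meet exactly in a common vertex. -/
def CornerTouching (N : ℕ) (f f' : ℂ → ℂ) : Prop :=
  ∃ k k' : ℤ, f '' stdBody N ∩ f' '' stdBody N = {f (spin N (2 * k))} ∧
    f (spin N (2 * k)) = f' (spin N (2 * k'))

theorem IsTile.injective (hf : IsTile r f) (hr : 0 < r) : Function.Injective f := by
  obtain ⟨ε, b, hε, h⟩ := hf
  intro x y hxy
  rw [h, h] at hxy
  have h1 : (ε : ℂ) * r ≠ 0 := by
    rcases hε with rfl | rfl <;> simp [hr.ne']
  exact mul_left_cancel₀ h1 (add_right_cancel hxy)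

theorem IsTile.continuous (hf : IsTile r f) : Continuous f := by
  obtain ⟨ε, b, hε, h⟩ := hf
  rw [show f = fun y => (ε : ℂ) * r * y + b from funext h]
  fun_prop

theorem IsTile.dist_eq (hf : IsTile r f) (hr : 0 < r) (x y : ℂ) : dist (f x) (f y) = r * dist x y := by
  obtain ⟨ε, b, hε, h⟩ := hf
  rw [h, h, dist_add_right, dist_eq_norm, ← mul_sub, norm_mul, norm_mul, dist_eq_norm]
  have h1 : ‖(ε : ℂ)‖ = 1 := by rcases hε with rfl | rfl <;> simp
  rw [h1, one_mul, Complex.norm_real, Real.norm_of_nonneg hr.le]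

theorem IsTile.combo (hf : IsTile r f) {p q : ℝ} (hpq : p + q = 1) (x y : ℂ) :
    f (p • x + q • y) = p • f x + q • f y := by
  obtain ⟨ε, b, hε, h⟩ := hf
  rw [h, h, h]
  simp only [Complex.real_smul]
  have : (p : ℂ) + q = 1 := by exact_mod_cast hpq
  linear_combination -b * this

theorem IsTile.image_segment (hf : IsTile r f) (x y : ℂ) :
    f '' segment ℝ x y = segment ℝ (f x) (f y) := by
  ext z
  constructor
  · rintro ⟨_, ⟨p, q, hp, hq, hpq, rfl⟩, rfl⟩
    exact ⟨p, q, hp, hq, hpq, (hf.combo hpq _ _).symm⟩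
  · rintro ⟨p, q, hp, hq, hpq, rfl⟩
    exact ⟨_, ⟨p, q, hp, hq, hpq, rfl⟩, hf.combo hpq _ _⟩

theorem IsTile.comp {r' : ℝ} (hf : IsTile r f) (hf' : IsTile r' f') : IsTile (r * r') (f ∘ f') := by
  obtain ⟨ε, b, hε, h⟩ := hf
  obtain ⟨ε', b', hε', h'⟩ := hf'
  refine ⟨ε * ε', (ε : ℂ) * r * b' + b, ?_, fun y => ?_⟩
  · rcases hε with rfl | rfl <;> rcases hε' with rfl | rfl <;> norm_num
  · simp only [Function.comp_apply, h, h']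
    push_cast
    ring

/-- In the direction of the side `k`, a tile is seen like the polygon in the direction `2 * k + 1 - c`,
where `c = 0` or `c = N` according to the sign of the similarity. -/
theorem IsTile.exists_shift (hN : N ≠ 0) (hf : IsTile r f) :
    ∃ (c : ℤ) (b : ℂ), (c = 0 ∨ c = N) ∧ (∀ y, f y = spin N c * r * y + b) ∧
      ∀ j y, height N j (f y) = r * height N (j - c) y + height N j b := by
  obtain ⟨ε, b, hε, h⟩ := hf
  have h1 : ∃ c : ℤ, (c = 0 ∨ c = N) ∧ (ε : ℂ) = spin N c := by
    rcases hε with rfl | rfl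
    · exact ⟨0, Or.inl rfl, by simp⟩
    · exact ⟨N, Or.inr rfl, by rw [spin_natCast hN]; simp⟩
  obtain ⟨c, hc, hcε⟩ := h1
  refine ⟨c, b, hc, fun y => by rw [h, hcε], fun j y => ?_⟩
  rw [h, map_add, hcε, height_apply j, height_apply (j - c)]
  rw [← Complex.re_ofReal_mul]
  congr 2
  rw [show -(j - c) = c + -j by ring, spin_add]
  ring

/-- How a tile in the polygon touches a side of the polygon: with the side `i` if `2 * k + 1 - c` is
the odd number `2 * i + 1`, and with the vertex `i` if it is the even number `2 * i`. -/
theorem touching_side_cases (hN : 3 ≤ N) (hr : 0 < r) {c : ℤ} {b : ℂ}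
    (hh : ∀ j y, height N j (f y) = r * height N (j - c) y + height N j b)
    (hfA : f '' stdBody N ⊆ stdBody N) {k : ℤ} {y₀ : ℂ} (hy₀ : y₀ ∈ stdBody N) (hy : f y₀ ∈ stdSide N k) :
    (∀ i, 2 * k + 1 - c = 2 * i + 1 → y₀ ∈ stdSide N i ∧ f '' stdSide N i ⊆ stdSide N k) ∧
    (∀ i, 2 * k + 1 - c = 2 * i → y₀ = spin N (2 * i)) := by
  have hN0 : N ≠ 0 := by omega
  have hmax : ∀ y ∈ stdBody N, height N (2 * k + 1 - c) y ≤ height N (2 * k + 1 - c) y₀ := by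
    intro y hy'
    have h1 := height_le_of_mem_stdBody hN0 (hfA ⟨y, hy', rfl⟩) k
    rw [← height_of_mem_stdSide hy, hh, hh] at h1
    have : r * height N (2 * k + 1 - c) y ≤ r * height N (2 * k + 1 - c) y₀ := by linarith
    exact le_of_mul_le_mul_left this hr
  constructor
  · intro i hi
    have h2 := hmax _ (stdSide_subset i (left_mem_stdSide i))
    rw [hi, height_of_mem_stdSide (left_mem_stdSide i)] at h2
    have h3 := le_antisymm (height_le_of_mem_stdBody hN0 hy₀ i) h2
    refine ⟨mem_stdSide_of_height hN0 hy₀ h3, ?_⟩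
    rintro _ ⟨y, hyi, rfl⟩
    refine mem_stdSide_of_height hN0 (hfA ⟨y, stdSide_subset i hyi, rfl⟩) ?_
    rw [← height_of_mem_stdSide hy, hh, hh, hi, h3, height_of_mem_stdSide hyi]
  · intro i hi
    have h2 := hmax _ (spin_mem_stdBody i)
    rw [hi, height_spin] at h2
    simp only [sub_self, Int.cast_zero, mul_zero, zero_div, Real.cos_zero] at h2
    have h3 := norm_le_of_mem_stdBody hy₀
    exact eq_spin_of_height_eq_one h3 (le_antisymm ((height_le_norm _ _).trans h3) h2)

/-- A tile in the polygon meets a side of the polygon in nothing, in a side, or in a vertex. -/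
theorem IsTile.inter_stdSide (hN : 3 ≤ N) (hr : 0 < r) (hf : IsTile r f)
    (hfA : f '' stdBody N ⊆ stdBody N) (k : ℤ) :
    (f '' stdBody N ∩ stdSide N k = ∅) ∨ (∃ i, f '' stdBody N ∩ stdSide N k = f '' stdSide N i) ∨
      (∃ i, f '' stdBody N ∩ stdSide N k = {f (spin N (2 * i))}) := by
  obtain ⟨c, b, hc, -, hh⟩ := hf.exists_shift (N := N) (by omega)
  rcases (f '' stdBody N ∩ stdSide N k).eq_empty_or_nonempty with h | ⟨_, ⟨y₀, hy₀, rfl⟩, hyk⟩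
  · exact Or.inl h
  right
  rcases Int.even_or_odd' (2 * k + 1 - c) with ⟨i, hi | hi⟩
  · right
    refine ⟨i, Set.Subset.antisymm ?_ ?_⟩
    · rintro _ ⟨⟨y, hyA, rfl⟩, hy⟩
      rw [(touching_side_cases hN hr hh hfA hyA hy).2 i hi]
      rfl
    · rintro _ rfl
      rw [← (touching_side_cases hN hr hh hfA hy₀ hyk).2 i hi]
      exact ⟨⟨y₀, hy₀, rfl⟩, hyk⟩
  · left
    refine ⟨i, Set.Subset.antisymm ?_ ?_⟩
    · rintro _ ⟨⟨y, hyA, rfl⟩, hy⟩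
      exact ⟨y, ((touching_side_cases hN hr hh hfA hyA hy).1 i hi).1, rfl⟩
    · exact Set.subset_inter (Set.image_mono (stdSide_subset i))
        ((touching_side_cases hN hr hh hfA hy₀ hyk).1 i hi).2

/-- A vertex of the polygon that lies in a tile is a vertex of the tile. -/
theorem IsTile.eq_spin_of_map_eq_spin (hN : 3 ≤ N) (hr : 0 < r) (hf : IsTile r f)
    (hfA : f '' stdBody N ⊆ stdBody N) {k : ℤ} {y₀ : ℂ} (hy₀ : y₀ ∈ stdBody N)
    (hy : f y₀ = spin N (2 * k)) : ∃ i, y₀ = spin N (2 * i) := by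
  have hN0 : N ≠ 0 := by omega
  have hinj := hf.injective hr
  obtain ⟨c, b, hc, -, hh⟩ := hf.exists_shift hN0
  have h1 : ∀ y ∈ stdBody N, f y ∈ stdBody N := fun y hy => hfA ⟨y, hy, rfl⟩
  have hmax : ∀ y ∈ stdBody N, height N (2 * k - c) y ≤ height N (2 * k - c) y₀ := by
    intro y hy'
    have h2 := (height_le_norm (N := N) (2 * k) (f y)).trans (norm_le_of_mem_stdBody (h1 y hy'))
    have h3 : height N (2 * k) (f y₀) = 1 := by rw [hy, height_spin]; simp
    rw [← h3, hh, hh] at h2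
    have : r * height N (2 * k - c) y ≤ r * height N (2 * k - c) y₀ := by linarith
    exact le_of_mul_le_mul_left this hr
  rcases Int.even_or_odd' (2 * k - c) with ⟨i, hi | hi⟩
  · refine ⟨i, ?_⟩
    have h2 := hmax _ (spin_mem_stdBody i)
    rw [hi, height_spin] at h2
    simp only [sub_self, Int.cast_zero, mul_zero, zero_div, Real.cos_zero] at h2
    have h3 := norm_le_of_mem_stdBody hy₀
    exact eq_spin_of_height_eq_one h3 (le_antisymm ((height_le_norm _ _).trans h3) h2)
  · -- a whole side of the tile would be mapped to the vertex
    exfalso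
    have hside : ∀ y ∈ stdSide N i, f y = spin N (2 * k) := by
      intro y hyi
      apply eq_spin_of_height_eq_one (norm_le_of_mem_stdBody (h1 y (stdSide_subset i hyi)))
      refine le_antisymm ((height_le_norm _ _).trans (norm_le_of_mem_stdBody (h1 y (stdSide_subset i hyi)))) ?_
      have h3 : height N (2 * k) (f y₀) = 1 := by rw [hy, height_spin]; simp
      rw [← h3, hh, hh, hi, height_of_mem_stdSide hyi]
      have := mul_le_mul_of_nonneg_left (height_le_of_mem_stdBody hN0 hy₀ i) hr.le
      linarith
    have h4 := hinj ((hside _ (left_mem_stdSide i)).trans (hside _ (right_mem_stdSide i)).symm)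
    rw [spin_eq_iff hN0] at h4
    have := Int.le_of_dvd (by norm_num) ((dvd_neg).2 h4)
    omega

/-- A tile in the polygon that contains the vertex `0` has a side on the side `0`: if it only had a
vertex there, then it would touch the side `-1` with a different vertex. -/
theorem IsTile.exists_side_of_corner (hN : 3 ≤ N) (hr : 0 < r) (hf : IsTile r f)
    (hfA : f '' stdBody N ⊆ stdBody N) (h : spin N 0 ∈ f '' stdBody N) :
    ∃ i, f '' stdSide N i ⊆ stdSide N 0 := by
  have hN0 : N ≠ 0 := by omega
  obtain ⟨c, b, hc, -, hh⟩ := hf.exists_shift hN0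
  obtain ⟨y₀, hy₀, hy⟩ := h
  have h1 : f y₀ ∈ stdSide N 0 := by rw [hy]; exact left_mem_stdSide 0
  have h2 : f y₀ ∈ stdSide N (-1) := by rw [hy]; exact right_mem_stdSide (-1)
  rcases Int.even_or_odd' (2 * 0 + 1 - c) with ⟨i, hi | hi⟩
  · have h3 := (touching_side_cases hN hr hh hfA hy₀ h1).2 i hi
    have h4 := (touching_side_cases hN hr hh hfA hy₀ h2).2 (i - 1) (by linarith)
    rw [h3, spin_two_mul_eq_iff hN0] at h4
    have := Int.le_of_dvd (by norm_num) h4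
    omega
  · exact ⟨i, ((touching_side_cases hN hr hh hfA hy₀ h1).1 i hi).2⟩

theorem segment_eq_cases {a b c d : ℂ} (h : segment ℝ a b = segment ℝ c d) (hd : dist a b = dist c d)
    (hcd : c ≠ d) : (a = c ∧ b = d) ∨ (a = d ∧ b = c) := by
  obtain ⟨p, q, hp, hq, hpq, ha⟩ : a ∈ segment ℝ c d := h ▸ left_mem_segment ℝ a b
  obtain ⟨p', q', hp', hq', hpq', hb⟩ : b ∈ segment ℝ c d := h ▸ right_mem_segment ℝ a b
  have e : a - b = (p - p') • (c - d) := by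
    rw [← ha, ← hb]
    have h1 : q = 1 - p := by linarith
    have h2 : q' = 1 - p' := by linarith
    subst h1 h2
    module
  rw [dist_eq_norm, e, norm_smul, dist_eq_norm] at hd
  have h3 : ‖p - p'‖ = 1 := by
    have := norm_pos_iff.2 (sub_ne_zero.2 hcd)
    exact mul_right_cancel₀ this.ne' (by rw [hd, one_mul])
  rcases eq_or_eq_neg_of_abs_eq h3 with h4 | h4
  · left
    have h5 : p = 1 := by linarith
    have h6 : p' = 0 := by linarith
    have h7 : q = 0 := by linarith
    have h8 : q' = 1 := by linarith
    subst h5 h6 h7 h8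
    simp at ha hb
    exact ⟨ha.symm, hb.symm⟩
  · right
    have h5 : p' = 1 := by linarith
    have h6 : p = 0 := by linarith
    have h7 : q' = 0 := by linarith
    have h8 : q = 1 := by linarith
    subst h5 h6 h7 h8
    simp at ha hb
    exact ⟨ha.symm, hb.symm⟩

theorem spin_ne_spin_add_two (hN : 3 ≤ N) (k : ℤ) : spin N (2 * k) ≠ spin N (2 * k + 2) := by
  rw [Ne, spin_eq_iff (by omega)]
  intro h
  have := Int.le_of_dvd (by norm_num) ((dvd_neg).2 h)
  omega

theorem dist_side (k : ℤ) : dist (spin N (2 * k)) (spin N (2 * k + 2)) = dist 1 (spin N 2) := by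
  rw [dist_eq_norm, spin_add, dist_eq_norm]
  have : spin N (2 * k) - spin N (2 * k) * spin N 2 = spin N (2 * k) * (1 - spin N 2) := by ring
  rw [this, norm_mul, norm_spin, one_mul]

/-- The end points of a common side agree, in one of the two orders. -/
theorem end_points_of_common_side (hN : 3 ≤ N) (hr : 0 < r) (hf : IsTile r f) (hf' : IsTile r f') {k k' : ℤ}
    (h : f '' stdSide N k = f' '' stdSide N k') :
    (f (spin N (2 * k)) = f' (spin N (2 * k')) ∧ f (spin N (2 * k + 2)) = f' (spin N (2 * k' + 2))) ∨
    (f (spin N (2 * k)) = f' (spin N (2 * k' + 2)) ∧ f (spin N (2 * k + 2)) = f' (spin N (2 * k'))) := by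
  rw [stdSide, stdSide, hf.image_segment, hf'.image_segment] at h
  refine segment_eq_cases h ?_ ?_
  · rw [hf.dist_eq hr, hf'.dist_eq hr, dist_side, dist_side]
  · exact fun h => spin_ne_spin_add_two hN k' (hf'.injective hr h)

/-- On a common side two tiles differ by a symmetry of the polygon. -/
theorem exists_symmetry_of_common_side (hN : 3 ≤ N) (hr : 0 < r) (hf : IsTile r f) (hf' : IsTile r f')
    {k k' : ℤ} (h : f '' stdSide N k = f' '' stdSide N k') :
    ∃ g ∈ polygonGroup N, ∀ y ∈ stdSide N k, f y = f' (g y) := by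
  have hends := end_points_of_common_side hN hr hf hf' h
  have hinj := hf'.injective hr
  have hr0 : (r : ℂ) ≠ 0 := Complex.ofReal_ne_zero.2 hr.ne'
  have hf2 := hf'
  obtain ⟨ε', b', hε', he'⟩ := hf'
  let F : ℂ → ℂ := fun y => (ε' : ℂ) * (f y - b') / r
  have hF : ∀ y, f' (F y) = f y := by
    intro y
    have : (ε' : ℂ) * ε' = 1 := by rcases hε' with rfl | rfl <;> simp
    rw [he']
    simp only [F]
    field_simp
    linear_combination (f y - b') * this
  obtain ⟨g, hg, hgF⟩ := exists_symmetry_of_side (N := N) k k' (f := F) (by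
      intro a b p q hpq
      apply hinj
      rw [hF, hf.combo hpq, hf2.combo hpq, hF, hF]) (by
      rcases hends with ⟨h1, h2⟩ | ⟨h1, h2⟩
      · exact Or.inl ⟨hinj (by rw [hF, h1]), hinj (by rw [hF, h2])⟩
      · exact Or.inr ⟨hinj (by rw [hF, h1]), hinj (by rw [hF, h2])⟩)
  exact ⟨g, hg, fun y hy => by rw [← hgF y hy, hF]⟩

/-- Two similarities with the same tile differ by a symmetry of the polygon. -/
theorem exists_symmetry_of_image_eq (hN : 3 ≤ N) (hr : 0 < r) (hf : IsTile r f) (hf' : IsTile r f')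
    (h : f '' stdBody N = f' '' stdBody N) : ∃ g ∈ polygonGroup N, ∀ y, f y = f' (g y) := by
  have hinj := hf.injective hr
  have hinj' := hf'.injective hr
  have hr0 : (r : ℂ) ≠ 0 := Complex.ofReal_ne_zero.2 hr.ne'
  obtain ⟨ε, b, hε, he⟩ := hf
  obtain ⟨ε', b', hε', he'⟩ := hf'
  have hε2 : (ε' : ℂ) * ε' = 1 := by rcases hε' with rfl | rfl <;> simp
  have key : ∀ y, f' (((ε * ε' : ℝ) : ℂ) * y + ε' * (b - b') / r) = f y := by
    intro y
    rw [he, he']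
    push_cast
    field_simp
    linear_combination (ε * r * y + (b - b')) * hε2
  have hmem : ∀ y ∈ stdBody N, ((ε * ε' : ℝ) : ℂ) * y + ε' * (b - b') / r ∈ stdBody N := by
    intro y hy
    obtain ⟨z, hz, hzy⟩ : f y ∈ f' '' stdBody N := h ▸ ⟨y, hy, rfl⟩
    rw [← key] at hzy
    rwa [← hinj' hzy]
  have hεε : ε * ε' = 1 ∨ ε * ε' = -1 := by
    rcases hε with rfl | rfl <;> rcases hε' with rfl | rfl <;> norm_num
  have hb := eq_zero_of_translate_subset hN hεε (fun k => hmem _ (spin_mem_stdBody k))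
  rw [hb] at key hmem
  have hb0 : b = b' := by
    have h2 : (ε' : ℂ) ≠ 0 := by rintro h; rw [h] at hε2; simp at hε2
    have := div_eq_zero_iff.1 hb
    rcases this with h1 | h1
    · rcases mul_eq_zero.1 h1 with h1 | h1
      · exact absurd h1 h2
      · exact sub_eq_zero.1 h1
    · exact absurd h1 hr0
  rcases hεε with h1 | h1
  · refine ⟨1, one_mem _, fun y => ?_⟩
    rw [← key, h1]
    simp
  · refine ⟨LinearIsometryEquiv.neg ℝ, ?_, fun y => ?_⟩
    · rw [mem_polygonGroup]
      rw [h1] at hmem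
      have : ∀ y ∈ stdBody N, -y ∈ stdBody N := fun y hy => by simpa using hmem y hy
      ext z
      constructor
      · rintro ⟨y, hy, rfl⟩
        exact this y hy
      · intro hz
        exact ⟨-z, this z hz, by simp⟩
    · rw [← key, h1]
      simp

/-- The midpoint of a side of the polygon. -/
theorem midpoint_side (k : ℤ) : ((1 / 2 : ℝ) • spin N (2 * k) + (1 / 2 : ℝ) • spin N (2 * k + 2) : ℂ)
    = (Real.cos (Real.pi / N) : ℂ) * spin N (2 * k + 1) := by
  have h1 : spin N (2 * k) = spin N (2 * k + 1) * spin N (-1) := by rw [← spin_add]; ring_nf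
  have h2 : spin N (2 * k + 2) = spin N (2 * k + 1) * spin N 1 := by rw [← spin_add]; ring_nf
  have h3 : spin N (-1) + spin N 1 = 2 * (Real.cos (Real.pi / N) : ℂ) := by
    rw [← conj_spin, add_comm, Complex.add_conj, spin_re]
    push_cast; ring_nf
  rw [h1, h2, Complex.real_smul, Complex.real_smul]
  push_cast at h3 ⊢
  linear_combination (spin N (2 * k + 1) / 2) * h3

theorem midpoint_mem_stdSide (k : ℤ) : (Real.cos (Real.pi / N) : ℂ) * spin N (2 * k + 1) ∈ stdSide N k := by
  rw [← midpoint_side]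
  exact ⟨1 / 2, 1 / 2, by norm_num, by norm_num, by norm_num, rfl⟩

/-- Two tiles with a common side agree or are mirror images: the side has the same midpoint in both,
and their centers agree or are symmetric with respect to it. -/
theorem centers_of_common_side (hN : 3 ≤ N) (hr : 0 < r) (hf : IsTile r f) (hf' : IsTile r f') {k k' : ℤ}
    (h : f '' stdSide N k = f' '' stdSide N k') :
    f (Real.cos (Real.pi / N) * spin N (2 * k + 1)) = f' (Real.cos (Real.pi / N) * spin N (2 * k' + 1)) ∧
    (f 0 = f' 0 → f '' stdBody N = f' '' stdBody N) ∧
    (f 0 ≠ f' 0 → f 0 + f' 0 = 2 * f (Real.cos (Real.pi / N) * spin N (2 * k + 1))) := by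
  have hN0 : N ≠ 0 := by omega
  have hends := end_points_of_common_side hN hr hf hf' h
  have hmid : f (Real.cos (Real.pi / N) * spin N (2 * k + 1)) =
      f' (Real.cos (Real.pi / N) * spin N (2 * k' + 1)) := by
    rw [← midpoint_side, ← midpoint_side, hf.combo (by norm_num), hf'.combo (by norm_num)]
    rcases hends with ⟨h1, h2⟩ | ⟨h1, h2⟩
    · rw [h1, h2]
    · rw [h1, h2, add_comm]
  have hδ := cos_pi_div_pos hN
  have hδ0 : (Real.cos (Real.pi / N) : ℂ) ≠ 0 := Complex.ofReal_ne_zero.2 hδ.ne'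
  have hr0 : (r : ℂ) ≠ 0 := Complex.ofReal_ne_zero.2 hr.ne'
  refine ⟨hmid, ?_, ?_⟩
  · intro h0
    obtain ⟨ε, b, hε, he⟩ := hf
    obtain ⟨ε', b', hε', he'⟩ := hf'
    rw [he, he', mul_zero, zero_add, mul_zero, zero_add] at h0
    subst h0
    rw [he, he', add_left_inj] at hmid
    have h1 : (ε : ℂ) * spin N (2 * k + 1) = ε' * spin N (2 * k' + 1) := by
      have : (r : ℂ) * (Real.cos (Real.pi / N) : ℂ) ≠ 0 := mul_ne_zero hr0 hδ0
      apply mul_left_cancel₀ this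
      linear_combination hmid
    by_cases hεε : ε = ε'
    · subst hεε
      congr 1
      ext1 y
      rw [he, he']
    · have h2 : ε' = -ε := by
        rcases hε with rfl | rfl <;> rcases hε' with rfl | rfl <;> first | exact absurd rfl hεε | norm_num
      subst h2
      have h3 : spin N (2 * k + 1 + N) = spin N (2 * k' + 1) := by
        rw [spin_add, spin_natCast hN0]
        have : (ε : ℂ) ≠ 0 := by rcases hε with rfl | rfl <;> simp
        apply mul_left_cancel₀ this
        push_cast at h1
        linear_combination -h1
      rw [spin_eq_iff hN0] at h3
      obtain ⟨m, hm⟩ := h3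
      have hneg : ∀ y ∈ stdBody N, -y ∈ stdBody N := by
        intro y hy
        have := map_mem_stdBody (rot_mem (N := N) (k - k' - N * m)) hy
        rw [rot_apply] at this
        have h4 : spin N (2 * (k - k' - N * m)) = -1 := by
          rw [← spin_natCast hN0, spin_eq_iff hN0]
          exact ⟨-1, by linear_combination hm⟩
        rw [h4] at this
        simpa using this
      have hff : ∀ y, f y = f' (-y) := by intro y; rw [he, he']; push_cast; ring
      ext z
      constructor
      · rintro ⟨y, hy, rfl⟩
        exact ⟨-y, hneg y hy, (hff y).symm⟩
      · rintro ⟨y, hy, rfl⟩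
        exact ⟨-y, hneg y hy, by rw [hff, neg_neg]⟩
  · intro h0
    have e1 : spin N (2 * k) = spin N (2 * k + 1) * spin N (-1) := by rw [← spin_add]; ring_nf
    have e2 : spin N (2 * k + 2) = spin N (2 * k + 1) * spin N 1 := by rw [← spin_add]; ring_nf
    have e1' : spin N (2 * k') = spin N (2 * k' + 1) * spin N (-1) := by rw [← spin_add]; ring_nf
    have e2' : spin N (2 * k' + 2) = spin N (2 * k' + 1) * spin N 1 := by rw [← spin_add]; ring_nf
    have hd : spin N 1 - spin N (-1) ≠ 0 := by
      rw [sub_ne_zero, Ne, spin_eq_iff hN0]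
      intro h
      have := Int.le_of_dvd (by norm_num) h
      omega
    obtain ⟨ε, b, hε, he⟩ := hf
    obtain ⟨ε', b', hε', he'⟩ := hf'
    rw [e1, e2, e1', e2'] at hends
    simp only [he, he', mul_zero, zero_add] at hends hmid h0 ⊢
    have hcase : (ε : ℂ) * spin N (2 * k + 1) = ε' * spin N (2 * k' + 1) ∨
        (ε : ℂ) * spin N (2 * k + 1) = - (ε' * spin N (2 * k' + 1)) := by
      have : (r : ℂ) * (spin N 1 - spin N (-1)) ≠ 0 := mul_ne_zero hr0 hd
      rcases hends with ⟨h1, h2⟩ | ⟨h1, h2⟩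
      · left
        apply mul_left_cancel₀ this
        linear_combination h2 - h1
      · right
        apply mul_left_cancel₀ this
        linear_combination h2 - h1
    rcases hcase with h1 | h1
    · exfalso
      apply h0
      linear_combination hmid - (r : ℂ) * (Real.cos (Real.pi / N) : ℂ) * h1
    · linear_combination -hmid - (r : ℂ) * (Real.cos (Real.pi / N) : ℂ) * h1

end PolygonCarpet

/-! ### A union of tiles determines the tiles -/

namespace PolygonCarpet

variable {N : ℕ} {r : ℝ}

/-- The tile that contains the lexicographically maximal point `e` of a union of tiles, for the height
over the side `0` and then the coordinate along that side, is one of two. Either it is a translate of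
the polygon with `e` at the vertex `0`, or it is upside down and `e` is its only highest point. -/
theorem tile_at_top (hN : 3 ≤ N) (hr : 0 < r) {f : ℂ → ℂ} (hf : IsTile r f) {e : ℂ}
    (he : e ∈ f '' stdBody N) (hmax : ∀ y ∈ stdBody N, height N 1 (f y) ≤ height N 1 e)
    (hmax' : ∀ y ∈ stdBody N, height N 1 (f y) = height N 1 e →
      (e * spin N (-1)).im ≤ (f y * spin N (-1)).im) :
    f '' stdBody N = (fun y => e - r + r * y) '' stdBody N ∨
    (f '' stdBody N = (fun y => e - r * spin N 1 - r * y) '' stdBody N ∧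
      ∀ y ∈ stdBody N, height N 1 (f y) = height N 1 e → f y = e) := by
  have hN0 : N ≠ 0 := by omega
  obtain ⟨y₀, hy₀, rfl⟩ := he
  obtain ⟨c, b, hc, hfc, hh⟩ := hf.exists_shift hN0
  have hmax2 : ∀ y ∈ stdBody N, height N (1 - c) y ≤ height N (1 - c) y₀ := by
    intro y hy
    have := hmax y hy
    rw [hh, hh] at this
    exact le_of_mul_le_mul_left (by linarith : r * height N (1 - c) y ≤ r * height N (1 - c) y₀) hr
  rcases Int.even_or_odd' (1 - c) with ⟨i, hi | hi⟩
  · right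
    have hvert : ∀ y ∈ stdBody N, height N (1 - c) y₀ ≤ height N (1 - c) y → y = spin N (2 * i) := by
      intro y hy hle
      have h2 := (hmax2 _ (spin_mem_stdBody i)).trans hle
      rw [hi, height_spin] at h2
      simp only [sub_self, Int.cast_zero, mul_zero, zero_div, Real.cos_zero] at h2
      have h3 := norm_le_of_mem_stdBody hy
      exact eq_spin_of_height_eq_one h3 (le_antisymm ((height_le_norm _ _).trans h3) h2)
    have hy0 := hvert y₀ hy₀ le_rfl
    have hcN : c = N := by rcases hc with h | h; · omega
                           · exact h
    constructor
    · congr 1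
      ext1 y
      rw [hfc, hfc, hy0]
      have : spin N c * spin N (2 * i) = spin N 1 := by rw [← spin_add, ← hi]; ring_nf
      rw [hcN, spin_natCast hN0] at this ⊢
      linear_combination -(r : ℂ) * this
    · intro y hy hye
      rw [hh, hh] at hye
      rw [hvert y hy (le_of_mul_le_mul_left (by linarith : r * height N (1 - c) y₀ ≤ r * height N (1 - c) y) hr),
        hy0]
  · left
    have hci : c = 2 * (-i) := by linarith
    have h1 := hmax2 _ (stdSide_subset i (left_mem_stdSide i))
    rw [hi, height_of_mem_stdSide (left_mem_stdSide i)] at h1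
    have h2 := le_antisymm (height_le_of_mem_stdBody hN0 hy₀ i) h1
    have h3 := hmax' _ (spin_mem_stdBody i) (by
      rw [hh, hh, hi, h2, height_of_mem_stdSide (left_mem_stdSide i)])
    obtain ⟨p, q, hp, hq, hpq, rfl⟩ := mem_stdSide_of_height hN0 hy₀ h2
    have hs : 0 < Real.sin (Real.pi / N) := by
      have hNp : (3 : ℝ) ≤ N := by exact_mod_cast hN
      have hpi := Real.pi_pos
      apply Real.sin_pos_of_pos_of_lt_pi (by positivity)
      rw [div_lt_iff₀ (by linarith)]; nlinarith
    have e1 : spin N c * spin N (2 * i) = 1 := by rw [hci, ← spin_add]; ring_nf; simp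
    have e2 : spin N c * spin N (2 * i + 2) = spin N 2 := by rw [hci, ← spin_add]; ring_nf
    have e3 : spin N 2 * spin N (-1) = spin N 1 := by rw [← spin_add]; norm_num
    have e4 : (spin N 1).im = Real.sin (Real.pi / N) := by rw [spin_im]; simp
    have e5 : (spin N (-1)).im = - Real.sin (Real.pi / N) := by rw [← conj_spin, Complex.conj_im, e4]
    have h4 : f (p • spin N (2 * i) + q • spin N (2 * i + 2)) * spin N (-1) =
        (r * p : ℝ) * spin N (-1) + (r * q : ℝ) * spin N 1 + b * spin N (-1) := by
      rw [hfc, Complex.real_smul, Complex.real_smul, ← e3]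
      push_cast
      linear_combination (r : ℂ) * p * spin N (-1) * e1 + (r : ℂ) * q * spin N (-1) * e2
    have h5 : f (spin N (2 * i)) * spin N (-1) = (r : ℝ) * spin N (-1) + b * spin N (-1) := by
      rw [hfc]
      linear_combination (r : ℂ) * spin N (-1) * e1
    rw [h4, h5, Complex.add_im, Complex.add_im, Complex.add_im, Complex.im_ofReal_mul,
      Complex.im_ofReal_mul, Complex.im_ofReal_mul, e4, e5] at h3
    have h6 : q * (r * Real.sin (Real.pi / N)) ≤ 0 := by
      have : p = 1 - q := by linarith
      subst this
      nlinarith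
    have h7 : q = 0 := by
      by_contra hne
      have : 0 < q := lt_of_le_of_ne hq (Ne.symm hne)
      have := mul_pos this (mul_pos hr hs)
      linarith
    have h8 : p = 1 := by linarith
    subst h7 h8
    simp only [one_smul, zero_smul, add_zero]
    have key : ∀ y, f y = f (spin N (2 * i)) - r + r * (rot N (-i) y) := by
      intro y
      rw [hfc, hfc, rot_apply, ← hci]
      linear_combination -(r : ℂ) * e1
    have hrot := rot_mem (N := N) (-i)
    rw [mem_polygonGroup] at hrot
    conv_rhs => rw [← hrot]
    rw [Set.image_image]
    congr 1
    exact funext key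

/-- If points of a finite union of tiles converge to `m`, one of the tiles contains `m` and some of
the points. -/
theorem exists_tile_of_tendsto {S : Type*} [Finite S] (hN : N ≠ 0) {f : S → ℂ → ℂ} (hf : ∀ i, IsTile r (f i))
    {z : ℕ → ℂ} {m : ℂ} (hz : Filter.Tendsto z Filter.atTop (nhds m))
    (hU : ∀ n, z n ∈ ⋃ i, f i '' stdBody N) : ∃ i n, m ∈ f i '' stdBody N ∧ z n ∈ f i '' stdBody N := by
  choose j hj using fun n => Set.mem_iUnion.1 (hU n)
  obtain ⟨i, hi⟩ := Finite.exists_infinite_fiber j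
  have hi2 : (j ⁻¹' {i}).Infinite := Set.infinite_coe_iff.1 hi
  obtain ⟨n0, hn0⟩ := hi2.nonempty
  have hn0' : j n0 = i := hn0
  refine ⟨i, n0, ?_, hn0' ▸ hj n0⟩
  have hclosed : IsClosed (f i '' stdBody N) :=
    ((isCompact_stdBody hN).image (hf i).continuous).isClosed
  refine hclosed.mem_of_frequently_of_tendsto ?_ hz
  rw [Filter.frequently_atTop]
  intro a
  obtain ⟨b, hb, hab⟩ := hi2.exists_gt a
  exact ⟨b, hab.le, (show j b = i from hb) ▸ hj b⟩

/-- Two finite families of tiles of the same size and with the same union have a tile in common. -/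
theorem exists_common_tile {S : Type*} [Finite S] [Nonempty S] (hN : 3 ≤ N) (hr : 0 < r)
    {f f' : S → ℂ → ℂ} (hf : ∀ i, IsTile r (f i)) (hf' : ∀ i, IsTile r (f' i))
    (hU : ⋃ i, f i '' stdBody N = ⋃ i, f' i '' stdBody N) :
    ∃ i j, f' j '' stdBody N = f i '' stdBody N := by
  have hN0 : N ≠ 0 := by omega
  set U := ⋃ i, f i '' stdBody N with hUdef
  have hUc : IsCompact U := isCompact_iUnion fun i => (isCompact_stdBody hN0).image (hf i).continuous
  have hUne : U.Nonempty :=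
    ⟨_, Set.mem_iUnion.2 ⟨Classical.arbitrary S, _, spin_mem_stdBody 0, rfl⟩⟩
  have hhc : Continuous (height N 1) := LinearMap.continuous_of_finiteDimensional _
  obtain ⟨e₀, he₀, hmax₀⟩ := hUc.exists_isMaxOn hUne hhc.continuousOn
  have hUc' : IsCompact (U ∩ {z | height N 1 z = height N 1 e₀}) :=
    hUc.inter_right (isClosed_eq hhc continuous_const)
  obtain ⟨e, ⟨heU, hee₀⟩, hmin⟩ := hUc'.exists_isMinOn ⟨e₀, he₀, rfl⟩
    (f := fun z => (z * spin N (-1)).im) (by fun_prop)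
  have hee₀' : height N 1 e = height N 1 e₀ := hee₀
  have h1 : ∀ z ∈ U, height N 1 z ≤ height N 1 e := fun z hz => hee₀'.symm ▸ hmax₀ hz
  have h2 : ∀ z ∈ U, height N 1 z = height N 1 e → (e * spin N (-1)).im ≤ (z * spin N (-1)).im :=
    fun z hz hze => hmin ⟨hz, hze.trans hee₀'⟩
  -- an upright tile of one family at `e` forces an upright tile of the other one
  have key : ∀ f f' : S → ℂ → ℂ, (∀ i, IsTile r (f i)) → (∀ i, IsTile r (f' i)) →
      (⋃ i, f i '' stdBody N) = U → (⋃ i, f' i '' stdBody N) = U → ∀ i,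
      f i '' stdBody N = (fun y => e - r + r * y) '' stdBody N →
      ∃ j, f' j '' stdBody N = (fun y => e - r + r * y) '' stdBody N := by
    intro f f' hf hf' hfU hf'U i hi
    have hz : ∀ s : ℝ, 0 ≤ s → s ≤ 1 → e + s * (r * (spin N 2 - 1)) ∈ U := by
      intro s hs0 hs1
      rw [← hfU]
      refine Set.mem_iUnion.2 ⟨i, ?_⟩
      rw [hi]
      refine ⟨(1 - s) • spin N (2 * 0) + s • spin N (2 * 0 + 2), stdSide_subset 0
        ⟨1 - s, s, by linarith, hs0, by ring, rfl⟩, ?_⟩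
      simp only [Complex.real_smul]
      norm_num
      ring
    have hlim : Filter.Tendsto (fun n : ℕ => e + ((1 / ((n : ℝ) + 1) : ℝ) : ℂ) * (r * (spin N 2 - 1)))
        Filter.atTop (nhds e) := by
      have h := tendsto_one_div_add_atTop_nhds_zero_nat (𝕜 := ℝ)
      have h' := ((Complex.continuous_ofReal.tendsto 0).comp h).mul_const ((r : ℂ) * (spin N 2 - 1))
      have h'' := h'.const_add e
      simpa using h''
    have hs1 : ∀ n : ℕ, 1 / ((n : ℝ) + 1) ≤ 1 := by
      intro n
      rw [div_le_one (by positivity)]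
      have : (0 : ℝ) ≤ n := n.cast_nonneg
      linarith
    obtain ⟨j, n, hj, hjn⟩ := exists_tile_of_tendsto hN0 hf' hlim
      (fun n => by rw [hf'U]; exact hz _ (by positivity) (hs1 n))
    refine ⟨j, ?_⟩
    have hsub : ∀ y ∈ stdBody N, f' j y ∈ U := fun y hy => hf'U ▸ Set.mem_iUnion.2 ⟨j, y, hy, rfl⟩
    rcases tile_at_top hN hr (hf' j) hj (fun y hy => h1 _ (hsub y hy)) (fun y hy => h2 _ (hsub y hy))
      with h | ⟨-, h⟩
    · exact h
    · exfalso
      obtain ⟨y, hy, hyz⟩ := hjn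
      have h3 : height N 1 (spin N 2 - 1) = 0 := by
        rw [map_sub, height_spin, ← spin_zero (N := N), height_spin, sub_eq_zero]
        rw [← Real.cos_neg]; congr 1; push_cast; ring
      have h4 := h y hy (by
        rw [hyz, map_add, ← mul_assoc, ← Complex.ofReal_mul, ← Complex.real_smul, map_smul, h3]
        simp)
      rw [h4] at hyz
      have h5 : ((1 / ((n : ℝ) + 1) : ℝ) : ℂ) * (r * (spin N 2 - 1)) = 0 := by
        have := hyz.symm
        simpa using this
      have h6 : spin N 2 - 1 ≠ 0 := by
        rw [sub_ne_zero]
        have := (spin_ne_spin_add_two hN 0).symm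
        simpa using this
      have h7 : ((1 / ((n : ℝ) + 1) : ℝ) : ℂ) ≠ 0 := by
        rw [Complex.ofReal_ne_zero]; positivity
      exact mul_ne_zero h7 (mul_ne_zero (Complex.ofReal_ne_zero.2 hr.ne') h6) h5
  obtain ⟨i, hi⟩ := Set.mem_iUnion.1 heU
  obtain ⟨j, hj⟩ := Set.mem_iUnion.1 (hU ▸ heU)
  have hsub : ∀ i, ∀ y ∈ stdBody N, f i y ∈ U := fun i y hy => Set.mem_iUnion.2 ⟨i, y, hy, rfl⟩
  have hsub' : ∀ j, ∀ y ∈ stdBody N, f' j y ∈ U := fun i y hy => hU ▸ Set.mem_iUnion.2 ⟨i, y, hy, rfl⟩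
  rcases tile_at_top hN hr (hf i) hi (fun y hy => h1 _ (hsub i y hy)) (fun y hy => h2 _ (hsub i y hy))
    with h | ⟨h, -⟩
  · obtain ⟨j, hj⟩ := key f f' hf hf' rfl hU.symm i h
    exact ⟨i, j, hj.trans h.symm⟩
  rcases tile_at_top hN hr (hf' j) hj (fun y hy => h1 _ (hsub' j y hy)) (fun y hy => h2 _ (hsub' j y hy))
    with h' | ⟨h', -⟩
  · obtain ⟨i, hi⟩ := key f' f hf' hf hU.symm rfl j h'
    exact ⟨i, j, h'.trans hi.symm⟩
  · exact ⟨i, j, h'.trans h.symm⟩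

/-- Two families of tiles with the same union have the same tiles, if the tiles of the first are
connected through common sides and the tiles of the second only meet in common sides and vertices: a
common tile has a unique neighbour across each of its sides. -/
theorem tiles_eq_of_iUnion_eq {S : Type*} [Finite S] [Nonempty S] (hN : 3 ≤ N) (hr : 0 < r)
    {f f' : S → ℂ → ℂ} (hf : ∀ i, IsTile r (f i)) (hf' : ∀ i, IsTile r (f' i))
    (hU : ⋃ i, f i '' stdBody N = ⋃ i, f' i '' stdBody N)
    (hchain : ∀ i j, Relation.ReflTransGen (fun i j => SideTouching N (f i) (f j)) i j)
    (htouch : ∀ i j, i ≠ j → (f' i '' stdBody N ∩ f' j '' stdBody N).Nonempty →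
      SideTouching N (f' i) (f' j) ∨ CornerTouching N (f' i) (f' j)) (i : S) :
    ∃ j, f' j '' stdBody N = f i '' stdBody N := by
  have hN0 : N ≠ 0 := by omega
  obtain ⟨i₀, h₀⟩ := exists_common_tile hN hr hf hf' hU
  refine Relation.ReflTransGen.head_induction_on (motive := fun a _ =>
    (∃ j, f' j '' stdBody N = f a '' stdBody N) → ∃ j, f' j '' stdBody N = f i '' stdBody N)
    (hchain i₀ i) (fun h => h) ?_ h₀
  rintro a c ⟨k, k', hac, hkk'⟩ - ih ⟨j, hj⟩
  apply ih
  clear ih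
  have hδ := cos_pi_div_pos hN
  set δ := Real.cos (Real.pi / N) with hδdef
  obtain ⟨hm, hsame, hdiff⟩ := centers_of_common_side hN hr (hf a) (hf c) hkk'
  set m := f a (δ * spin N (2 * k + 1)) with hmdef
  -- points of the neighbour close to the midpoint of the common side
  set y : ℕ → ℂ := fun n => ((1 - 1 / ((n : ℝ) + 1) : ℝ) : ℂ) * (δ * spin N (2 * k' + 1)) with hy
  have hs : ∀ n : ℕ, 0 < 1 / ((n : ℝ) + 1) ∧ 1 / ((n : ℝ) + 1) ≤ 1 := by
    intro n
    refine ⟨by positivity, ?_⟩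
    rw [div_le_one (by positivity)]
    have : (0 : ℝ) ≤ n := n.cast_nonneg
    linarith
  have h0A : (0 : ℂ) ∈ stdBody N := by
    obtain ⟨ρ, hρ, h⟩ := exists_ball_subset_stdBody hN
    exact h (Metric.mem_ball_self hρ)
  have hyA : ∀ n, y n ∈ stdBody N := by
    intro n
    have := convex_stdBody.segment_subset h0A (stdSide_subset k' (midpoint_mem_stdSide k'))
    refine this ⟨1 / ((n : ℝ) + 1), 1 - 1 / ((n : ℝ) + 1), (hs n).1.le, by linarith [(hs n).2], by ring, ?_⟩
    rw [hy, smul_zero, zero_add, Complex.real_smul]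
  have hynorm : ∀ n, ‖y n‖ < δ := by
    intro n
    rw [hy]
    simp only
    rw [norm_mul, norm_mul, norm_spin, Complex.norm_real, Complex.norm_real, mul_one,
      Real.norm_of_nonneg (by linarith [(hs n).2]), Real.norm_of_nonneg hδ.le]
    nlinarith [(hs n).1]
  have hlim : Filter.Tendsto (fun n => f c (y n)) Filter.atTop (nhds m) := by
    rw [hm]
    refine ((hf c).continuous.tendsto _).comp ?_
    have h := (tendsto_one_div_add_atTop_nhds_zero_nat (𝕜 := ℝ)).const_sub 1
    have h' := ((Complex.continuous_ofReal.tendsto _).comp h).mul_const ((δ : ℂ) * spin N (2 * k' + 1))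
    simpa [hy, -Complex.ofReal_cos] using h'
  have hnot : ∀ n, f c (y n) ∉ f a '' stdBody N := by
    intro n hn
    have : f c (y n) ∈ f a '' stdSide N k := hac ▸ ⟨hn, y n, hyA n, rfl⟩
    rw [hkk'] at this
    obtain ⟨w, hw, hwy⟩ := this
    rw [(hf c).injective hr hwy] at hw
    exact absurd (norm_ge_of_mem_stdSide hw) (not_le.2 (hynorm n))
  obtain ⟨j', n, hmj', hnj'⟩ := exists_tile_of_tendsto hN0 hf' hlim
    (fun n => hU ▸ Set.mem_iUnion.2 ⟨c, y n, hyA n, rfl⟩)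
  refine ⟨j', ?_⟩
  have hjj' : j ≠ j' := by
    rintro rfl
    exact hnot n (hj ▸ hnj')
  have hma : m ∈ f a '' stdBody N := ⟨_, stdSide_subset k (midpoint_mem_stdSide k), rfl⟩
  obtain ⟨g, hg, hgj⟩ := exists_symmetry_of_image_eq hN hr (hf' j) (hf a) hj
  -- the touching with the second family takes place in the same side
  have hside : ∃ l l' : ℤ, f' j' '' stdSide N l' = f a '' stdSide N l ∧
      f a '' stdSide N l = f a '' stdSide N k := by
    rcases htouch j j' hjj' ⟨m, hj ▸ hma, hmj'⟩ with ⟨l, l', h1, h2⟩ | ⟨l, l', h1, h2⟩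
    · obtain ⟨l2, hl2⟩ := exists_map_stdSide hg l
      have e1 : f' j '' stdSide N l = f a '' stdSide N l2 := by
        rw [← hl2, Set.image_image]
        exact Set.image_congr fun y _ => hgj y
      have hm2 : m ∈ f a '' stdSide N l2 := by
        rw [← e1, ← h1]; exact ⟨hj ▸ hma, hmj'⟩
      obtain ⟨w, hw, hwm⟩ := hm2
      rw [(hf a).injective hr hwm] at hw
      have h3 := height_of_mem_stdSide hw
      rw [← Complex.real_smul, map_smul, height_spin, smul_eq_mul] at h3
      have h4 : Real.cos (Real.pi * (2 * k + 1 - (2 * l2 + 1) : ℤ) / N) = 1 :=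
        mul_left_cancel₀ hδ.ne' (h3.trans (mul_one _).symm)
      have h5 : spin N (2 * k + 1) = spin N (2 * l2 + 1) := by
        apply eq_spin_of_height_eq_one (norm_spin _).le
        rw [height_spin, h4]
      rw [spin_eq_iff hN0] at h5
      have h6 : (N : ℤ) ∣ l2 - k := by
        obtain ⟨q, hq⟩ := h5
        exact ⟨-q, by linarith⟩
      exact ⟨l2, l', by rw [← h2, e1], by rw [stdSide_congr hN0 h6]⟩
    · exfalso
      have h3 : m = f' j (spin N (2 * l)) := by
        have : m ∈ f' j '' stdBody N ∩ f' j' '' stdBody N := ⟨hj ▸ hma, hmj'⟩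
        rw [h1] at this
        exact this
      rw [hgj] at h3
      have h4 := congrArg norm ((hf a).injective hr h3)
      rw [g.norm_map, norm_spin, norm_mul, norm_spin, mul_one, Complex.norm_real,
        Real.norm_of_nonneg hδ.le] at h4
      have h5 : δ < 1 := by
        rw [hδdef, ← Real.cos_zero]
        have hNp : (3 : ℝ) ≤ N := by exact_mod_cast hN
        have hpi := Real.pi_pos
        refine Real.cos_lt_cos_of_nonneg_of_le_pi le_rfl ?_ (by positivity)
        rw [div_le_iff₀ (by linarith)]; nlinarith
      linarith
  obtain ⟨l, l', h1, h2⟩ := hside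
  rw [h2] at h1
  obtain ⟨hm', hsame', hdiff'⟩ := centers_of_common_side hN hr (hf a) (hf' j') h1.symm
  have hne1 : f a 0 ≠ f c 0 := fun h => hnot 0 (hsame h ▸ ⟨_, hyA 0, rfl⟩)
  have hne2 : f a 0 ≠ f' j' 0 := fun h => hnot n (hsame' h ▸ hnj')
  have hcenter : f' j' 0 = f c 0 := by
    have h3 := hdiff hne1
    have h4 := hdiff' hne2
    exact add_left_cancel (h4.trans h3.symm)
  exact (centers_of_common_side hN hr (hf' j') (hf c) (h1.trans hkk')).2.1 hcenter

end PolygonCarpet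

/-! ### Carpets in the standard position -/

namespace PolygonCarpet

/-- A perfect polygon carpet whose polygon is the standard one. All similarities have the same ratio,
as the small polygons are connected through common sides. -/
structure Carpet (N : ℕ) (S : Type*) where
  three_le : 3 ≤ N
  ratio : ℝ
  ratio_pos : 0 < ratio
  ratio_lt_one : ratio < 1
  map : S → ℂ → ℂ
  isTile : ∀ i, IsTile ratio (map i)
  maps_body : ∀ i, map i '' stdBody N ⊆ stdBody N
  symmetric : ∀ g ∈ polygonGroup N, g '' (⋃ i, map i '' stdBody N) = ⋃ i, map i '' stdBody N
  nontrivial : (⋃ i, map i '' stdBody N) ≠ stdBody N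
  /-- The attractor. -/
  K : Set ℂ
  isCompact_K : IsCompact K
  nonempty_K : K.Nonempty
  K_eq : K = ⋃ i, map i '' K
  K_subset : K ⊆ stdBody N
  isPreconnected_K : IsPreconnected K
  chain : ∀ i j, Relation.ReflTransGen (fun i j => SideTouching N (map i) (map j)) i j
  touching : ∀ i j, i ≠ j → (map i '' stdBody N ∩ map j '' stdBody N).Nonempty →
    SideTouching N (map i) (map j) ∨ CornerTouching N (map i) (map j)

theorem IsTile.conj {r : ℝ} {f : ℂ → ℂ} (hf : IsTile r f) (g : ℂ ≃ₗᵢ[ℝ] ℂ) :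
    IsTile r (fun y => g (f (g.symm y))) := by
  obtain ⟨ε, b, hε, h⟩ := hf
  refine ⟨ε, g b, hε, fun y => ?_⟩
  have : (ε : ℂ) * r * g.symm y + b = (ε * r : ℝ) • g.symm y + b := by
    rw [Complex.real_smul]; push_cast; ring
  simp only [h]
  rw [this, map_add, LinearIsometryEquiv.map_smul, g.apply_symm_apply, Complex.real_smul]
  push_cast; ring

/-- The center of a tile of the polygon is not on a side of the polygon. -/
theorem IsTile.center_notMem_stdSide {N : ℕ} {r : ℝ} {f : ℂ → ℂ} (hN : 3 ≤ N) (hr : 0 < r)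
    (hf : IsTile r f) (hfA : f '' stdBody N ⊆ stdBody N) (k : ℤ) : f 0 ∉ stdSide N k := by
  intro h0
  have h0A : (0 : ℂ) ∈ stdBody N := by
    obtain ⟨ρ, hρ, h⟩ := exists_ball_subset_stdBody hN
    exact h (Metric.mem_ball_self hρ)
  have hmem : f 0 ∈ f '' stdBody N ∩ stdSide N k := ⟨⟨0, h0A, rfl⟩, h0⟩
  rcases hf.inter_stdSide hN hr hfA k with h | ⟨i, h⟩ | ⟨i, h⟩
  · rw [h] at hmem; exact hmem
  · rw [h] at hmem
    obtain ⟨y, hy, hy0⟩ := hmem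
    rw [hf.injective hr hy0] at hy
    have := norm_ge_of_mem_stdSide hy
    rw [norm_zero] at this
    linarith [cos_pi_div_pos hN]
  · rw [h] at hmem
    exact spin_ne_zero _ (hf.injective hr hmem).symm

theorem stdSide_inter_stdSide {N : ℕ} (hN : 3 ≤ N) {l : ℤ} {y : ℂ} (h : y ∈ stdSide N l)
    (h' : y ∈ stdSide N (l - 1)) : y = spin N (2 * l) := by
  obtain ⟨a, b, ha, hb, hab, rfl⟩ := h
  have h1 := height_of_mem_stdSide h'
  rw [map_add, map_smul, map_smul, height_spin, height_spin] at h1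
  have e1 : 2 * l - (2 * (l - 1) + 1) = 1 := by ring
  have e2 : 2 * l + 2 - (2 * (l - 1) + 1) = 3 := by ring
  rw [e1, e2] at h1
  have hN' : (3 : ℝ) ≤ N := by exact_mod_cast hN
  have h3 : Real.cos (Real.pi * ((3 : ℤ) : ℝ) / N) < Real.cos (Real.pi / N) := by
    have hpi := Real.pi_pos
    apply Real.cos_lt_cos_of_nonneg_of_le_pi
    · positivity
    · rw [div_le_iff₀ (by linarith)]; push_cast; nlinarith
    · rw [div_lt_div_iff_of_pos_right (by linarith)]; push_cast; linarith
  simp only [smul_eq_mul] at h1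
  have hb0 : b = 0 := by
    by_contra hb0
    have hb' : 0 < b := lt_of_le_of_ne hb (Ne.symm hb0)
    have e3 : Real.cos (Real.pi * ((1 : ℤ) : ℝ) / N) = Real.cos (Real.pi / N) := by simp
    rw [e3] at h1
    have : a = 1 - b := by linarith
    subst this
    nlinarith
  subst hb0
  have : a = 1 := by linarith
  subst this
  simp

namespace Carpet

variable {N : ℕ} {S : Type*} (C : Carpet N S)

theorem zero_mem_body (hN : 3 ≤ N) : (0 : ℂ) ∈ stdBody N := by
  obtain ⟨ρ, hρ, h⟩ := exists_ball_subset_stdBody hN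
  exact h (Metric.mem_ball_self hρ)

theorem sideTouching_conj {f f' : ℂ → ℂ} (h : SideTouching N f f')
    {g : ℂ ≃ₗᵢ[ℝ] ℂ} (hg : g ∈ polygonGroup N) :
    SideTouching N (fun y => g (f (g.symm y))) (fun y => g (f' (g.symm y))) := by
  have hs : ∀ (f : ℂ → ℂ) (X : Set ℂ), (fun y => g (f (g.symm y))) '' (g '' X) = g '' (f '' X) := by
    intro f X
    rw [Set.image_image, Set.image_image]
    simp
  obtain ⟨k, k', h1, h2⟩ := h
  obtain ⟨i, hi⟩ := exists_map_stdSide hg k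
  obtain ⟨i', hi'⟩ := exists_map_stdSide hg k'
  have hA := mem_polygonGroup.1 hg
  refine ⟨i, i', ?_, ?_⟩
  · rw [← hA, ← hi, hs, hs, hs, ← Set.image_inter g.injective, h1]
  · rw [← hi, ← hi', hs, hs, h2]

/-- The symmetries of the polygon permute the small polygons. -/
theorem exists_perm [Finite S] (g : polygonGroup N) (i : S) :
    ∃ p : S × polygonGroup N, ∀ y, g.1 (C.map i y) = C.map p.1 (p.2.1 y) := by
  obtain ⟨g, hg⟩ := g
  have : Nonempty S := ⟨i⟩
  have hA := mem_polygonGroup.1 hg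
  have hg' := (polygonGroup N).inv_mem hg
  have hA' : g.symm '' stdBody N = stdBody N := mem_polygonGroup.1 hg'
  have himg : ∀ i, (fun y => g (C.map i (g.symm y))) '' stdBody N = g '' (C.map i '' stdBody N) := by
    intro i
    conv_lhs => rw [← hA]
    rw [Set.image_image, Set.image_image]
    simp
  obtain ⟨j, hj⟩ := tiles_eq_of_iUnion_eq C.three_le C.ratio_pos
    (f := fun i y => g (C.map i (g.symm y))) (f' := C.map)
    (fun i => (C.isTile i).conj g) C.isTile
    (by simp only [himg]; rw [← Set.image_iUnion]; exact C.symmetric g hg)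
    (fun i j => (C.chain i j).lift id fun a b h => sideTouching_conj h hg)
    C.touching i
  obtain ⟨h, hh, hhy⟩ := exists_symmetry_of_image_eq C.three_le C.ratio_pos
    ((C.isTile i).conj g) (C.isTile j) hj.symm
  refine ⟨(j, ⟨h * g, (polygonGroup N).mul_mem hh hg⟩), fun y => ?_⟩
  have := hhy (g y)
  simp only [LinearIsometryEquiv.symm_apply_apply] at this
  simpa using this

/-- `Ψ w` for a finite word `w`. -/
def wordMap : List S → ℂ → ℂ
  | [] => id
  | i :: w => C.map i ∘ wordMap w

theorem wordMap_cons (i : S) (w : List S) (y : ℂ) : C.wordMap (i :: w) y = C.map i (C.wordMap w y) := rfl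

theorem wordMap_append (w v : List S) (y : ℂ) : C.wordMap (w ++ v) y = C.wordMap w (C.wordMap v y) := by
  induction w with
  | nil => rfl
  | cons i w ih => rw [List.cons_append, wordMap_cons, wordMap_cons, ih]

theorem isTile_wordMap (w : List S) : IsTile (C.ratio ^ w.length) (C.wordMap w) := by
  induction w with
  | nil => exact ⟨1, 0, Or.inl rfl, fun y => by simp [wordMap]⟩
  | cons i w ih => rw [List.length_cons, pow_succ']; exact (C.isTile i).comp ih

theorem ratio_pow_pos (n : ℕ) : 0 < C.ratio ^ n := pow_pos C.ratio_pos n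

theorem wordMap_injective (w : List S) : Function.Injective (C.wordMap w) :=
  (C.isTile_wordMap w).injective (C.ratio_pow_pos _)

theorem map_injective (i : S) : Function.Injective (C.map i) := (C.isTile i).injective C.ratio_pos

theorem dist_wordMap (w : List S) (x y : ℂ) :
    dist (C.wordMap w x) (C.wordMap w y) = C.ratio ^ w.length * dist x y :=
  (C.isTile_wordMap w).dist_eq (C.ratio_pow_pos _) x y

theorem wordMap_image_body (w : List S) : C.wordMap w '' stdBody N ⊆ stdBody N := by
  induction w with
  | nil => simp [wordMap]
  | cons i w ih =>
    rw [show C.wordMap (i :: w) = C.map i ∘ C.wordMap w from rfl, Set.image_comp]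
    exact (Set.image_mono ih).trans (C.maps_body i)

theorem wordMap_mem_body (w : List S) {y : ℂ} (hy : y ∈ stdBody N) : C.wordMap w y ∈ stdBody N :=
  C.wordMap_image_body w ⟨y, hy, rfl⟩

/-- The cell `Ψ w K`. -/
def cell (w : List S) : Set ℂ := C.wordMap w '' C.K

theorem cell_subset_K (w : List S) : C.cell w ⊆ C.K := by
  induction w with
  | nil => simp [cell, wordMap]
  | cons i w ih =>
    rintro _ ⟨y, hy, rfl⟩
    rw [C.K_eq]
    exact Set.mem_iUnion.2 ⟨i, _, ih ⟨y, hy, rfl⟩, rfl⟩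

theorem cell_append (w v : List S) : C.cell (w ++ v) = C.wordMap w '' C.cell v := by
  ext y
  constructor
  · rintro ⟨z, hz, rfl⟩
    exact ⟨_, ⟨z, hz, rfl⟩, (C.wordMap_append w v z).symm⟩
  · rintro ⟨_, ⟨z, hz, rfl⟩, rfl⟩
    exact ⟨z, hz, C.wordMap_append w v z⟩

theorem cell_append_subset (w v : List S) : C.cell (w ++ v) ⊆ C.cell w := by
  rw [cell_append]
  exact Set.image_mono (C.cell_subset_K v)

theorem cell_subset_body (w : List S) : C.cell w ⊆ stdBody N := (C.cell_subset_K w).trans C.K_subset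

theorem nonempty_cell (w : List S) : (C.cell w).Nonempty := C.nonempty_K.image _

theorem isPreconnected_cell (w : List S) : IsPreconnected (C.cell w) :=
  C.isPreconnected_K.image _ (C.isTile_wordMap w).continuous.continuousOn

theorem isCompact_cell (w : List S) : IsCompact (C.cell w) :=
  C.isCompact_K.image (C.isTile_wordMap w).continuous

section Act

variable [Finite S]

/-- The action of the symmetries on the words: `g` maps the tile of `w` to the tile of `act g w`. -/
noncomputable def act : polygonGroup N → List S → List S
  | _, [] => []
  | g, i :: w => (C.exists_perm g i).choose.1 :: act (C.exists_perm g i).choose.2 w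

theorem length_act (g : polygonGroup N) (w : List S) : (C.act g w).length = w.length := by
  induction w generalizing g with
  | nil => rfl
  | cons i w ih => rw [act, List.length_cons, List.length_cons, ih]

theorem exists_wordMap_act (g : polygonGroup N) (w : List S) :
    ∃ h : polygonGroup N, ∀ y, g.1 (C.wordMap w y) = C.wordMap (C.act g w) (h.1 y) := by
  induction w generalizing g with
  | nil => exact ⟨g, fun y => rfl⟩
  | cons i w ih =>
    obtain ⟨h, hh⟩ := ih (C.exists_perm g i).choose.2
    refine ⟨h, fun y => ?_⟩
    rw [wordMap_cons, act, wordMap_cons, (C.exists_perm g i).choose_spec, hh]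

/-- The attractor is invariant under the symmetries of the polygon. -/
theorem map_mem_K (g : polygonGroup N) {y : ℂ} (hy : y ∈ C.K) : g.1 y ∈ C.K := by
  have hcl := C.isCompact_K.isClosed
  have hb : ∀ n : ℕ, ∀ (g : polygonGroup N) (y : ℂ), y ∈ C.K →
      Metric.infDist (g.1 y) C.K ≤ C.ratio ^ n * 2 := by
    intro n
    induction n with
    | zero =>
      intro g y hy
      obtain ⟨z, hz⟩ := C.nonempty_K
      refine (Metric.infDist_le_dist_of_mem hz).trans ?_
      have h1 := norm_le_of_mem_stdBody (map_mem_stdBody g.2 (C.K_subset hy))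
      have h2 := norm_le_of_mem_stdBody (C.K_subset hz)
      rw [dist_eq_norm]
      linarith [norm_sub_le (g.1 y) z]
    | succ n ih =>
      intro g y hy
      rw [C.K_eq] at hy
      obtain ⟨i, y', hy', rfl⟩ := Set.mem_iUnion.1 hy
      obtain ⟨⟨j, h⟩, hh⟩ := C.exists_perm g i
      rw [hh, pow_succ', mul_assoc]
      refine le_trans ?_ (mul_le_mul_of_nonneg_left (ih h y' hy') C.ratio_pos.le)
      obtain ⟨z, hz, hzd⟩ := C.isCompact_K.exists_infDist_eq_dist C.nonempty_K (h.1 y')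
      rw [hzd, ← (C.isTile j).dist_eq C.ratio_pos]
      apply Metric.infDist_le_dist_of_mem
      rw [C.K_eq]
      exact Set.mem_iUnion.2 ⟨j, z, hz, rfl⟩
  rw [hcl.mem_iff_infDist_zero C.nonempty_K]
  refine le_antisymm ?_ Metric.infDist_nonneg
  have ht : Filter.Tendsto (fun n : ℕ => C.ratio ^ n * 2) Filter.atTop (nhds (0 * 2)) :=
    (tendsto_pow_atTop_nhds_zero_of_lt_one C.ratio_pos.le C.ratio_lt_one).mul_const 2
  rw [zero_mul] at ht
  exact ge_of_tendsto' ht fun n => hb n g y hy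

theorem map_mem_K_iff (g : polygonGroup N) {y : ℂ} : g.1 y ∈ C.K ↔ y ∈ C.K := by
  refine ⟨fun h => ?_, C.map_mem_K g⟩
  have := C.map_mem_K g⁻¹ h
  simpa using this

theorem mem_cell_act_iff (g : polygonGroup N) (w : List S) {y : ℂ} :
    g.1 y ∈ C.cell (C.act g w) ↔ y ∈ C.cell w := by
  obtain ⟨h, hh⟩ := C.exists_wordMap_act g w
  constructor
  · rintro ⟨z, hz, hzy⟩
    refine ⟨h.1.symm z, ?_, g.1.injective ?_⟩
    · rw [← C.map_mem_K_iff h]; simpa using hz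
    · rw [hh]; simpa using hzy
  · rintro ⟨z, hz, rfl⟩
    rw [hh]
    exact ⟨_, C.map_mem_K h hz, rfl⟩

/-- If two tiles of the same level meet in a point, then they are related by a symmetry that takes
the parameters of the point to each other, and that respects the smallest face that contains the
point: the face that consists of the points `b` of the polygon that lie on all the sides through
`a`. -/
theorem exists_gluing {x x' : List S} (hl : x.length = x'.length) {a a' : ℂ} (ha : a ∈ stdBody N)
    (ha' : a' ∈ stdBody N) (h : C.wordMap x a = C.wordMap x' a') :
    ∃ g : polygonGroup N, g.1 a = a' ∧ ∀ b ∈ stdBody N, (∀ k, a ∈ stdSide N k → b ∈ stdSide N k) →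
      C.wordMap x b = C.wordMap x' (g.1 b) := by
  have hN := C.three_le
  induction x generalizing x' a a' with
  | nil =>
    obtain rfl : x' = [] := List.length_eq_zero_iff.1 hl.symm
    exact ⟨1, h, fun b _ _ => rfl⟩
  | cons i x ih =>
    cases x' with
    | nil => simp at hl
    | cons j x' =>
    simp only [List.length_cons, add_left_inj] at hl
    rw [wordMap_cons, wordMap_cons] at h
    by_cases hij : i = j
    · subst hij
      obtain ⟨g, hg, hgb⟩ := ih hl ha ha' (C.map_injective i h)
      refine ⟨g, hg, fun b hb hb' => ?_⟩
      rw [wordMap_cons, wordMap_cons, hgb b hb hb']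
    -- a symmetry that matches the two polygons of level one, up to the face of the point
    have key : ∃ g : polygonGroup N, g.1 (C.wordMap x a) = C.wordMap x' a' ∧
        ∀ b ∈ stdBody N, (∀ k, a ∈ stdSide N k → b ∈ stdSide N k) →
          C.map i (C.wordMap x b) = C.map j (g.1 (C.wordMap x b)) := by
      have hvert : ∀ l : ℤ, a = spin N (2 * l) → ∀ b, (∀ k, a ∈ stdSide N k → b ∈ stdSide N k) → b = a := by
        rintro l rfl b hb
        refine stdSide_inter_stdSide hN (hb l (left_mem_stdSide l)) (hb (l - 1) ?_)
        have := right_mem_stdSide (N := N) (l - 1)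
        rwa [show 2 * (l - 1) + 2 = 2 * l by ring] at this
      have hm : C.map i (C.wordMap x a) ∈ C.map i '' stdBody N ∩ C.map j '' stdBody N :=
        ⟨⟨_, C.wordMap_mem_body x ha, rfl⟩, ⟨_, C.wordMap_mem_body x' ha', h.symm⟩⟩
      rcases C.touching i j hij ⟨_, hm⟩ with ⟨k, k', h1, h2⟩ | ⟨k, k', h1, h2⟩
      · obtain ⟨g, hg, hgk⟩ := exists_symmetry_of_common_side hN C.ratio_pos (C.isTile i) (C.isTile j) h2
        rw [h1] at hm
        obtain ⟨z, hz, hza⟩ := hm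
        obtain rfl := C.map_injective i hza
        refine ⟨⟨g, hg⟩, C.map_injective j ((hgk _ hz).symm.trans h), fun b hb hb' => hgk _ ?_⟩
        rcases (C.isTile_wordMap x).inter_stdSide hN (C.ratio_pow_pos _) (C.wordMap_image_body x) k with
          h3 | ⟨l, h3⟩ | ⟨l, h3⟩
        · have : C.wordMap x a ∈ C.wordMap x '' stdBody N ∩ stdSide N k := ⟨⟨a, ha, rfl⟩, hz⟩
          rw [h3] at this
          exact absurd this (Set.notMem_empty _)
        · have : C.wordMap x a ∈ C.wordMap x '' stdSide N l := h3 ▸ ⟨⟨a, ha, rfl⟩, hz⟩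
          obtain ⟨a₁, ha₁, e⟩ := this
          rw [C.wordMap_injective x e] at ha₁
          have : C.wordMap x b ∈ C.wordMap x '' stdSide N l := ⟨b, hb' l ha₁, rfl⟩
          rw [← h3] at this
          exact this.2
        · have : C.wordMap x a ∈ ({C.wordMap x (spin N (2 * l))} : Set ℂ) := h3 ▸ ⟨⟨a, ha, rfl⟩, hz⟩
          rw [hvert l (C.wordMap_injective x this) b hb']
          exact hz
      · rw [h1] at hm
        have e1 : C.wordMap x a = spin N (2 * k) := C.map_injective i hm
        have e2 : C.wordMap x' a' = spin N (2 * k') := C.map_injective j (by rw [← h, e1, h2])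
        obtain ⟨g, hg, hgk⟩ := exists_spin_to_spin (N := N) k k'
        refine ⟨⟨g, hg⟩, by rw [e1, e2]; exact hgk, fun b hb hb' => ?_⟩
        obtain ⟨l, hl⟩ := (C.isTile_wordMap x).eq_spin_of_map_eq_spin hN (C.ratio_pow_pos _)
          (C.wordMap_image_body x) ha e1
        rw [hvert l hl b hb', e1, h2]
        simp only
        rw [hgk]
    obtain ⟨g, hg, hgb⟩ := key
    obtain ⟨h', hh'⟩ := C.exists_wordMap_act g⁻¹ x'
    have hinv : ∀ z, (g⁻¹).1 (g.1 z) = z := fun z => g.1.symm_apply_apply z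
    obtain ⟨k, hk, hkb⟩ := ih (x' := C.act g⁻¹ x') (a' := h'.1 a') (by rw [length_act, hl]) ha
      (map_mem_stdBody h'.2 ha') (by rw [← hh', ← hg, hinv])
    have hinv' : ∀ z, h'.1 ((h'⁻¹).1 z) = z := fun z => h'.1.apply_symm_apply z
    refine ⟨h'⁻¹ * k, ?_, fun b hb hb' => ?_⟩
    · apply h'.1.injective
      rw [← hk]
      exact hinv' _
    · rw [wordMap_cons, wordMap_cons, hgb b hb hb']
      congr 1
      apply (g⁻¹).1.injective
      rw [hinv, hh', hkb b hb hb']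
      congr 1
      exact (hinv' _).symm

end Act

end Carpet

end PolygonCarpet

/-! ### Tiles and cells of the same level -/

namespace PolygonCarpet

namespace Carpet

variable {N : ℕ} {S : Type*} [Finite S] (C : Carpet N S)

theorem eq_of_center_eq {x x' : List S} (hl : x.length = x'.length)
    (h : C.wordMap x 0 = C.wordMap x' 0) : x = x' := by
  have hN := C.three_le
  induction x generalizing x' with
  | nil => exact (List.length_eq_zero_iff.1 hl.symm).symm
  | cons i x ih =>
    cases x' with
    | nil => simp at hl
    | cons j x' =>
    simp only [List.length_cons, add_left_inj] at hl
    rw [wordMap_cons, wordMap_cons] at h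
    by_cases hij : i = j
    · subst hij
      rw [ih hl (C.map_injective i h)]
    exfalso
    have h0 := zero_mem_body hN
    have hm : C.map i (C.wordMap x 0) ∈ C.map i '' stdBody N ∩ C.map j '' stdBody N :=
      ⟨⟨_, C.wordMap_mem_body x h0, rfl⟩, ⟨_, C.wordMap_mem_body x' h0, h.symm⟩⟩
    have hc := (C.isTile_wordMap x).center_notMem_stdSide hN (C.ratio_pow_pos _) (C.wordMap_image_body x)
    rcases C.touching i j hij ⟨_, hm⟩ with ⟨k, k', h1, h2⟩ | ⟨k, k', h1, h2⟩
    · rw [h1] at hm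
      obtain ⟨z, hz, hza⟩ := hm
      obtain rfl := C.map_injective i hza
      exact hc k hz
    · rw [h1] at hm
      apply hc k
      rw [C.map_injective i hm]
      exact left_mem_stdSide k

theorem act_injective (g : polygonGroup N) {u v : List S} (hl : u.length = v.length)
    (h : C.act g u = C.act g v) : u = v := by
  obtain ⟨h1, hh1⟩ := C.exists_wordMap_act g u
  obtain ⟨h2, hh2⟩ := C.exists_wordMap_act g v
  apply C.eq_of_center_eq hl
  apply g.1.injective
  rw [hh1, hh2, h, map_zero, map_zero]

/-- Different tiles of the same level only meet in their boundaries. -/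
theorem exists_mem_stdSide {x x' : List S} (hl : x.length = x'.length) (hne : x ≠ x') {a a' : ℂ}
    (ha : a ∈ stdBody N) (ha' : a' ∈ stdBody N) (h : C.wordMap x a = C.wordMap x' a') :
    ∃ k, a ∈ stdSide N k := by
  by_contra hk
  push Not at hk
  obtain ⟨g, -, hg⟩ := C.exists_gluing hl ha ha' h
  have := hg 0 (zero_mem_body C.three_le) (fun k hk' => absurd hk' (hk k))
  rw [map_zero] at this
  exact hne (C.eq_of_center_eq hl this)

/-- The centers of different tiles of level `n` have at least a certain distance. -/
theorem exists_separation : ∃ r₀ > 0, ∀ x x' : List S, x.length = x'.length → x ≠ x' →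
    r₀ * C.ratio ^ x.length ≤ dist (C.wordMap x 0) (C.wordMap x' 0) := by
  obtain ⟨r₀, hr₀, hb⟩ := exists_ball_subset_stdBody C.three_le
  refine ⟨r₀, hr₀, fun x x' hl hne => ?_⟩
  by_contra! hlt
  obtain ⟨ε, b, hε, hf⟩ := C.isTile_wordMap x'
  have hp := C.ratio_pow_pos x'.length
  have hε' : (ε : ℂ) * ε = 1 := by rcases hε with rfl | rfl <;> norm_num
  have hpc : ((C.ratio : ℂ) ^ x'.length) ≠ 0 := pow_ne_zero _ (by exact_mod_cast C.ratio_pos.ne')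
  set a := (ε : ℂ) * (C.wordMap x 0 - b) / (C.ratio : ℂ) ^ x'.length with ha
  have hfa : C.wordMap x' a = C.wordMap x 0 := by
    rw [hf, ha]; push_cast; field_simp
    linear_combination (C.wordMap x 0 - b) * hε'
  have haB : a ∈ stdBody N := by
    apply hb
    have := C.dist_wordMap x' a 0
    rw [hfa, ← hl] at this
    rw [this, mul_comm r₀] at hlt
    exact lt_of_mul_lt_mul_left hlt (C.ratio_pow_pos _).le
  obtain ⟨k, hk⟩ := C.exists_mem_stdSide hl hne (zero_mem_body C.three_le) haB hfa.symm
  have := norm_ge_of_mem_stdSide hk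
  rw [norm_zero] at this
  linarith [cos_pi_div_pos C.three_le]

/-- The attractor meets the boundary of the polygon: otherwise the cells of level one would be
disjoint. -/
theorem exists_mem_K_stdSide [Nontrivial S] (k : ℤ) : (C.K ∩ stdSide N k).Nonempty := by
  suffices h : ∃ k, (C.K ∩ stdSide N k).Nonempty by
    obtain ⟨l, y, hy, hyl⟩ := h
    obtain ⟨g, hg, hgl⟩ := exists_side_to_side (N := N) l k
    exact ⟨g y, C.map_mem_K ⟨g, hg⟩ hy, hgl ▸ ⟨y, hyl, rfl⟩⟩
  by_contra! hk
  have hdisj : ∀ i j, i ≠ j → Disjoint (C.map i '' C.K) (C.map j '' C.K) := by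
    intro i j hij
    rw [Set.disjoint_left]
    rintro _ ⟨a, ha, rfl⟩ ⟨a', ha', h⟩
    obtain ⟨k, hk'⟩ := C.exists_mem_stdSide (x := [i]) (x' := [j]) rfl (by simpa using hij)
      (C.K_subset ha) (C.K_subset ha') h.symm
    have := hk k
    exact Set.eq_empty_iff_forall_notMem.1 this a ⟨ha, hk'⟩
  obtain ⟨i, j, hij⟩ := exists_pair_ne S
  have hclosed : ∀ i, IsClosed (C.map i '' C.K) := fun i =>
    (C.isCompact_K.image (C.isTile i).continuous).isClosed
  have hrest : IsClosed (⋃ l ∈ {l | l ≠ i}, C.map l '' C.K) :=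
    (Set.toFinite _).isClosed_biUnion fun l _ => hclosed l
  have hd : Disjoint (C.map i '' C.K) (⋃ l ∈ {l | l ≠ i}, C.map l '' C.K) := by
    rw [Set.disjoint_iUnion₂_right]
    exact fun l hl => hdisj i l (Ne.symm hl)
  have hsub : C.K ⊆ (C.map i '' C.K) ∪ ⋃ l ∈ {l | l ≠ i}, C.map l '' C.K := by
    intro y hy
    rw [C.K_eq] at hy
    obtain ⟨l, hl⟩ := Set.mem_iUnion.1 hy
    by_cases hli : l = i
    · exact Or.inl (hli ▸ hl)
    · exact Or.inr (Set.mem_biUnion hli hl)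
  obtain ⟨y, hy⟩ := C.nonempty_K
  have hin : ∀ l, C.map l y ∈ C.K := fun l => by
    rw [C.K_eq]; exact Set.mem_iUnion.2 ⟨l, y, hy, rfl⟩
  obtain ⟨z, -, hz⟩ := (isPreconnected_closed_iff.1 C.isPreconnected_K) _ _ (hclosed i) hrest hsub
    ⟨_, hin i, y, hy, rfl⟩ ⟨_, hin j, Set.mem_biUnion (Ne.symm hij) ⟨y, hy, rfl⟩⟩
  exact Set.disjoint_left.1 hd hz.1 hz.2

/-- If a small polygon contains a vertex of the polygon, then the attractor contains all the
vertices. -/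
theorem spin_mem_K {i : S} {k : ℤ} (h : spin N (2 * k) ∈ C.map i '' stdBody N) (l : ℤ) :
    spin N (2 * l) ∈ C.K := by
  have hsame : ∀ j j', Metric.infDist (spin N (2 * j)) C.K ≤ Metric.infDist (spin N (2 * j')) C.K := by
    intro j j'
    obtain ⟨g, hg, hgj⟩ := exists_spin_to_spin (N := N) j' j
    obtain ⟨z, hz, hzd⟩ := C.isCompact_K.exists_infDist_eq_dist C.nonempty_K (spin N (2 * j'))
    rw [hzd, ← g.isometry.dist_eq, hgj]
    exact Metric.infDist_le_dist_of_mem (C.map_mem_K ⟨g, hg⟩ hz)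
  obtain ⟨y, hy, hyk⟩ := h
  obtain ⟨j, rfl⟩ := (C.isTile i).eq_spin_of_map_eq_spin C.three_le C.ratio_pos (C.maps_body i) hy hyk
  obtain ⟨z, hz, hzd⟩ := C.isCompact_K.exists_infDist_eq_dist C.nonempty_K (spin N (2 * j))
  have h1 : Metric.infDist (spin N (2 * k)) C.K ≤ C.ratio * Metric.infDist (spin N (2 * j)) C.K := by
    rw [hzd, ← (C.isTile i).dist_eq C.ratio_pos, hyk]
    apply Metric.infDist_le_dist_of_mem
    rw [C.K_eq]
    exact Set.mem_iUnion.2 ⟨i, z, hz, rfl⟩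
  have h2 := hsame j k
  have h3 := hsame l k
  have h4 : 0 ≤ Metric.infDist (spin N (2 * k)) C.K := Metric.infDist_nonneg
  have h5 : Metric.infDist (spin N (2 * k)) C.K ≤ 0 := by
    nlinarith [C.ratio_lt_one, C.ratio_pos]
  rw [C.isCompact_K.isClosed.mem_iff_infDist_zero C.nonempty_K]
  exact le_antisymm (h3.trans h5) Metric.infDist_nonneg

/-- Some small polygon has a side on the side `0` of the polygon. -/
theorem exists_side_subset_side [Nontrivial S] : ∃ i l, C.map i '' stdSide N l ⊆ stdSide N 0 := by
  obtain ⟨y, hy, hy0⟩ := C.exists_mem_K_stdSide 0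
  rw [C.K_eq] at hy
  obtain ⟨i, a, ha, rfl⟩ := Set.mem_iUnion.1 hy
  have hm : C.map i a ∈ C.map i '' stdBody N ∩ stdSide N 0 := ⟨⟨a, C.K_subset ha, rfl⟩, hy0⟩
  rcases (C.isTile i).inter_stdSide C.three_le C.ratio_pos (C.maps_body i) 0 with h | ⟨l, h⟩ | ⟨l, h⟩
  · rw [h] at hm; exact absurd hm (Set.notMem_empty _)
  · exact ⟨i, l, h ▸ Set.inter_subset_right⟩
  · rw [h] at hm
    have hal := C.map_injective i hm
    rw [C.K_eq] at ha
    obtain ⟨j, b, hb, hba⟩ := Set.mem_iUnion.1 ha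
    have h0 : spin N (2 * 0) ∈ C.K :=
      C.spin_mem_K (i := j) (k := l) (hal ▸ ⟨b, C.K_subset hb, hba⟩) 0
    rw [C.K_eq] at h0
    obtain ⟨i', b', hb', hbb'⟩ := Set.mem_iUnion.1 h0
    obtain ⟨l', hl'⟩ := (C.isTile i').exists_side_of_corner C.three_le C.ratio_pos (C.maps_body i')
      ⟨b', C.K_subset hb', by simpa using hbb'⟩
    exact ⟨i', l', hl'⟩

/-- Different tiles of the same level that meet in a point of a side of the polygon meet in a common
vertex. -/
theorem exists_eq_spin_of_mem_stdSide {x x' : List S} (hl : x.length = x'.length) (hne : x ≠ x')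
    {a a' : ℂ} (ha : a ∈ stdBody N) (ha' : a' ∈ stdBody N) (h : C.wordMap x a = C.wordMap x' a') {k : ℤ}
    (hk : C.wordMap x a ∈ stdSide N k) : ∃ l, a = spin N (2 * l) := by
  have hN := C.three_le
  induction x generalizing x' k with
  | nil => exact absurd (List.length_eq_zero_iff.1 hl.symm).symm hne
  | cons i x ih =>
    cases x' with
    | nil => simp at hl
    | cons j x' =>
    simp only [List.length_cons, add_left_inj] at hl
    rw [wordMap_cons, wordMap_cons] at h
    rw [wordMap_cons] at hk
    have hvert : ∀ l, C.wordMap x a = spin N (2 * l) → ∃ l, a = spin N (2 * l) := fun l hl =>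
      (C.isTile_wordMap x).eq_spin_of_map_eq_spin hN (C.ratio_pow_pos _) (C.wordMap_image_body x) ha hl
    by_cases hij : i = j
    · subst hij
      have hm : C.map i (C.wordMap x a) ∈ C.map i '' stdBody N ∩ stdSide N k :=
        ⟨⟨_, C.wordMap_mem_body x ha, rfl⟩, hk⟩
      rcases (C.isTile i).inter_stdSide hN C.ratio_pos (C.maps_body i) k with h1 | ⟨l, h1⟩ | ⟨l, h1⟩
      · rw [h1] at hm; exact absurd hm (Set.notMem_empty _)
      · rw [h1] at hm
        obtain ⟨z, hz, hza⟩ := hm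
        obtain rfl := C.map_injective i hza
        exact ih hl (fun e => hne (by rw [e])) (C.map_injective i h) hz
      · rw [h1] at hm
        exact hvert l (C.map_injective i hm)
    have hm : C.map i (C.wordMap x a) ∈ C.map i '' stdBody N ∩ C.map j '' stdBody N :=
      ⟨⟨_, C.wordMap_mem_body x ha, rfl⟩, ⟨_, C.wordMap_mem_body x' ha', h.symm⟩⟩
    rcases C.touching i j hij ⟨_, hm⟩ with ⟨l, l', h1, h2⟩ | ⟨l, l', h1, h2⟩
    · have hm' := hm
      rw [h1] at hm'
      obtain ⟨z, hz, hza⟩ := hm'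
      obtain rfl := C.map_injective i hza
      obtain ⟨p, q, hp, hq, hpq, hz'⟩ := hz
      rcases hp.eq_or_lt with rfl | hp
      · apply hvert (l + 1)
        rw [← hz', show q = 1 by linarith, zero_smul, one_smul, zero_add]
        ring_nf
      rcases hq.eq_or_lt with rfl | hq
      · apply hvert l
        rw [← hz', show p = 1 by linarith, zero_smul, one_smul, add_zero]
      -- the common side of the small polygons lies on a side of the polygon: the midpoint of their
      -- centers is on this side, while the centers are not
      exfalso
      have hN0 : N ≠ 0 := by omega
      obtain ⟨e1, e2, e3⟩ := centers_of_common_side hN C.ratio_pos (C.isTile i) (C.isTile j) h2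
      have hle : ∀ i, ∀ y ∈ stdBody N, height N (2 * k + 1) (C.map i y) ≤ Real.cos (Real.pi / N) :=
        fun i y hy => height_le_of_mem_stdBody hN0 (C.maps_body i ⟨y, hy, rfl⟩) k
      have hlt : ∀ i, height N (2 * k + 1) (C.map i 0) < Real.cos (Real.pi / N) := fun i =>
        lt_of_le_of_ne (hle i 0 (zero_mem_body hN)) fun he =>
          (C.isTile i).center_notMem_stdSide hN C.ratio_pos (C.maps_body i) k
            (mem_stdSide_of_height hN0 (C.maps_body i ⟨0, zero_mem_body hN, rfl⟩) he)
      have hne0 : C.map i 0 ≠ C.map j 0 := fun he => hij (by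
        simpa using C.eq_of_center_eq (x := [i]) (x' := [j]) rfl he)
      have hmid := congrArg (height N (2 * k + 1)) (e3 hne0)
      rw [← midpoint_side, (C.isTile i).combo (by norm_num), map_add,
        show (2 : ℂ) * ((1 / 2 : ℝ) • C.map i (spin N (2 * l)) + (1 / 2 : ℝ) • C.map i (spin N (2 * l + 2)))
          = C.map i (spin N (2 * l)) + C.map i (spin N (2 * l + 2)) by
            simp only [Complex.real_smul]; push_cast; ring, map_add] at hmid
      have hk' := height_of_mem_stdSide hk
      rw [← hz', (C.isTile i).combo hpq, map_add, map_smul, map_smul, smul_eq_mul, smul_eq_mul] at hk'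
      have b1 := hle i _ (stdSide_subset l (left_mem_stdSide l))
      have b2 := hle i _ (stdSide_subset l (right_mem_stdSide l))
      have b3 := hlt i
      have b4 := hlt j
      obtain rfl : p = 1 - q := by linarith
      generalize height N (2 * k + 1) (C.map i (spin N (2 * l))) = s at *
      generalize height N (2 * k + 1) (C.map i (spin N (2 * l + 2))) = t at *
      rcases lt_or_ge s (Real.cos (Real.pi / N)) with hs | hs
      · nlinarith
      rcases lt_or_ge t (Real.cos (Real.pi / N)) with ht | ht
      · nlinarith
      linarith
    · rw [h1] at hm
      exact hvert l (C.map_injective i hm)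

/-- Tiles of the same level that meet in a point that is not a vertex of them have intersecting
cells. -/
theorem cell_inter_nonempty_of_ne_spin [Nontrivial S] {x x' : List S} (hl : x.length = x'.length)
    {a a' : ℂ} (ha : a ∈ stdBody N) (ha' : a' ∈ stdBody N) (h : C.wordMap x a = C.wordMap x' a')
    (hv : ∀ l, a ≠ spin N (2 * l)) : (C.cell x ∩ C.cell x').Nonempty := by
  have hN := C.three_le
  induction x generalizing x' with
  | nil =>
    obtain rfl := (List.length_eq_zero_iff.1 hl.symm)
    rw [Set.inter_self]
    exact C.nonempty_cell _
  | cons i x ih =>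
    cases x' with
    | nil => simp at hl
    | cons j x' =>
    simp only [List.length_cons, add_left_inj] at hl
    rw [wordMap_cons, wordMap_cons] at h
    by_cases hij : i = j
    · subst hij
      obtain ⟨y, ⟨z, hz, rfl⟩, ⟨z', hz', e⟩⟩ := ih hl (C.map_injective i h)
      exact ⟨C.map i (C.wordMap x z), ⟨z, hz, rfl⟩, ⟨z', hz', congrArg (C.map i) e⟩⟩
    have hvert : ∀ l, C.wordMap x a ≠ spin N (2 * l) := fun l hl => by
      obtain ⟨l', e⟩ := (C.isTile_wordMap x).eq_spin_of_map_eq_spin hN (C.ratio_pow_pos _)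
        (C.wordMap_image_body x) ha hl
      exact hv l' e
    have hm : C.map i (C.wordMap x a) ∈ C.map i '' stdBody N ∩ C.map j '' stdBody N :=
      ⟨⟨_, C.wordMap_mem_body x ha, rfl⟩, ⟨_, C.wordMap_mem_body x' ha', h.symm⟩⟩
    rcases C.touching i j hij ⟨_, hm⟩ with ⟨k, k', h1, h2⟩ | ⟨k, k', h1, h2⟩
    · obtain ⟨g, hg, hgk⟩ := exists_symmetry_of_common_side hN C.ratio_pos (C.isTile i) (C.isTile j) h2
      rw [h1] at hm
      obtain ⟨z, hz, hza⟩ := hm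
      obtain rfl := C.map_injective i hza
      have hgz := C.map_injective j ((hgk _ hz).symm.trans h)
      obtain ⟨h', hh'⟩ := C.exists_wordMap_act (⟨g, hg⟩⁻¹ : polygonGroup N) x'
      have hinv : ∀ z, ((⟨g, hg⟩⁻¹ : polygonGroup N)).1 (g z) = z := fun z => g.symm_apply_apply z
      have hxx : x = C.act (⟨g, hg⟩⁻¹ : polygonGroup N) x' := by
        by_contra hne
        obtain ⟨l, e⟩ := C.exists_eq_spin_of_mem_stdSide (by rw [length_act, hl]) hne ha
          (map_mem_stdBody h'.2 ha') (by rw [← hh', ← hgz, hinv]) hz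
        exact hv l e
      have hm : C.wordMap x a ∈ C.wordMap x '' stdBody N ∩ stdSide N k := ⟨⟨a, ha, rfl⟩, hz⟩
      rcases (C.isTile_wordMap x).inter_stdSide hN (C.ratio_pow_pos _) (C.wordMap_image_body x) k with
        h3 | ⟨l, h3⟩ | ⟨l, h3⟩
      · rw [h3] at hm; exact absurd hm (Set.notMem_empty _)
      · obtain ⟨b, hb, hbl⟩ := C.exists_mem_K_stdSide l
        have hbk : C.wordMap x b ∈ C.wordMap x '' stdBody N ∩ stdSide N k := h3 ▸ ⟨b, hbl, rfl⟩
        refine ⟨C.map i (C.wordMap x b), ⟨b, hb, rfl⟩, ?_⟩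
        have : g (C.wordMap x b) ∈ C.cell x' := by
          rw [← C.mem_cell_act_iff (⟨g, hg⟩⁻¹ : polygonGroup N), hinv, ← hxx]
          exact ⟨b, hb, rfl⟩
        obtain ⟨c, hc, hcb⟩ := this
        exact ⟨c, hc, by rw [wordMap_cons, hcb, hgk _ hbk.2]⟩
      · rw [h3] at hm
        exact absurd (C.wordMap_injective x hm) (hv l)
    · rw [h1] at hm
      exact absurd (C.map_injective i hm) (hvert k)

/-- If subtiles of deeper levels of two tiles have a common vertex, then the cells of the tiles
intersect. -/
theorem cell_inter_nonempty_of_common_vertex [Nontrivial S] {x x' s s' : List S}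
    (hl : x.length = x'.length) (hs : s ≠ []) {k k' : ℤ}
    (h : C.wordMap (x ++ s) (spin N (2 * k)) = C.wordMap (x' ++ s') (spin N (2 * k'))) :
    (C.cell x ∩ C.cell x').Nonempty := by
  by_cases hK : ∀ l, spin N (2 * l) ∈ C.K
  · refine ⟨C.wordMap (x ++ s) (spin N (2 * k)), ?_, ?_⟩
    · exact C.cell_append_subset _ _ ⟨_, hK k, rfl⟩
    · rw [h]; exact C.cell_append_subset _ _ ⟨_, hK k', rfl⟩
  · rw [wordMap_append, wordMap_append] at h
    have hb : ∀ s k, C.wordMap s (spin N (2 * k)) ∈ stdBody N := fun s k =>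
      C.wordMap_mem_body _ (spin_mem_stdBody k)
    refine C.cell_inter_nonempty_of_ne_spin hl (hb _ _) (hb _ _) h fun l hl => hK ?_
    cases s with
    | nil => exact absurd rfl hs
    | cons i s => exact C.spin_mem_K (i := i) (k := l) ⟨_, hb s k, hl⟩

end Carpet

end PolygonCarpet

/-! ### Skeletons and folding -/

namespace PolygonCarpet

/-- The words of length `n`. -/
noncomputable def words (S : Type*) [Finite S] (n : ℕ) : Finset (List S) :=
  (List.finite_length_eq S n).toFinset

theorem mem_words {S : Type*} [Finite S] {n : ℕ} {w : List S} : w ∈ words S n ↔ w.length = n := by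
  simp [words]

namespace Carpet

variable {N : ℕ} {S : Type*} [Finite S] (C : Carpet N S)

/-- The union of the cells of a finite set of words. -/
def realization (F : Finset (List S)) : Set ℂ := ⋃ u ∈ F, C.cell u

theorem mem_realization {F : Finset (List S)} {y : ℂ} : y ∈ C.realization F ↔ ∃ u ∈ F, y ∈ C.cell u := by
  simp [realization]

theorem cell_subset_realization {F : Finset (List S)} {u : List S} (hu : u ∈ F) :
    C.cell u ⊆ C.realization F := Set.subset_biUnion_of_mem (u := fun u => C.cell u) hu

theorem isCompact_realization (F : Finset (List S)) : IsCompact (C.realization F) :=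
  F.finite_toSet.isCompact_biUnion fun u _ => C.isCompact_cell u

theorem realization_subset_body (F : Finset (List S)) : C.realization F ⊆ stdBody N :=
  Set.iUnion₂_subset fun u _ => C.cell_subset_body u

/-- Two words of `F` with intersecting cells. -/
def Meets (F : Finset (List S)) (u v : List S) : Prop :=
  u ∈ F ∧ v ∈ F ∧ (C.cell u ∩ C.cell v).Nonempty

/-- The words of `F` are connected to each other by chains of words of `F` whose consecutive cells
intersect. -/
def IsLinked (F : Finset (List S)) : Prop :=
  ∀ u ∈ F, ∀ v ∈ F, Relation.ReflTransGen (C.Meets F) u v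

theorem Meets.symm {F : Finset (List S)} {u v : List S} (h : C.Meets F u v) : C.Meets F v u :=
  ⟨h.2.1, h.1, by rw [Set.inter_comm]; exact h.2.2⟩

theorem isLinked_of_isPreconnected {F : Finset (List S)} (h : IsPreconnected (C.realization F)) :
    C.IsLinked F := by
  intro u hu v hv
  by_contra hcon
  have hcl : ∀ G : Set (List S), G ⊆ F → IsClosed (⋃ w ∈ G, C.cell w) := fun G hG =>
    (F.finite_toSet.subset hG).isClosed_biUnion fun w _ => (C.isCompact_cell w).isClosed
  set R : Set (List S) := {w | w ∈ F ∧ Relation.ReflTransGen (C.Meets F) u w} with hR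
  set R' : Set (List S) := {w | w ∈ F ∧ ¬ Relation.ReflTransGen (C.Meets F) u w} with hR'
  obtain ⟨a, ha⟩ := C.nonempty_cell u
  obtain ⟨b, hb⟩ := C.nonempty_cell v
  obtain ⟨z, -, hz, hz'⟩ := (isPreconnected_closed_iff.1 h) _ _ (hcl R fun w hw => hw.1)
    (hcl R' fun w hw => hw.1)
    (by
      intro y hy
      obtain ⟨w, hw, hyw⟩ := C.mem_realization.1 hy
      by_cases hr : Relation.ReflTransGen (C.Meets F) u w
      · exact Or.inl (Set.mem_biUnion (show w ∈ R from ⟨hw, hr⟩) hyw)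
      · exact Or.inr (Set.mem_biUnion (show w ∈ R' from ⟨hw, hr⟩) hyw))
    ⟨a, C.cell_subset_realization hu ha, Set.mem_biUnion (show u ∈ R from ⟨hu, .refl⟩) ha⟩
    ⟨b, C.cell_subset_realization hv hb, Set.mem_biUnion (show v ∈ R' from ⟨hv, hcon⟩) hb⟩
  obtain ⟨w, hw, hzw⟩ := Set.mem_iUnion₂.1 hz
  obtain ⟨w', hw', hzw'⟩ := Set.mem_iUnion₂.1 hz'
  exact hw'.2 (hw.2.tail ⟨hw.1, hw'.1, z, hzw, hzw'⟩)

theorem IsLinked.exists_eq {F : Finset (List S)} (h : C.IsLinked F) {α : Type*} {p : List S → α}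
    (hp : ∀ u ∈ F, ∀ v ∈ F, (C.cell u ∩ C.cell v).Nonempty → p u = p v) {u v : List S}
    (hu : u ∈ F) (hv : v ∈ F) : p u = p v := by
  induction h u hu v hv with
  | refl => rfl
  | tail _ hbc ih => exact (ih hbc.1).trans (hp _ hbc.1 _ hbc.2.1 hbc.2.2)

/-- A set of words of length `j` whose cells form a connected set that is invariant under the
symmetries of the polygon, and that meets the boundary of the polygon. -/
structure IsSkeleton (j : ℕ) (F : Finset (List S)) : Prop where
  length_eq : ∀ u ∈ F, u.length = j
  isPreconnected : IsPreconnected (C.realization F)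
  invariant : ∀ g : polygonGroup N, ∀ y ∈ C.realization F, g.1 y ∈ C.realization F
  boundary : ∃ k, (C.realization F ∩ stdSide N k).Nonempty

variable {C} in
theorem IsSkeleton.inter_stdSide_nonempty {j : ℕ} {F : Finset (List S)} (h : C.IsSkeleton j F) (k : ℤ) :
    (C.realization F ∩ stdSide N k).Nonempty := by
  obtain ⟨l, y, hy, hyl⟩ := h.boundary
  obtain ⟨g, hg, hgl⟩ := exists_side_to_side (N := N) l k
  exact ⟨g y, h.invariant ⟨g, hg⟩ y hy, hgl ▸ ⟨y, hyl, rfl⟩⟩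

/-- Any two skeletons of the same level cross each other. -/
theorem IsSkeleton.exists_crossing {j : ℕ} {F F' : Finset (List S)} (h : C.IsSkeleton j F)
    (h' : C.IsSkeleton j F') : ∃ u ∈ F, ∃ v ∈ F', (C.cell u ∩ C.cell v).Nonempty := by
  obtain ⟨y, hy, hy'⟩ := inter_nonempty_of_invariant C.three_le (C.isCompact_realization F)
    (C.isCompact_realization F') h.isPreconnected h'.isPreconnected (C.realization_subset_body F)
    (C.realization_subset_body F') (fun g hg => h.invariant ⟨g, hg⟩) (fun g hg => h'.invariant ⟨g, hg⟩)
    h.boundary h'.boundary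
  obtain ⟨u, hu, hyu⟩ := C.mem_realization.1 hy
  obtain ⟨v, hv, hyv⟩ := C.mem_realization.1 hy'
  exact ⟨u, hu, v, hv, y, hyu, hyv⟩

theorem IsSkeleton.nonempty {j : ℕ} {F : Finset (List S)} (h : C.IsSkeleton j F) : F.Nonempty := by
  obtain ⟨k, y, hy, -⟩ := h.boundary
  obtain ⟨u, hu, -⟩ := C.mem_realization.1 hy
  exact ⟨u, hu⟩

open scoped Classical in
/-- The words `i :: u` for all letters `i` and all `u ∈ F`. -/
noncomputable def extend [Fintype S] (F : Finset (List S)) : Finset (List S) :=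
  Finset.univ.biUnion fun i : S => F.image (List.cons i)

theorem mem_extend [Fintype S] {F : Finset (List S)} {v : List S} :
    v ∈ extend F ↔ ∃ i, ∃ u ∈ F, i :: u = v := by
  simp [extend]

theorem realization_extend [Fintype S] (F : Finset (List S)) :
    C.realization (extend F) = ⋃ i, C.map i '' C.realization F := by
  ext y
  rw [mem_realization, Set.mem_iUnion]
  constructor
  · rintro ⟨_, hv, hy⟩
    obtain ⟨i, u, hu, rfl⟩ := mem_extend.1 hv
    obtain ⟨z, hz, rfl⟩ := hy
    exact ⟨i, C.wordMap u z, C.cell_subset_realization hu ⟨z, hz, rfl⟩, rfl⟩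
  · rintro ⟨i, y, hy, rfl⟩
    obtain ⟨u, hu, z, hz, rfl⟩ := C.mem_realization.1 hy
    exact ⟨i :: u, mem_extend.2 ⟨i, u, hu, rfl⟩, z, hz, rfl⟩

theorem IsSkeleton.extend [Fintype S] [Nontrivial S] {j : ℕ} {F : Finset (List S)}
    (h : C.IsSkeleton j F) : C.IsSkeleton (j + 1) (extend F) := by
  refine ⟨?_, ?_, ?_, 0, ?_⟩
  · intro v hv
    obtain ⟨i, u, hu, rfl⟩ := mem_extend.1 hv
    rw [List.length_cons, h.length_eq u hu]
  · rw [realization_extend]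
    apply IsPreconnected.iUnion_of_reflTransGen
    · exact fun i => h.isPreconnected.image _ (C.isTile i).continuous.continuousOn
    · intro i j
      refine Relation.ReflTransGen.mono ?_ _ _ (C.chain i j)
      rintro i j ⟨k, k', -, h2⟩
      obtain ⟨g, hg, hgk⟩ := exists_symmetry_of_common_side C.three_le C.ratio_pos (C.isTile i)
        (C.isTile j) h2
      obtain ⟨y, hy, hyk⟩ := h.inter_stdSide_nonempty k
      exact ⟨C.map i y, ⟨y, hy, rfl⟩, g y, h.invariant ⟨g, hg⟩ y hy, (hgk y hyk).symm⟩
  · rw [realization_extend]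
    intro g y hy
    obtain ⟨i, z, hz, rfl⟩ := Set.mem_iUnion.1 hy
    obtain ⟨⟨j, h'⟩, hh⟩ := C.exists_perm g i
    rw [hh]
    exact Set.mem_iUnion.2 ⟨j, _, h.invariant h' z hz, rfl⟩
  · rw [realization_extend]
    obtain ⟨i, l, hil⟩ := C.exists_side_subset_side
    obtain ⟨y, hy, hyl⟩ := h.inter_stdSide_nonempty l
    exact ⟨C.map i y, Set.mem_iUnion.2 ⟨i, y, hy, rfl⟩, hil ⟨y, hyl, rfl⟩⟩

open scoped Classical in
/-- The words of length `j` that are obtained from the words of `F` by removing their first `n`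
letters and by applying the symmetries. -/
noncomputable def fold (n j : ℕ) (F : Finset (List S)) : Finset (List S) :=
  (words S j).filter fun u => ∃ v ∈ F, ∃ g, C.act g (v.drop n) = u

theorem mem_fold {n j : ℕ} {F : Finset (List S)} {u : List S} :
    u ∈ C.fold n j F ↔ u.length = j ∧ ∃ v ∈ F, ∃ g, C.act g (v.drop n) = u := by
  classical
  rw [fold, Finset.mem_filter, mem_words]

theorem mem_realization_fold {n j : ℕ} {F : Finset (List S)} (hF : ∀ v ∈ F, v.length = n + j) {y : ℂ} :
    y ∈ C.realization (C.fold n j F) ↔ ∃ v ∈ F, ∃ g : polygonGroup N, g.1 y ∈ C.cell (v.drop n) := by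
  rw [mem_realization]
  constructor
  · rintro ⟨u, hu, hy⟩
    obtain ⟨-, v, hv, g, rfl⟩ := C.mem_fold.1 hu
    refine ⟨v, hv, g⁻¹, (C.mem_cell_act_iff g _).1 ?_⟩
    have : g.1 ((g⁻¹).1 y) = y := g.1.apply_symm_apply y
    rwa [this]
  · rintro ⟨v, hv, g, hy⟩
    refine ⟨C.act g⁻¹ (v.drop n), C.mem_fold.2 ⟨?_, v, hv, g⁻¹, rfl⟩, ?_⟩
    · rw [length_act, List.length_drop, hF v hv]; omega
    · rw [← C.mem_cell_act_iff g⁻¹] at hy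
      have : (g⁻¹).1 (g.1 y) = y := g.1.symm_apply_apply y
      rwa [this] at hy

theorem exists_of_cell_inter {n : ℕ} {v v' : List S} (h : (C.cell v ∩ C.cell v').Nonempty) :
    ∃ a ∈ C.cell (v.drop n), ∃ a' ∈ C.cell (v'.drop n),
      C.wordMap (v.take n) a = C.wordMap (v'.take n) a' := by
  obtain ⟨z, hz, hz'⟩ := h
  rw [← List.take_append_drop n v, cell_append] at hz
  rw [← List.take_append_drop n v', cell_append] at hz'
  obtain ⟨a, ha, rfl⟩ := hz
  obtain ⟨a', ha', e⟩ := hz'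
  exact ⟨a, ha, a', ha', e.symm⟩

/-- A connected set of words of length `n + j` either folds to a skeleton, or the tiles of level `n`
that it visits have a common vertex. Indeed, if the folded set misses the rays through the midpoints
of the sides, then in every tile it stays closest to one vertex, and this vertex does not change when
it passes from one tile to another. If it misses the rays through the vertices, it stays close to
one side. If it misses the boundary, it stays in one tile. Otherwise the folded set is connected. -/
theorem isSkeleton_fold_or {n j : ℕ} {F : Finset (List S)} (hF : ∀ v ∈ F, v.length = n + j)
    (hne : F.Nonempty) (hlink : C.IsLinked F) :
    C.IsSkeleton j (C.fold n j F) ∨ ∃ p, ∀ v ∈ F, ∃ k, p = C.wordMap (v.take n) (spin N (2 * k)) := by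
  have hN := C.three_le
  have hN0 : N ≠ 0 := by omega
  set X := C.realization (C.fold n j F) with hXdef
  have hX : ∀ {y}, y ∈ X ↔ ∃ v ∈ F, ∃ g : polygonGroup N, g.1 y ∈ C.cell (v.drop n) :=
    C.mem_realization_fold hF
  have hcX : ∀ v ∈ F, C.cell (v.drop n) ⊆ X := fun v hv y hy => hX.2 ⟨v, hv, 1, hy⟩
  have hlen : ∀ v ∈ F, (v.take n).length = n := fun v hv => by
    rw [List.length_take, hF v hv]; omega
  have hle : ∀ v ∈ F, ∀ v' ∈ F, (v.take n).length = (v'.take n).length := fun v hv v' hv' => by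
    rw [hlen v hv, hlen v' hv']
  obtain ⟨v₀, hv₀⟩ := hne
  have hcb := C.cell_subset_body
  by_cases hmid : ∃ (s : ℝ) (i : ℤ), 0 ≤ s ∧ s * spin N (2 * i + 1) ∈ X
  swap
  · right
    push Not at hmid
    have hk : ∀ v : List S, ∃ k, v ∈ F → ∀ y ∈ C.cell (v.drop n), IsNearest N 0 k y := by
      intro v
      by_cases hv : v ∈ F
      · obtain ⟨k, hk⟩ := exists_forall_isNearest (N := N) (by omega) 0 (C.isPreconnected_cell (v.drop n)) (by
          rintro y hy r i hr rfl
          rw [add_zero] at hy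
          exact hmid r i hr (hcX v hv hy))
        exact ⟨k, fun _ => hk⟩
      · exact ⟨0, fun h => absurd h hv⟩
    choose κ hκ using hk
    refine ⟨C.wordMap (v₀.take n) (spin N (2 * κ v₀)), fun v hv => ⟨κ v, ?_⟩⟩
    refine hlink.exists_eq C (p := fun v => C.wordMap (v.take n) (spin N (2 * κ v))) ?_ hv₀ hv
    intro v hv v' hv' hvv'
    obtain ⟨a, ha, a', ha', e⟩ := C.exists_of_cell_inter (n := n) hvv'
    obtain ⟨g, hga, hg⟩ := C.exists_gluing (hle v hv v' hv') (hcb _ ha) (hcb _ ha') e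
    have h1 := hκ v hv a ha
    obtain ⟨k, hk1, hk2⟩ := h1.map g.2
    rw [hg _ (spin_mem_stdBody _) ?_, hk1]
    · congr 1
      rw [spin_two_mul_eq_iff hN0]
      rw [hga] at hk2
      exact (hκ v' hv' a' ha').unique hk2
    · intro l hl
      rcases h1.of_mem_stdSide_zero hN hl with h | h
      · rw [(spin_two_mul_eq_iff hN0 _ _).2 h]; exact left_mem_stdSide l
      · rw [(spin_two_mul_eq_iff hN0 _ _).2 h, mul_add, mul_one]; exact right_mem_stdSide l
  by_cases hver : ∃ (s : ℝ) (i : ℤ), 0 ≤ s ∧ s * spin N (2 * i) ∈ X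
  swap
  · right
    push Not at hver
    have hk : ∀ v : List S, ∃ k, v ∈ F → ∀ y ∈ C.cell (v.drop n), IsNearest N 1 k y := by
      intro v
      by_cases hv : v ∈ F
      · obtain ⟨k, hk⟩ := exists_forall_isNearest (N := N) (by omega) 1 (C.isPreconnected_cell (v.drop n)) (by
          rintro y hy r i hr rfl
          rw [show 2 * i + 1 + 1 = 2 * (i + 1) by ring] at hy
          exact hver r _ hr (hcX v hv hy))
        exact ⟨k, fun _ => hk⟩
      · exact ⟨0, fun h => absurd h hv⟩
    choose κ hκ using hk
    refine ⟨C.wordMap (v₀.take n) (spin N (2 * κ v₀)), fun v hv => ?_⟩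
    have hside : C.wordMap (v₀.take n) '' stdSide N (κ v₀) = C.wordMap (v.take n) '' stdSide N (κ v) := by
      refine hlink.exists_eq C (p := fun v => C.wordMap (v.take n) '' stdSide N (κ v)) ?_ hv₀ hv
      intro v hv v' hv' hvv'
      obtain ⟨a, ha, a', ha', e⟩ := C.exists_of_cell_inter (n := n) hvv'
      have h1 := hκ v hv a ha
      have h2 := hκ v' hv' a' ha'
      by_cases hb : ∃ l, a ∈ stdSide N l
      · obtain ⟨l, hl⟩ := hb
        rw [stdSide_congr hN0 (h1.of_mem_stdSide_one hN0 hl)] at hl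
        obtain ⟨g, hga, hg⟩ := C.exists_gluing (hle v hv v' hv') (hcb _ ha) (hcb _ ha') e
        obtain ⟨i, hi⟩ := exists_map_stdSide g.2 (κ v)
        have h3 : a' ∈ stdSide N i := hi ▸ ⟨a, hl, hga⟩
        rw [← stdSide_congr hN0 (h2.of_mem_stdSide_one hN0 h3), ← hi, Set.image_image]
        refine Set.image_congr fun b hb => hg b (stdSide_subset _ hb) fun m hm => ?_
        rwa [stdSide_congr hN0 (h1.of_mem_stdSide_one hN0 hm)]
      · have hx : v.take n = v'.take n := by
          by_contra hx
          exact hb (C.exists_mem_stdSide (hle v hv v' hv') hx (hcb _ ha) (hcb _ ha') e)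
        rw [hx] at e ⊢
        obtain rfl := C.wordMap_injective _ e
        rw [stdSide_congr hN0 (h2.unique h1)]
    have ht := C.isTile_wordMap (v.take n)
    rw [← hle v₀ hv₀ v hv] at ht
    rcases end_points_of_common_side hN (C.ratio_pow_pos _) (C.isTile_wordMap (v₀.take n)) ht hside with
      h | h
    · exact ⟨κ v, h.1⟩
    · exact ⟨κ v + 1, by rw [h.1, mul_add, mul_one]⟩
  by_cases hbd : ∃ k, (X ∩ stdSide N k).Nonempty
  swap
  · right
    refine ⟨C.wordMap (v₀.take n) (spin N (2 * 0)), fun v hv => ⟨0, ?_⟩⟩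
    have : v₀.take n = v.take n := by
      refine hlink.exists_eq C (p := fun v => v.take n) ?_ hv₀ hv
      intro v hv v' hv' hvv'
      obtain ⟨a, ha, a', ha', e⟩ := C.exists_of_cell_inter (n := n) hvv'
      by_contra hx
      obtain ⟨k, hk⟩ := C.exists_mem_stdSide (hle v hv v' hv') hx (hcb _ ha) (hcb _ ha') e
      exact hbd ⟨k, a, hcX v hv ha, hk⟩
    rw [this]
  left
  have hinv : ∀ g : polygonGroup N, ∀ y ∈ X, g.1 y ∈ X := by
    intro g y hy
    obtain ⟨v, hv, h, hy⟩ := hX.1 hy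
    refine hX.2 ⟨v, hv, h * g⁻¹, ?_⟩
    have : (h * g⁻¹).1 (g.1 y) = h.1 y := congrArg h.1 (g.1.symm_apply_apply y)
    rwa [this]
  refine ⟨fun u hu => (C.mem_fold.1 hu).1, ?_, hinv, hbd⟩
  obtain ⟨r, i, hr, hrX⟩ := hver
  obtain ⟨s, l, hs, hsX⟩ := hmid
  -- the orbit of a connected component of the folded set is the whole folded set
  obtain ⟨a₀, ha₀⟩ := C.nonempty_cell (v₀.drop n)
  set Y := connectedComponentIn X a₀ with hY
  have hYX : Y ⊆ X := connectedComponentIn_subset X a₀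
  have hmaps : ∀ (g : polygonGroup N) v, v ∈ F → ∀ a ∈ C.cell (v.drop n), g.1 a ∈ Y →
      ∀ b ∈ C.cell (v.drop n), g.1 b ∈ Y := by
    intro g v hv a ha hga b hb
    rw [hY, connectedComponentIn_eq hga]
    exact ((C.isPreconnected_cell (v.drop n)).image g.1 g.1.continuous.continuousOn).subset_connectedComponentIn
      ⟨a, ha, rfl⟩ (by rintro _ ⟨c, hc, rfl⟩; exact hinv g c (hcX v hv hc)) ⟨b, hb, rfl⟩
  have hreach : ∀ v ∈ F, ∃ g : polygonGroup N, ∀ a ∈ C.cell (v.drop n), g.1 a ∈ Y := by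
    intro v hv
    induction hlink v₀ hv₀ v hv with
    | refl => exact ⟨1, hmaps 1 v₀ hv₀ a₀ ha₀ (mem_connectedComponentIn (hcX v₀ hv₀ ha₀))⟩
    | tail _ hbc ih =>
      obtain ⟨g, hg⟩ := ih hbc.1
      obtain ⟨a, ha, a', ha', e⟩ := C.exists_of_cell_inter (n := n) hbc.2.2
      obtain ⟨h, hha, -⟩ := C.exists_gluing (hle _ hbc.1 _ hbc.2.1) (hcb _ ha) (hcb _ ha') e
      refine ⟨g * h⁻¹, hmaps _ _ hbc.2.1 a' ha' ?_⟩
      have : (g * h⁻¹).1 a' = g.1 a := by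
        rw [← hha]; exact congrArg g.1 (h.1.symm_apply_apply a)
      rw [this]
      exact hg a ha
  refine isPreconnected_orbit hN0 (isPreconnected_connectedComponentIn : IsPreconnected Y) ?_ ?_ hr hs hrX hsX
  · exact fun y hy => norm_le_of_mem_stdBody (C.realization_subset_body _ (hYX hy))
  · intro y
    constructor
    · intro hy
      obtain ⟨v, hv, g, hgy⟩ := hX.1 hy
      obtain ⟨h, hh⟩ := hreach v hv
      exact ⟨(h * g).1, (h * g).2, hh _ hgy⟩
    · rintro ⟨g, hg, hgy⟩
      have := hinv (⟨g, hg⟩ : polygonGroup N)⁻¹ _ (hYX hgy)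
      rwa [show ((⟨g, hg⟩ : polygonGroup N)⁻¹).1 (g y) = y from g.symm_apply_apply y] at this

end Carpet

end PolygonCarpet

/-! ### Counting words and tiles -/

namespace PolygonCarpet

theorem sum_words_zero {S : Type*} [Finite S] (f : List S → ℝ) : ∑ w ∈ words S 0, f w = f [] := by
  have : words S 0 = {[]} := by
    ext w; rw [mem_words, Finset.mem_singleton, List.length_eq_zero_iff]
  rw [this, Finset.sum_singleton]

theorem sum_words_add {S : Type*} [Finite S] (n m : ℕ) (f : List S → ℝ) :
    ∑ w ∈ words S (n + m), f w = ∑ x ∈ words S n, ∑ u ∈ words S m, f (x ++ u) := by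
  rw [← Finset.sum_product']
  symm
  refine Finset.sum_bij' (fun p _ => p.1 ++ p.2) (fun w _ => (w.take n, w.drop n)) ?_ ?_ ?_ ?_ ?_
  · rintro ⟨x, u⟩ h
    rw [Finset.mem_product, mem_words, mem_words] at h
    rw [mem_words, List.length_append, h.1, h.2]
  · intro w h
    rw [mem_words] at h
    rw [Finset.mem_product, mem_words, mem_words, List.length_take, List.length_drop]
    constructor <;> omega
  · rintro ⟨x, u⟩ h
    rw [Finset.mem_product, mem_words, mem_words] at h
    obtain ⟨h1, h2⟩ := h
    simp only at h1 h2
    subst h1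
    simp
  · intro w _
    simp
  · intro p _; rfl

theorem sum_words_succ {S : Type*} [Fintype S] (n : ℕ) (f : List S → ℝ) :
    ∑ w ∈ words S (n + 1), f w = ∑ i, ∑ u ∈ words S n, f (i :: u) := by
  rw [add_comm, sum_words_add]
  refine Finset.sum_bij' (fun w h => w.head (by rintro rfl; simp [mem_words] at h)) (fun i _ => [i])
    ?_ ?_ ?_ ?_ ?_
  · intro _ _; exact Finset.mem_univ _
  · intro _ _; rw [mem_words]; rfl
  · intro w h
    rw [mem_words, List.length_eq_one_iff] at h
    obtain ⟨a, rfl⟩ := h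
    rfl
  · intro _ _; rfl
  · intro w h
    rw [mem_words, List.length_eq_one_iff] at h
    obtain ⟨a, rfl⟩ := h
    rfl

theorem card_words {S : Type*} [Fintype S] (n : ℕ) : ((words S n).card : ℝ) = (Fintype.card S : ℝ) ^ n := by
  have h : ∀ n, ((words S n).card : ℝ) = ∑ w ∈ words S n, (1 : ℝ) := fun n => by simp
  induction n with
  | zero => rw [h, sum_words_zero, pow_zero]
  | succ n ih => rw [h, sum_words_succ, ← h, ih]; simp [pow_succ, mul_comm]

namespace Carpet

variable {N : ℕ} {S : Type*} [Fintype S] (C : Carpet N S)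

section Orbit

variable [Fintype (polygonGroup N)]

/-- The sum of a weight over the orbit of a word under the symmetries. -/
noncomputable def orbitSum (ρ : List S → ℝ) (u : List S) : ℝ := ∑ g : polygonGroup N, ρ (C.act g u)

theorem orbitSum_nonneg {ρ : List S → ℝ} (hρ : ∀ u, 0 ≤ ρ u) (u : List S) : 0 ≤ C.orbitSum ρ u :=
  Finset.sum_nonneg fun _ _ => hρ _

theorem sum_orbitSum_sq_le (j : ℕ) (ρ : List S → ℝ) :
    ∑ u ∈ words S j, C.orbitSum ρ u ^ 2 ≤
      (Fintype.card (polygonGroup N) : ℝ) ^ 2 * ∑ u ∈ words S j, ρ u ^ 2 := by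
  have h1 : ∀ u, C.orbitSum ρ u ^ 2 ≤
      (Fintype.card (polygonGroup N) : ℝ) * ∑ g : polygonGroup N, ρ (C.act g u) ^ 2 := fun u =>
    sq_sum_le_card_mul_sum_sq
  refine (Finset.sum_le_sum fun u _ => h1 u).trans ?_
  rw [← Finset.mul_sum, Finset.sum_comm, sq, mul_assoc]
  refine mul_le_mul_of_nonneg_left ?_ (Nat.cast_nonneg _)
  rw [← nsmul_eq_mul, ← Finset.card_univ]
  refine Finset.sum_le_card_nsmul _ _ _ fun g _ => ?_
  classical
  have hinj : Set.InjOn (C.act g) (words S j : Set (List S)) := fun u hu v hv h =>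
    C.act_injective g ((mem_words.1 hu).trans (mem_words.1 hv).symm) h
  rw [← Finset.sum_image (f := fun u => ρ u ^ 2) hinj]
  refine Finset.sum_le_sum_of_subset_of_nonneg ?_ fun _ _ _ => sq_nonneg _
  intro v hv
  obtain ⟨u, hu, rfl⟩ := Finset.mem_image.1 hv
  rw [mem_words, length_act, mem_words.1 hu]

theorem sum_fold_le (n j : ℕ) {ρ : List S → ℝ} (hρ : ∀ u, 0 ≤ ρ u) (F : Finset (List S)) :
    ∑ u ∈ C.fold n j F, ρ u ≤ ∑ v ∈ F, C.orbitSum ρ (v.drop n) := by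
  classical
  have hsub : C.fold n j F ⊆ (F ×ˢ (Finset.univ : Finset (polygonGroup N))).image
      fun p => C.act p.2 (p.1.drop n) := by
    intro u hu
    obtain ⟨-, v, hv, g, rfl⟩ := C.mem_fold.1 hu
    exact Finset.mem_image.2 ⟨(v, g), Finset.mem_product.2 ⟨hv, Finset.mem_univ g⟩, rfl⟩
  refine (Finset.sum_le_sum_of_subset_of_nonneg hsub fun _ _ _ => hρ _).trans ?_
  refine (Finset.sum_image_le_of_nonneg fun _ _ => hρ _).trans ?_
  rw [Finset.sum_product]
  rfl

end Orbit

/-- The number of words of length `n` with centers close to a given point is bounded. -/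
theorem exists_card_le (R : ℝ) : ∃ M : ℕ, ∀ (n : ℕ) (c : ℂ) (A : Finset (List S)),
    (∀ x ∈ A, x.length = n ∧ dist (C.wordMap x 0) c ≤ R * C.ratio ^ n) → A.card ≤ M := by
  obtain ⟨r₀, hr₀, hsep⟩ := C.exists_separation
  obtain ⟨t, ht, hcov⟩ := Metric.totallyBounded_iff.1 (isCompact_closedBall (0 : ℂ) R).totallyBounded
    (r₀ / 2) (by positivity)
  refine ⟨ht.toFinset.card, fun n c A hA => ?_⟩
  have hp := C.ratio_pow_pos n
  have hch : ∀ x ∈ A, ∃ y ∈ t, dist (C.wordMap x 0 - c) (C.ratio ^ n * y) < r₀ / 2 * C.ratio ^ n := by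
    intro x hx
    have hpc : ((C.ratio : ℂ) ^ n) ≠ 0 := by exact_mod_cast hp.ne'
    have hnorm : ‖(C.ratio : ℂ) ^ n‖ = C.ratio ^ n := by
      rw [norm_pow, Complex.norm_real, Real.norm_of_nonneg C.ratio_pos.le]
    have hmem : (C.wordMap x 0 - c) / (C.ratio : ℂ) ^ n ∈ Metric.closedBall (0 : ℂ) R := by
      rw [mem_closedBall_zero_iff, norm_div, hnorm, div_le_iff₀ hp, ← dist_eq_norm]
      exact (hA x hx).2
    obtain ⟨y, hy, hxy⟩ := Set.mem_iUnion₂.1 (hcov hmem)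
    refine ⟨y, hy, ?_⟩
    rw [Metric.mem_ball, dist_eq_norm] at hxy
    rw [dist_eq_norm, show C.wordMap x 0 - c - (C.ratio : ℂ) ^ n * y
      = ((C.wordMap x 0 - c) / (C.ratio : ℂ) ^ n - y) * (C.ratio : ℂ) ^ n by field_simp, norm_mul, hnorm]
    exact mul_lt_mul_of_pos_right hxy hp
  choose! φ hφ hφd using hch
  refine Finset.card_le_card_of_injOn φ (fun x hx => ht.mem_toFinset.2 (hφ x hx)) ?_
  intro x hx x' hx' he
  by_contra hne
  have h1 := hsep x x' ((hA x hx).1.trans (hA x' hx').1.symm) hne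
  rw [(hA x hx).1] at h1
  have h2 := hφd x hx
  have h3 := hφd x' hx'
  rw [← he] at h3
  have h4 := dist_triangle_right (C.wordMap x 0 - c) (C.wordMap x' 0 - c) (C.ratio ^ n * φ x)
  rw [dist_sub_right] at h4
  linarith

theorem dist_center_le {x : List S} {y : ℂ} (hy : y ∈ C.wordMap x '' stdBody N) :
    dist (C.wordMap x 0) y ≤ C.ratio ^ x.length := by
  obtain ⟨a, ha, rfl⟩ := hy
  rw [dist_wordMap, dist_zero_left]
  exact mul_le_of_le_one_right (C.ratio_pow_pos _).le (norm_le_of_mem_stdBody ha)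

theorem cell_subset_tile (x : List S) : C.cell x ⊆ C.wordMap x '' stdBody N := Set.image_mono C.K_subset

theorem dist_center_le_of_inter {n : ℕ} {x x' : List S} (hx : x.length = n) (hx' : x'.length = n)
    (h : (C.cell x ∩ C.cell x').Nonempty) : dist (C.wordMap x 0) (C.wordMap x' 0) ≤ 2 * C.ratio ^ n := by
  obtain ⟨y, hy, hy'⟩ := h
  have h1 := C.dist_center_le (C.cell_subset_tile x hy)
  have h2 := C.dist_center_le (C.cell_subset_tile x' hy')
  rw [hx] at h1
  rw [hx'] at h2
  linarith [dist_triangle_right (C.wordMap x 0) (C.wordMap x' 0) y]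

open scoped Pointwise in
/-- The area of the small polygons adds up to less than the area of the polygon. -/
theorem card_mul_ratio_sq_lt_one : Fintype.card S * C.ratio ^ 2 < 1 := by
  have hN := C.three_le
  have hN0 : N ≠ 0 := by omega
  set μ : MeasureTheory.Measure ℂ := MeasureTheory.volume with hμ
  have hA := isCompact_stdBody hN0
  have hcompact : ∀ i, IsCompact (C.map i '' stdBody N) := fun i => hA.image (C.isTile i).continuous
  have hAfin : μ (stdBody N) ≠ ∞ := hA.measure_lt_top.ne
  have hint : (interior (stdBody N)).Nonempty := by
    obtain ⟨r, hr, hb⟩ := exists_ball_subset_stdBody hN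
    exact ⟨0, mem_interior.2 ⟨_, hb, Metric.isOpen_ball, Metric.mem_ball_self hr⟩⟩
  have htile : ∀ i (X : Set ℂ), μ (C.map i '' X) = ENNReal.ofReal (C.ratio ^ 2) * μ X := by
    intro i X
    obtain ⟨ε, b, hε, h⟩ := C.isTile i
    have himg : C.map i '' X = (fun z => z + b) '' ((ε * C.ratio : ℝ) • X) := by
      rw [← Set.image_smul, Set.image_image]
      refine Set.image_congr fun y _ => ?_
      rw [h, Complex.real_smul]; push_cast; rfl
    rw [himg, Set.image_add_right, MeasureTheory.measure_preimage_add_right,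
      MeasureTheory.Measure.addHaar_smul, Complex.finrank_real_complex, mul_pow,
      show ε ^ 2 = 1 by rcases hε with rfl | rfl <;> norm_num, one_mul, abs_of_nonneg (sq_nonneg _)]
  have hside : ∀ k, μ (stdSide N k) = 0 := by
    intro k
    refine MeasureTheory.measure_mono_null (t := frontier (stdBody N)) (fun y hy => ⟨subset_closure (stdSide_subset k hy), fun hint => ?_⟩)
      (Convex.addHaar_frontier μ convex_stdBody)
    obtain ⟨ε, hε, hb⟩ := Metric.isOpen_iff.1 isOpen_interior y hint
    have hz : y + (ε / 2 : ℝ) • spin N (2 * k + 1) ∈ stdBody N := by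
      apply interior_subset
      apply hb
      rw [Metric.mem_ball, dist_eq_norm, add_sub_cancel_left, norm_smul, norm_spin, mul_one,
        Real.norm_of_nonneg (by positivity)]
      linarith
    have h1 := height_le_of_mem_stdBody hN0 hz k
    rw [map_add, map_smul, height_of_mem_stdSide hy, height_spin, sub_self] at h1
    simp at h1
    linarith
  have hnull : ∀ i j, i ≠ j → μ (C.map i '' stdBody N ∩ C.map j '' stdBody N) = 0 := by
    intro i j hij
    rcases Set.eq_empty_or_nonempty (C.map i '' stdBody N ∩ C.map j '' stdBody N) with he | hne
    · rw [he, MeasureTheory.measure_empty]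
    rcases C.touching i j hij hne with ⟨k, k', h, -⟩ | ⟨k, k', h, -⟩
    · rw [h, htile, hside, mul_zero]
    · rw [h]; exact MeasureTheory.measure_singleton _
  have hsum : μ (⋃ i, C.map i '' stdBody N) = ∑ i, μ (C.map i '' stdBody N) := by
    rw [MeasureTheory.measure_iUnion₀, tsum_fintype]
    · exact fun i j hij => hnull i j hij
    · exact fun i => (hcompact i).measurableSet.nullMeasurableSet
  have hsub : ⋃ i, C.map i '' stdBody N ⊆ stdBody N := Set.iUnion_subset C.maps_body
  have hU : IsClosed (⋃ i, C.map i '' stdBody N) := isClosed_iUnion_of_finite fun i => (hcompact i).isClosed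
  have hlt : μ (⋃ i, C.map i '' stdBody N) < μ (stdBody N) := by
    obtain ⟨y, hy, hyU⟩ : ∃ y ∈ stdBody N, y ∉ ⋃ i, C.map i '' stdBody N := by
      by_contra! hcon
      exact C.nontrivial (hsub.antisymm hcon)
    have hcl : y ∈ closure (interior (stdBody N)) := by
      rw [convex_stdBody.closure_interior_eq_closure_of_nonempty_interior hint]
      exact subset_closure hy
    obtain ⟨z, hz, hz'⟩ := mem_closure_iff.1 hcl _ hU.isOpen_compl hyU
    set V := (⋃ i, C.map i '' stdBody N)ᶜ ∩ interior (stdBody N) with hV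
    have hVo : IsOpen V := hU.isOpen_compl.inter isOpen_interior
    have hdisj : Disjoint (⋃ i, C.map i '' stdBody N) V :=
      Set.disjoint_left.2 fun _ h h' => h'.1 h
    have hVpos : 0 < μ V := hVo.measure_pos μ ⟨z, hz, hz'⟩
    calc μ (⋃ i, C.map i '' stdBody N) < μ (⋃ i, C.map i '' stdBody N) + μ V :=
          ENNReal.lt_add_right (ne_top_of_le_ne_top hAfin (MeasureTheory.measure_mono hsub)) hVpos.ne'
      _ = μ ((⋃ i, C.map i '' stdBody N) ∪ V) := (MeasureTheory.measure_union hdisj hVo.measurableSet).symm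
      _ ≤ μ (stdBody N) :=
          MeasureTheory.measure_mono (Set.union_subset hsub fun _ h => interior_subset h.2)
  rw [hsum, Finset.sum_congr rfl fun i _ => htile i _, Finset.sum_const, nsmul_eq_mul, Finset.card_univ,
    ← mul_assoc] at hlt
  have h1 : ((Fintype.card S : ℝ≥0∞) * ENNReal.ofReal (C.ratio ^ 2)) < 1 := by
    by_contra! hge
    exact absurd hlt (not_lt.2 (by simpa using mul_le_mul_left hge (μ (stdBody N))))
  rw [← ENNReal.ofReal_natCast, ← ENNReal.ofReal_mul (Nat.cast_nonneg _)] at h1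
  exact ENNReal.ofReal_lt_one.1 h1

end Carpet

end PolygonCarpet

/-! ### Weights of skeletons and potentials -/

namespace PolygonCarpet

namespace Carpet

variable {N : ℕ} {S : Type*} [Fintype S] (C : Carpet N S)

open scoped Classical in
/-- The energy of a function on a set of words of the same length. -/
noncomputable def energy (A : Finset (List S)) (f : List S → ℝ) : ℝ :=
  (1 / 2) * ∑ w ∈ A, ∑ v ∈ A, if (C.cell w ∩ C.cell v).Nonempty then (f w - f v) ^ 2 else 0

/-- There is a weight on the words of length `j` with sum of squares at most `E`, for which every
skeleton has weight at least one. -/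
def HasWeight (j : ℕ) (E : ℝ) : Prop :=
  ∃ ρ : List S → ℝ, (∀ u, 0 ≤ ρ u) ∧ (∀ F, C.IsSkeleton j F → 1 ≤ ∑ u ∈ F, ρ u) ∧
    ∑ u ∈ words S j, ρ u ^ 2 ≤ E

variable {C} in
theorem HasWeight.nonneg {j : ℕ} {E : ℝ} (h : C.HasWeight j E) : 0 ≤ E := by
  obtain ⟨ρ, -, -, h⟩ := h
  exact (Finset.sum_nonneg fun _ _ => sq_nonneg _).trans h

open scoped Classical in
theorem exists_degree_le : ∃ D : ℕ, ∀ v : List S,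
    ((words S v.length).filter fun v' => (C.cell v ∩ C.cell v').Nonempty).card ≤ D := by
  obtain ⟨D, hD⟩ := C.exists_card_le 2
  refine ⟨D, fun v => hD v.length (C.wordMap v 0) _ fun x hx => ?_⟩
  rw [Finset.mem_filter, mem_words] at hx
  exact ⟨hx.1, by rw [dist_comm]; exact C.dist_center_le_of_inter rfl hx.1 hx.2⟩

open scoped Classical in
theorem sum_sum_meets_le {D : ℕ}
    (hD : ∀ v : List S, ((words S v.length).filter fun v' => (C.cell v ∩ C.cell v').Nonempty).card ≤ D)
    (L : ℕ) {h : List S → ℝ} (hh : ∀ v, 0 ≤ h v) :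
    ∑ v ∈ words S L, ∑ v' ∈ words S L, (if (C.cell v ∩ C.cell v').Nonempty then h v + h v' else 0) ≤
      2 * D * ∑ v ∈ words S L, h v := by
  have h1 : ∑ v ∈ words S L, ∑ v' ∈ words S L, (if (C.cell v ∩ C.cell v').Nonempty then h v else 0) ≤
      D * ∑ v ∈ words S L, h v := by
    rw [Finset.mul_sum]
    refine Finset.sum_le_sum fun v hv => ?_
    rw [← Finset.sum_filter, Finset.sum_const, nsmul_eq_mul]
    have := hD v
    rw [mem_words.1 hv] at this
    exact mul_le_mul_of_nonneg_right (by exact_mod_cast this) (hh v)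
  have h2 : ∑ v ∈ words S L, ∑ v' ∈ words S L, (if (C.cell v ∩ C.cell v').Nonempty then h v' else 0) ≤
      D * ∑ v ∈ words S L, h v := by
    rw [Finset.sum_comm]
    refine le_trans (le_of_eq ?_) h1
    refine Finset.sum_congr rfl fun v _ => Finset.sum_congr rfl fun v' _ => ?_
    rw [Set.inter_comm]
  calc _ = ∑ v ∈ words S L, ∑ v' ∈ words S L, (if (C.cell v ∩ C.cell v').Nonempty then h v else 0) +
        ∑ v ∈ words S L, ∑ v' ∈ words S L, (if (C.cell v ∩ C.cell v').Nonempty then h v' else 0) := by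
        rw [← Finset.sum_add_distrib]
        refine Finset.sum_congr rfl fun v _ => ?_
        rw [← Finset.sum_add_distrib]
        refine Finset.sum_congr rfl fun v' _ => ?_
        split_ifs <;> simp
    _ ≤ _ := by linarith

theorem isLinked_singleton (v : List S) : C.IsLinked {v} := by
  intro a ha b hb
  rw [Finset.mem_singleton] at ha hb
  subst ha; subst hb
  exact .refl

open scoped Classical in
theorem IsLinked.insert {F : Finset (List S)} (hF : C.IsLinked F) {v v' : List S} (hv : v ∈ F)
    (h : (C.cell v ∩ C.cell v').Nonempty) : C.IsLinked (insert v' F) := by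
  have hm : ∀ a b, C.Meets F a b → C.Meets (Insert.insert v' F) a b := fun a b hab =>
    ⟨Finset.mem_insert_of_mem hab.1, Finset.mem_insert_of_mem hab.2.1, hab.2.2⟩
  have hstep : C.Meets (Insert.insert v' F) v v' :=
    ⟨Finset.mem_insert_of_mem hv, Finset.mem_insert_self _ _, h⟩
  intro a ha b hb
  rw [Finset.mem_insert] at ha hb
  have hav : Relation.ReflTransGen (C.Meets (Insert.insert v' F)) a v := by
    rcases ha with rfl | ha
    · exact .single (hstep.symm C)
    · exact Relation.ReflTransGen.mono hm _ _ (hF a ha v hv)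
  have hvb : Relation.ReflTransGen (C.Meets (Insert.insert v' F)) v b := by
    rcases hb with rfl | hb
    · exact .single hstep
    · exact Relation.ReflTransGen.mono hm _ _ (hF v hv b hb)
  exact hav.trans hvb

theorem cell_subset_cell_take (n : ℕ) (v : List S) : C.cell v ⊆ C.cell (v.take n) := by
  conv_lhs => rw [← List.take_append_drop n v]
  exact C.cell_append_subset _ _

/-- A connected set of words that joins disjoint cells of level `n` folds to a skeleton, if it is
folded at a deeper level. -/
theorem isSkeleton_fold_of_disjoint [Nontrivial S] {n k j : ℕ} (hk : 1 ≤ k) {F : Finset (List S)}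
    (hF : ∀ v ∈ F, v.length = n + k + j) (hlink : C.IsLinked F) {v v' : List S} (hv : v ∈ F)
    (hv' : v' ∈ F) (hdisj : ¬ (C.cell (v.take n) ∩ C.cell (v'.take n)).Nonempty) :
    C.IsSkeleton j (C.fold (n + k) j F) := by
  rcases C.isSkeleton_fold_or hF ⟨v, hv⟩ hlink with h | ⟨p, hp⟩
  · exact h
  exfalso
  apply hdisj
  obtain ⟨l, hl⟩ := hp v hv
  obtain ⟨l', hl'⟩ := hp v' hv'
  rw [hl, List.take_add, List.take_add] at hl'
  have h1 := hF v hv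
  have h2 := hF v' hv'
  refine C.cell_inter_nonempty_of_common_vertex ?_ ?_ hl'
  · rw [List.length_take, List.length_take, h1, h2]
  · intro he
    have := congrArg List.length he
    rw [List.length_take, List.length_drop, h1, List.length_nil] at this
    omega

open scoped Classical in
/-- A weight for the skeletons gives a potential which is `1` on a cell and `0` on the cells that are
disjoint from it: the minimal weight of a connected set of words that joins the cell to a given word,
truncated at one. -/
theorem exists_potential [Nontrivial S] : ∃ M > 0, ∀ (n k j : ℕ) (w : List S) (E : ℝ), 1 ≤ k →
    w.length = n → C.HasWeight j E → ∃ f : List S → ℝ,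
      (∀ v, v.length = n + k + j → v.take n = w → f v = 1) ∧
      (∀ v, v.length = n + k + j → ¬ (C.cell w ∩ C.cell (v.take n)).Nonempty → f v = 0) ∧
      C.energy (words S (n + k + j)) f ≤ M * (Fintype.card S : ℝ) ^ k * E := by
  have hN0 : N ≠ 0 := by have := C.three_le; omega
  have := finite_polygonGroup hN0
  let _ := Fintype.ofFinite (polygonGroup N)
  obtain ⟨D, hD⟩ := C.exists_degree_le
  obtain ⟨M₄, hM₄⟩ := C.exists_card_le 4
  set γ : ℝ := (Fintype.card (polygonGroup N) : ℝ) with hγ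
  refine ⟨2 * D * M₄ * γ ^ 2 + 1, by positivity, fun n k j w E hk hw hE => ?_⟩
  have hE0 := hE.nonneg
  obtain ⟨ρ, hρ, hskel, hsum⟩ := hE
  set ρ' : List S → ℝ := fun v => C.orbitSum ρ (v.drop (n + k)) with hρ'
  have hρ'0 : ∀ v, 0 ≤ ρ' v := fun v => C.orbitSum_nonneg hρ _
  set T : List S → Set ℝ := fun v => insert 1 {t | ∃ F : Finset (List S),
    (∀ x ∈ F, x.length = n + k + j) ∧ C.IsLinked F ∧ v ∈ F ∧ (∃ v₀ ∈ F, v₀.take n = w) ∧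
    t = ∑ x ∈ F, ρ' x} with hT
  have hbdd : ∀ v, BddBelow (T v) := by
    intro v
    refine ⟨0, ?_⟩
    rintro t (rfl | ⟨F, -, -, -, -, rfl⟩)
    · exact zero_le_one
    · exact Finset.sum_nonneg fun x _ => hρ'0 x
  have hTne : ∀ v, (T v).Nonempty := fun v => ⟨1, Set.mem_insert _ _⟩
  set d : List S → ℝ := fun v => sInf (T v) with hd
  have hd1 : ∀ v, d v ≤ 1 := fun v => csInf_le (hbdd v) (Set.mem_insert _ _)
  have hfar : ∀ v, v.length = n + k + j → ¬ (C.cell w ∩ C.cell (v.take n)).Nonempty → d v = 1 := by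
    intro v hv hdisj
    refine le_antisymm (hd1 v) (le_csInf (hTne v) ?_)
    rintro t (rfl | ⟨F, hF, hlink, hvF, ⟨v₀, hv₀, hv₀w⟩, rfl⟩)
    · exact le_rfl
    · rw [← hv₀w] at hdisj
      exact (hskel _ (C.isSkeleton_fold_of_disjoint hk hF hlink hv₀ hvF hdisj)).trans
        (C.sum_fold_le (n + k) j hρ F)
  have hstep : ∀ v v', v'.length = n + k + j → (C.cell v ∩ C.cell v').Nonempty → d v' ≤ d v + ρ' v' := by
    intro v v' hv' hvv'
    rw [← sub_le_iff_le_add]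
    refine le_csInf (hTne v) ?_
    rintro t (rfl | ⟨F, hF, hlink, hvF, ⟨v₀, hv₀, hv₀w⟩, rfl⟩)
    · linarith [hd1 v', hρ'0 v']
    · rw [sub_le_iff_le_add]
      have h1 : d v' ≤ ∑ x ∈ insert v' F, ρ' x := by
        refine csInf_le (hbdd v') (Or.inr ⟨insert v' F, ?_, IsLinked.insert C hlink hvF hvv',
          Finset.mem_insert_self _ _, ⟨v₀, Finset.mem_insert_of_mem hv₀, hv₀w⟩, rfl⟩)
        intro x hx
        rcases Finset.mem_insert.1 hx with rfl | hx
        · exact hv'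
        · exact hF x hx
      refine h1.trans ?_
      by_cases hm : v' ∈ F
      · rw [Finset.insert_eq_of_mem hm]; linarith [hρ'0 v']
      · rw [Finset.sum_insert hm]; linarith
  have hstart : ∀ v, v.length = n + k + j → v.take n = w → d v ≤ ρ' v := by
    intro v hv hvw
    refine csInf_le (hbdd v) (Or.inr ⟨{v}, ?_, C.isLinked_singleton v, Finset.mem_singleton_self v,
      ⟨v, Finset.mem_singleton_self v, hvw⟩, by simp⟩)
    intro x hx
    rw [Finset.mem_singleton.1 hx]; exact hv
  set f : List S → ℝ := fun v => if v.take n = w then 1 else 1 - d v with hf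
  have hf1 : ∀ v, v.take n = w → f v = 1 := fun v hv => if_pos hv
  have hf2 : ∀ v, v.take n ≠ w → f v = 1 - d v := fun v hv => if_neg hv
  have hf0 : ∀ v, v.length = n + k + j → ¬ (C.cell w ∩ C.cell (v.take n)).Nonempty → f v = 0 := by
    intro v hv hdisj
    have : v.take n ≠ w := by
      rintro h
      rw [h, Set.inter_self] at hdisj
      exact hdisj (C.nonempty_cell w)
    rw [hf2 v this, hfar v hv hdisj, sub_self]
  refine ⟨f, fun v _ => hf1 v, hf0, ?_⟩
  have hd0 : ∀ v, 0 ≤ d v := by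
    intro v
    refine le_csInf (hTne v) ?_
    rintro t (rfl | ⟨F, -, -, -, -, rfl⟩)
    · exact zero_le_one
    · exact Finset.sum_nonneg fun x _ => hρ'0 x
  have hlip : ∀ v v', v.length = n + k + j → v'.length = n + k + j →
      (C.cell v ∩ C.cell v').Nonempty → |f v - f v'| ≤ ρ' v + ρ' v' := by
    intro v v' hv hv' hvv'
    have hvv2 : (C.cell v' ∩ C.cell v).Nonempty := by rwa [Set.inter_comm]
    have h1 := hstep v v' hv' hvv'
    have h2 := hstep v' v hv hvv2
    have h3 := hρ'0 v
    have h4 := hρ'0 v'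
    have h5 := hd0 v
    have h6 := hd0 v'
    by_cases hw1 : v.take n = w <;> by_cases hw2 : v'.take n = w
    · rw [hf1 v hw1, hf1 v' hw2, sub_self, abs_zero]; positivity
    · rw [hf1 v hw1, hf2 v' hw2, abs_le]
      have := hstart v hv hw1
      constructor <;> linarith
    · rw [hf2 v hw1, hf1 v' hw2, abs_le]
      have := hstart v' hv' hw2
      constructor <;> linarith
    · rw [hf2 v hw1, hf2 v' hw2, abs_le]
      constructor <;> linarith
  set near : List S → Prop := fun x => ∃ y, y.length = n ∧ (C.cell w ∩ C.cell y).Nonempty ∧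
    (C.cell y ∩ C.cell x).Nonempty with hnear
  set h : List S → ℝ := fun v => if near (v.take n) then ρ' v ^ 2 else 0 with hh
  have hh0 : ∀ v, 0 ≤ h v := fun v => by simp only [hh]; split_ifs <;> positivity
  have hterm : ∀ v ∈ words S (n + k + j), ∀ v' ∈ words S (n + k + j),
      (if (C.cell v ∩ C.cell v').Nonempty then (f v - f v') ^ 2 else 0) ≤
        2 * (if (C.cell v ∩ C.cell v').Nonempty then h v + h v' else 0) := by
    intro v hv v' hv'
    rw [mem_words] at hv hv'
    by_cases hm : (C.cell v ∩ C.cell v').Nonempty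
    swap
    · rw [if_neg hm, if_neg hm, mul_zero]
    rw [if_pos hm, if_pos hm]
    have hlen : ∀ v : List S, v.length = n + k + j → (v.take n).length = n := fun v hv => by
      rw [List.length_take, hv]; omega
    have hm' : (C.cell (v.take n) ∩ C.cell (v'.take n)).Nonempty :=
      hm.mono (Set.inter_subset_inter (C.cell_subset_cell_take n v) (C.cell_subset_cell_take n v'))
    by_cases hz : (C.cell w ∩ C.cell (v.take n)).Nonempty ∨ (C.cell w ∩ C.cell (v'.take n)).Nonempty
    · have hn : near (v.take n) ∧ near (v'.take n) := by
        rcases hz with hz | hz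
        · exact ⟨⟨v.take n, hlen v hv, hz, by rw [Set.inter_self]; exact C.nonempty_cell _⟩,
            ⟨v.take n, hlen v hv, hz, hm'⟩⟩
        · exact ⟨⟨v'.take n, hlen v' hv', hz, by rw [Set.inter_comm]; exact hm'⟩,
            ⟨v'.take n, hlen v' hv', hz, by rw [Set.inter_self]; exact C.nonempty_cell _⟩⟩
      have e1 : h v = ρ' v ^ 2 := if_pos hn.1
      have e2 : h v' = ρ' v' ^ 2 := if_pos hn.2
      rw [e1, e2]
      have := sq_le_sq' (abs_le.1 (hlip v v' hv hv' hm)).1 (abs_le.1 (hlip v v' hv hv' hm)).2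
      nlinarith [sq_nonneg (ρ' v - ρ' v')]
    · push Not at hz
      rw [hf0 v hv (by rw [hz.1]; exact Set.not_nonempty_empty), hf0 v' hv' (by rw [hz.2]; exact Set.not_nonempty_empty)]
      have := hh0 v
      have := hh0 v'
      rw [sub_self]; linarith
  have hhsum : ∑ v ∈ words S (n + k + j), h v ≤ M₄ * ((Fintype.card S : ℝ) ^ k * (γ ^ 2 * E)) := by
    rw [add_assoc, sum_words_add]
    have hx : ∀ x ∈ words S n, ∑ u ∈ words S (k + j), h (x ++ u) ≤
        if near x then (Fintype.card S : ℝ) ^ k * (γ ^ 2 * E) else 0 := by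
      intro x hx
      rw [mem_words] at hx
      have htake : ∀ u, (x ++ u).take n = x := fun u => by rw [← hx, List.take_left]
      by_cases hn : near x
      · rw [if_pos hn, sum_words_add]
        have : ∀ s ∈ words S k, ∑ t ∈ words S j, h (x ++ (s ++ t)) ≤ γ ^ 2 * E := by
          intro s hs
          rw [mem_words] at hs
          refine le_trans (le_of_eq ?_) ((C.sum_orbitSum_sq_le j ρ).trans
            (mul_le_mul_of_nonneg_left hsum (sq_nonneg _)))
          refine Finset.sum_congr rfl fun t _ => ?_
          have e1 : h (x ++ (s ++ t)) = ρ' (x ++ (s ++ t)) ^ 2 := if_pos (by rw [htake]; exact hn)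
          rw [e1, hρ']
          simp only
          rw [← List.append_assoc, List.drop_left' (by rw [List.length_append, hx, hs])]
        refine (Finset.sum_le_card_nsmul _ _ _ this).trans ?_
        rw [nsmul_eq_mul, card_words]
      · rw [if_neg hn]
        refine Finset.sum_nonpos fun u _ => le_of_eq (if_neg ?_)
        rwa [htake]
    refine (Finset.sum_le_sum hx).trans ?_
    rw [← Finset.sum_filter, Finset.sum_const, nsmul_eq_mul]
    refine mul_le_mul_of_nonneg_right ?_ (by positivity)
    norm_cast
    refine hM₄ n (C.wordMap w 0) _ fun x hx => ?_
    rw [Finset.mem_filter, mem_words] at hx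
    obtain ⟨hx, y, hy, h1, h2⟩ := hx
    refine ⟨hx, ?_⟩
    have a1 := C.dist_center_le_of_inter hw hy h1
    have a2 := C.dist_center_le_of_inter hy hx h2
    rw [dist_comm]
    linarith [dist_triangle (C.wordMap w 0) (C.wordMap y 0) (C.wordMap x 0)]
  have henergy : C.energy (words S (n + k + j)) f ≤ 2 * D * ∑ v ∈ words S (n + k + j), h v := by
    have h1 := Finset.sum_le_sum fun v hv => Finset.sum_le_sum fun v' hv' => hterm v hv v' hv'
    simp only [← Finset.mul_sum] at h1
    have h2 := C.sum_sum_meets_le hD (n + k + j) hh0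
    rw [energy]
    linarith
  refine henergy.trans ((mul_le_mul_of_nonneg_left hhsum (by positivity)).trans ?_)
  have : 0 ≤ (Fintype.card S : ℝ) ^ k * E := by positivity
  nlinarith

end Carpet

end PolygonCarpet

/-! ### Growth of the weights -/

namespace PolygonCarpet

/-- A connected set that is covered by few discs has small diameter. -/
theorem dist_le_of_subset_iUnion_closedBall {X : Set ℂ} (hX : IsPreconnected X) {ι : Type*} {V : Finset ι}
    {c : ι → ℂ} {r : ℝ} (hr : 0 ≤ r) (hcov : ∀ y ∈ X, ∃ i ∈ V, dist (c i) y ≤ r) {y y' : ℂ} (hy : y ∈ X)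
    (hy' : y' ∈ X) : dist y y' ≤ V.card * (2 * r) := by
  have hsub : Set.Icc 0 (dist y y') ⊆ ⋃ i ∈ V, Set.Icc (dist y (c i) - r) (dist y (c i) + r) := by
    have h1 : Set.Icc (dist y y) (dist y y') ⊆ dist y '' X :=
      (hX.image _ (by fun_prop)).Icc_subset ⟨y, hy, rfl⟩ ⟨y', hy', rfl⟩
    rw [dist_self] at h1
    refine h1.trans ?_
    rintro _ ⟨z, hz, rfl⟩
    obtain ⟨i, hi, hiz⟩ := hcov z hz
    refine Set.mem_biUnion hi ⟨?_, ?_⟩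
    · linarith [dist_triangle_right y (c i) z]
    · linarith [dist_triangle y (c i) z]
  have h2 := (MeasureTheory.measure_mono (μ := MeasureTheory.volume) hsub).trans
    (MeasureTheory.measure_biUnion_finset_le V _)
  simp only [Real.volume_Icc, sub_zero] at h2
  have h3 : ∀ i, dist y (c i) + r - (dist y (c i) - r) = 2 * r := fun i => by ring
  simp only [h3, Finset.sum_const, nsmul_eq_mul] at h2
  rw [← ENNReal.ofReal_natCast, ← ENNReal.ofReal_mul (Nat.cast_nonneg _)] at h2
  exact (ENNReal.ofReal_le_ofReal_iff (by positivity)).1 h2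

namespace Carpet

variable {N : ℕ} {S : Type*} [Fintype S] (C : Carpet N S)

theorem exists_diam : ∃ δ > 0, ∀ j F, C.IsSkeleton j F →
    ∃ y ∈ C.realization F, ∃ y' ∈ C.realization F, δ ≤ dist y y' := by
  have hN := C.three_le
  have h1 : (1 : ℂ) - spin N 2 ≠ 0 := by
    have := spin_ne_spin_add_two hN 0
    rw [mul_zero, zero_add, spin_zero] at this
    exact sub_ne_zero.2 this
  have hδ := cos_pi_div_pos hN
  refine ⟨Real.cos (Real.pi / N) * ‖(1 : ℂ) - spin N 2‖, by positivity, fun j F hF => ?_⟩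
  obtain ⟨k, y, hy, hyk⟩ := hF.boundary
  refine ⟨y, hy, _, hF.invariant ⟨rot N 1, rot_mem 1⟩ y hy, ?_⟩
  have : y - (rot N 1) y = (1 - spin N 2) * y := by rw [rot_apply]; ring_nf
  rw [dist_eq_norm, this, norm_mul, mul_comm]
  exact mul_le_mul_of_nonneg_left (norm_ge_of_mem_stdSide hyk) (norm_nonneg _)

open scoped Classical in
/-- A connected set of words that leaves the neighbourhood of a tile has a certain weight close to this
tile. -/
theorem one_le_sum_near [Fintype (polygonGroup N)] {ρ : List S → ℝ} (hρ : ∀ u, 0 ≤ ρ u) {k j : ℕ}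
    (hskel : ∀ F, C.IsSkeleton j F → 1 ≤ ∑ u ∈ F, ρ u) {F : Finset (List S)}
    (hF : ∀ v ∈ F, v.length = k + j) (hlink : C.IsLinked F) {v v₁ : List S} (hv : v ∈ F) (hv₁ : v₁ ∈ F)
    (hfar : 2 * C.ratio ^ k < dist (C.wordMap (v.take k) 0) (C.wordMap (v₁.take k) 0)) :
    1 ≤ ∑ u ∈ F.filter (fun u => dist (C.wordMap (v.take k) 0) (C.wordMap (u.take k) 0) ≤ 4 * C.ratio ^ k),
      C.orbitSum ρ (u.drop k) := by
  set F₄ := F.filter (fun u => dist (C.wordMap (v.take k) 0) (C.wordMap (u.take k) 0) ≤ 4 * C.ratio ^ k)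
    with hF₄
  have hp := C.ratio_pow_pos k
  have hmem : ∀ u, u ∈ F₄ ↔ u ∈ F ∧
      dist (C.wordMap (v.take k) 0) (C.wordMap (u.take k) 0) ≤ 4 * C.ratio ^ k := fun u => Finset.mem_filter
  have hv4 : v ∈ F₄ := (hmem v).2 ⟨hv, by rw [dist_self]; positivity⟩
  have hlen : ∀ u ∈ F, (u.take k).length = k := fun u hu => by rw [List.length_take, hF u hu]; omega
  -- the connected component of the word in the neighbourhood
  set F' := F₄.filter fun u => Relation.ReflTransGen (C.Meets F₄) v u with hF'
  have hmem' : ∀ u, u ∈ F' ↔ u ∈ F₄ ∧ Relation.ReflTransGen (C.Meets F₄) v u := fun u => Finset.mem_filter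
  have hv' : v ∈ F' := (hmem' v).2 ⟨hv4, .refl⟩
  have hlift : ∀ u, Relation.ReflTransGen (C.Meets F₄) v u → Relation.ReflTransGen (C.Meets F') v u := by
    intro u hu
    induction hu with
    | refl => exact .refl
    | @tail b c hb hbc ih =>
      exact ih.tail ⟨(hmem' b).2 ⟨hbc.1, hb⟩, (hmem' c).2 ⟨hbc.2.1, hb.tail hbc⟩, hbc.2.2⟩
  have hlink' : C.IsLinked F' := by
    intro a ha b hb
    have h1 := hlift a ((hmem' a).1 ha).2
    have h2 := hlift b ((hmem' b).1 hb).2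
    have hsymm : Std.Symm (C.Meets F') := ⟨fun a b h => Meets.symm C h⟩
    exact (Std.Symm.symm _ _ h1).trans h2
  have hF'F : ∀ u ∈ F', u ∈ F := fun u hu => ((hmem u).1 ((hmem' u).1 hu).1).1
  have hreach : ∃ u ∈ F', 2 * C.ratio ^ k < dist (C.wordMap (v.take k) 0) (C.wordMap (u.take k) 0) := by
    by_contra! hcon
    have hall : ∀ u, Relation.ReflTransGen (C.Meets F) v u → u ∈ F' := by
      intro u hu
      induction hu with
      | refl => exact hv'
      | @tail b c hb hbc ih =>
        have h1 := hcon b ih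
        have h2 := C.dist_center_le_of_inter (hlen b hbc.1) (hlen c hbc.2.1)
          (hbc.2.2.mono (Set.inter_subset_inter (C.cell_subset_cell_take k b) (C.cell_subset_cell_take k c)))
        have hc : c ∈ F₄ := (hmem c).2 ⟨hbc.2.1, by
          linarith [dist_triangle (C.wordMap (v.take k) 0) (C.wordMap (b.take k) 0) (C.wordMap (c.take k) 0)]⟩
        exact (hmem' c).2 ⟨hc, ((hmem' b).1 ih).2.tail ⟨((hmem' b).1 ih).1, hc, hbc.2.2⟩⟩
    exact absurd (hcon v₁ (hall v₁ (hlink v hv v₁ hv₁))) (not_le.2 hfar)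
  have hsk : C.IsSkeleton j (C.fold k j F') := by
    rcases C.isSkeleton_fold_or (fun u hu => hF u (hF'F u hu)) ⟨v, hv'⟩ hlink' with h | ⟨p, hp'⟩
    · exact h
    · exfalso
      obtain ⟨u, hu, hul⟩ := hreach
      obtain ⟨l, hl⟩ := hp' v hv'
      obtain ⟨l', hl'⟩ := hp' u hu
      have h1 := C.dist_center_le (x := v.take k) (y := p) ⟨_, spin_mem_stdBody l, hl.symm⟩
      have h2 := C.dist_center_le (x := u.take k) (y := p) ⟨_, spin_mem_stdBody l', hl'.symm⟩
      rw [hlen v hv] at h1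
      rw [hlen u (hF'F u hu)] at h2
      linarith [dist_triangle_right (C.wordMap (v.take k) 0) (C.wordMap (u.take k) 0) p]
  refine (hskel _ hsk).trans ((C.sum_fold_le k j hρ F').trans ?_)
  exact Finset.sum_le_sum_of_subset_of_nonneg (Finset.filter_subset _ _)
    fun u _ _ => C.orbitSum_nonneg hρ _

open scoped Classical in
/-- A weight for the skeletons of level `j` gives a weight for the skeletons of level `k + j`, with a
small sum of squares, as such a skeleton visits at least `const * ratio ^ (-k)` tiles of level `k`. -/
theorem exists_hasWeight_add : ∃ B > 0, ∃ k₀ : ℕ, ∀ k j E, k₀ ≤ k → C.HasWeight j E →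
    C.HasWeight (k + j) (B * (Fintype.card S * C.ratio ^ 2) ^ k * E) := by
  have hN0 : N ≠ 0 := by have := C.three_le; omega
  have := finite_polygonGroup hN0
  let _ := Fintype.ofFinite (polygonGroup N)
  obtain ⟨M, hM⟩ := C.exists_card_le 4
  obtain ⟨δ, hδ, hdiam⟩ := C.exists_diam
  set γ : ℝ := (Fintype.card (polygonGroup N) : ℝ) with hγ
  have hγ0 : 0 < γ := by
    rw [hγ]
    exact Nat.cast_pos.2 Fintype.card_pos
  obtain ⟨k₀, hk₀⟩ := exists_pow_lt_of_lt_one (show 0 < δ / 6 by positivity) C.ratio_lt_one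
  set M' : ℝ := M + 1 with hM'
  have hM'0 : 0 < M' := by positivity
  refine ⟨(2 * M' / δ) ^ 2 * γ ^ 2, by positivity, k₀, fun k j E hk hE => ?_⟩
  obtain ⟨ρ, hρ, hskel, hsum⟩ := hE
  have hp := C.ratio_pow_pos k
  have hpk : 6 * C.ratio ^ k < δ := by
    have := pow_le_pow_of_le_one C.ratio_pos.le C.ratio_lt_one.le hk
    linarith
  set ε : ℝ := 2 * M' / δ * C.ratio ^ k with hε
  have hε0 : 0 < ε := by positivity
  refine ⟨fun v => ε * C.orbitSum ρ (v.drop k), fun v => mul_nonneg hε0.le (C.orbitSum_nonneg hρ _), ?_, ?_⟩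
  · intro F hF
    have hlink := C.isLinked_of_isPreconnected hF.isPreconnected
    have hlen : ∀ u ∈ F, (u.take k).length = k := fun u hu => by
      rw [List.length_take, hF.length_eq u hu]; omega
    set V := F.image (List.take k) with hV
    obtain ⟨y, hy, y', hy', hyy'⟩ := hdiam _ F hF
    have hcov : ∀ z ∈ C.realization F, ∃ x ∈ V, dist (C.wordMap x 0) z ≤ C.ratio ^ k := by
      intro z hz
      obtain ⟨u, hu, hzu⟩ := C.mem_realization.1 hz
      refine ⟨u.take k, Finset.mem_image_of_mem _ hu, ?_⟩
      have := C.dist_center_le (C.cell_subset_tile _ (C.cell_subset_cell_take k u hzu))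
      rwa [hlen u hu] at this
    have hcard := dist_le_of_subset_iUnion_closedBall hF.isPreconnected hp.le hcov hy hy'
    have hnear : ∀ x ∈ V, 1 ≤ ∑ u ∈ F, if dist (C.wordMap x 0) (C.wordMap (u.take k) 0) ≤ 4 * C.ratio ^ k
        then C.orbitSum ρ (u.drop k) else 0 := by
      intro x hx
      obtain ⟨v, hv, rfl⟩ := Finset.mem_image.1 hx
      rw [← Finset.sum_filter]
      obtain ⟨v₁, hv₁, hfar⟩ : ∃ v₁ ∈ F, 2 * C.ratio ^ k <
          dist (C.wordMap (v.take k) 0) (C.wordMap (v₁.take k) 0) := by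
        by_contra! hcon
        have hz : ∀ z ∈ C.realization F, dist (C.wordMap (v.take k) 0) z ≤ 3 * C.ratio ^ k := by
          intro z hz
          obtain ⟨x, hx, hxz⟩ := hcov z hz
          obtain ⟨u, hu, rfl⟩ := Finset.mem_image.1 hx
          linarith [hcon u hu, dist_triangle (C.wordMap (v.take k) 0) (C.wordMap (u.take k) 0) z]
        linarith [hz y hy, hz y' hy', dist_triangle_left y y' (C.wordMap (v.take k) 0)]
      exact C.one_le_sum_near hρ hskel hF.length_eq hlink hv hv₁ hfar
    have h1 : (V.card : ℝ) ≤ M' * ∑ u ∈ F, C.orbitSum ρ (u.drop k) := by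
      have h2 := Finset.card_nsmul_le_sum V _ 1 hnear
      rw [nsmul_eq_mul, mul_one, Finset.sum_comm] at h2
      refine h2.trans ?_
      rw [Finset.mul_sum]
      refine Finset.sum_le_sum fun u hu => ?_
      rw [← Finset.sum_filter, Finset.sum_const, nsmul_eq_mul]
      refine mul_le_mul_of_nonneg_right ?_ (C.orbitSum_nonneg hρ _)
      have h3 := hM k (C.wordMap (u.take k) 0)
        (V.filter fun x => dist (C.wordMap x 0) (C.wordMap (u.take k) 0) ≤ 4 * C.ratio ^ k) fun x hx => by
          rw [Finset.mem_filter] at hx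
          obtain ⟨v, hv, rfl⟩ := Finset.mem_image.1 hx.1
          exact ⟨hlen v hv, hx.2⟩
      have h4 : (((V.filter fun x => dist (C.wordMap x 0) (C.wordMap (u.take k) 0) ≤ 4 * C.ratio ^ k).card : ℕ) : ℝ)
          ≤ M := by exact_mod_cast h3
      linarith
    rw [← Finset.mul_sum]
    have h5 : δ ≤ M' * (∑ u ∈ F, C.orbitSum ρ (u.drop k)) * (2 * C.ratio ^ k) :=
      (hyy'.trans hcard).trans (mul_le_mul_of_nonneg_right h1 (by positivity))
    have h6 : ε * ∑ u ∈ F, C.orbitSum ρ (u.drop k) =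
        (M' * (∑ u ∈ F, C.orbitSum ρ (u.drop k)) * (2 * C.ratio ^ k)) / δ := by
      rw [hε]; ring
    rw [h6, le_div_iff₀ hδ, one_mul]
    exact h5
  · rw [sum_words_add]
    have : ∀ s ∈ words S k, ∑ t ∈ words S j, (ε * C.orbitSum ρ ((s ++ t).drop k)) ^ 2 ≤ ε ^ 2 * (γ ^ 2 * E) := by
      intro s hs
      rw [mem_words] at hs
      have h1 := (C.sum_orbitSum_sq_le j ρ).trans (mul_le_mul_of_nonneg_left hsum (sq_nonneg _))
      refine le_trans (le_of_eq ?_) (mul_le_mul_of_nonneg_left h1 (sq_nonneg ε))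
      rw [Finset.mul_sum]
      refine Finset.sum_congr rfl fun t _ => ?_
      rw [List.drop_left' hs, mul_pow]
    refine (Finset.sum_le_card_nsmul _ _ _ this).trans (le_of_eq ?_)
    rw [nsmul_eq_mul, card_words, hε, mul_pow, mul_pow, ← pow_mul, ← pow_mul]
    ring

/-- The potentials for the weights of skeletons have energies that decay exponentially in the
difference of the levels. -/
theorem exists_potential_of_hasWeight [Nontrivial S] : ∃ M > 0, ∀ (n k j : ℕ) (w : List S) (E : ℝ), 1 ≤ k →
    w.length = n → C.HasWeight j E → ∃ f : List S → ℝ,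
      (∀ v, v.length = n + k + j → v.take n = w → f v = 1) ∧
      (∀ v, v.length = n + k + j → ¬ (C.cell w ∩ C.cell (v.take n)).Nonempty → f v = 0) ∧
      C.energy (words S (n + k + j)) f ≤ M * (Fintype.card S * C.ratio ^ 2) ^ k * E := by
  obtain ⟨M, hM, hpot⟩ := C.exists_potential
  obtain ⟨B, hB, k₀, hw⟩ := C.exists_hasWeight_add
  have hs : (1 : ℝ) ≤ Fintype.card S := by exact_mod_cast Fintype.card_pos
  set s : ℝ := (Fintype.card S : ℝ) with hsdef
  have hr := C.ratio_pos
  have hq1 := C.card_mul_ratio_sq_lt_one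
  set q : ℝ := s * C.ratio ^ 2 with hq
  have hq0 : 0 < q := by positivity
  refine ⟨M * s ^ k₀ / q ^ k₀ + M * s * B / q, by positivity, fun n k j w E hk hwn hE => ?_⟩
  have hE0 := hE.nonneg
  rcases le_or_gt k k₀ with hkk | hkk
  · obtain ⟨f, h1, h2, h3⟩ := hpot n k j w E hk hwn hE
    refine ⟨f, h1, h2, h3.trans (mul_le_mul_of_nonneg_right ?_ hE0)⟩
    have e1 : s ^ k ≤ s ^ k₀ := pow_le_pow_right₀ hs hkk
    have e2 : q ^ k₀ ≤ q ^ k := pow_le_pow_of_le_one hq0.le hq1.le hkk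
    have e3 : M * s ^ k ≤ M * s ^ k₀ / q ^ k₀ * q ^ k := by
      rw [div_mul_eq_mul_div, le_div_iff₀ (by positivity)]
      gcongr
    refine e3.trans (mul_le_mul_of_nonneg_right ?_ (by positivity))
    have : 0 ≤ M * s * B / q := by positivity
    linarith
  · obtain ⟨k', rfl⟩ : ∃ k', k = k' + 1 := ⟨k - 1, by omega⟩
    obtain ⟨f, h1, h2, h3⟩ := hpot n 1 (k' + j) w _ le_rfl hwn (hw k' j E (by omega) hE)
    have hl : n + 1 + (k' + j) = n + (k' + 1) + j := by ring
    rw [hl] at h1 h2 h3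
    refine ⟨f, h1, h2, h3.trans ?_⟩
    have e : M * s ^ 1 * (B * q ^ k' * E) = M * s * B / q * q ^ (k' + 1) * E := by
      field_simp; ring
    rw [e]
    refine mul_le_mul_of_nonneg_right (mul_le_mul_of_nonneg_right ?_ (by positivity)) hE0
    have : 0 ≤ M * s ^ k₀ / q ^ k₀ := by positivity
    linarith

end Carpet

end PolygonCarpet

/-! ### Oscillation -/

namespace PolygonCarpet

namespace Carpet

variable {N : ℕ} {S : Type*} [Fintype S] (C : Carpet N S)

variable {C} in
theorem IsLinked.abs_sub_le {F : Finset (List S)} (hF : C.IsLinked F) {f γ : List S → ℝ}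
    (hγ : ∀ v, 0 ≤ γ v) (hf : ∀ u v, C.Meets F u v → |f u - f v| ≤ γ u) {a b : List S} (ha : a ∈ F)
    (hb : b ∈ F) : |f a - f b| ≤ 2 * ∑ v ∈ F, γ v := by
  have key : ∀ a ∈ F, ∀ b ∈ F, f b - f a ≤ 2 * ∑ v ∈ F, γ v := by
    intro a ha b hb
    have hsub : Set.Icc (f a) (f b) ⊆ ⋃ v ∈ F, Set.Icc (f v - γ v) (f v + γ v) := by
      intro t ht
      by_contra hcon
      have hnot : ∀ v ∈ F, f v ≤ t → f v + γ v < t := by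
        intro v hv hvt
        by_contra! hle
        exact hcon (Set.mem_biUnion hv ⟨by linarith [hγ v], hle⟩)
      have hlt : ∀ v, Relation.ReflTransGen (C.Meets F) a v → f v < t := by
        intro v hv
        induction hv with
        | refl => linarith [hnot a ha ht.1, hγ a]
        | @tail v v' _ hvv' ih =>
          have h1 := hnot v hvv'.1 ih.le
          have h2 := (abs_le.1 (hf v v' hvv')).1
          linarith
      exact absurd (hlt b (hF a ha b hb)) (not_lt.2 ht.2)
    have h2 := (MeasureTheory.measure_mono (μ := MeasureTheory.volume) hsub).trans
      (MeasureTheory.measure_biUnion_finset_le F _)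
    simp only [Real.volume_Icc] at h2
    rw [← ENNReal.ofReal_sum_of_nonneg (fun v _ => by linarith [hγ v])] at h2
    have h0 : 0 ≤ ∑ v ∈ F, (f v + γ v - (f v - γ v)) := Finset.sum_nonneg fun v _ => by linarith [hγ v]
    refine ((ENNReal.ofReal_le_ofReal_iff h0).1 h2).trans (le_of_eq ?_)
    rw [Finset.mul_sum]
    exact Finset.sum_congr rfl fun v _ => by ring
  rw [abs_le]
  constructor <;> linarith [key a ha b hb, key b hb a ha]

theorem cell_append_inter_nonempty_iff (w u v : List S) :
    (C.cell (w ++ u) ∩ C.cell (w ++ v)).Nonempty ↔ (C.cell u ∩ C.cell v).Nonempty := by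
  rw [cell_append, cell_append, ← Set.image_inter (C.wordMap_injective w), Set.image_nonempty]

open scoped Classical in
theorem energy_append_le {m : ℕ} {w : List S} {A : Finset (List S)} (hA : ∀ u ∈ words S m, w ++ u ∈ A)
    (f : List S → ℝ) : C.energy (words S m) (fun u => f (w ++ u)) ≤ C.energy A f := by
  have hinj : Function.Injective (fun u : List S => w ++ u) := fun _ _ h => List.append_cancel_left h
  have hsub : (words S m).image (fun u => w ++ u) ⊆ A := by
    intro v hv
    obtain ⟨u, hu, rfl⟩ := Finset.mem_image.1 hv
    exact hA u hu
  rw [energy, energy]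
  refine mul_le_mul_of_nonneg_left ?_ (by norm_num)
  have hnn : ∀ v v' : List S, 0 ≤ (if (C.cell v ∩ C.cell v').Nonempty then (f v - f v') ^ 2 else 0) := by
    intro v v'; split_ifs <;> positivity
  refine le_trans ?_ (Finset.sum_le_sum_of_subset_of_nonneg hsub fun v _ _ => Finset.sum_nonneg fun v' _ => hnn v v')
  rw [Finset.sum_image hinj.injOn]
  refine Finset.sum_le_sum fun u _ => ?_
  refine le_trans ?_ (Finset.sum_le_sum_of_subset_of_nonneg hsub fun v' _ _ => hnn _ v')
  rw [Finset.sum_image hinj.injOn]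
  refine le_of_eq (Finset.sum_congr rfl fun u' _ => ?_)
  rw [if_congr (C.cell_append_inter_nonempty_iff w u u') rfl rfl]

open scoped Classical in
theorem sq_sub_le_energy {A : Finset (List S)} (f : List S → ℝ) {v v' : List S} (hv : v ∈ A) (hv' : v' ∈ A)
    (h : (C.cell v ∩ C.cell v').Nonempty) : (f v - f v') ^ 2 ≤ C.energy A f := by
  by_cases hne : v = v'
  · subst hne
    rw [sub_self, zero_pow two_ne_zero, energy]
    refine mul_nonneg (by norm_num) (Finset.sum_nonneg fun v _ => Finset.sum_nonneg fun v' _ => ?_)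
    split_ifs <;> positivity
  have hnn : ∀ v v' : List S, 0 ≤ (if (C.cell v ∩ C.cell v').Nonempty then (f v - f v') ^ 2 else 0) := by
    intro v v'; split_ifs <;> positivity
  have hsub : ({v, v'} : Finset (List S)) ⊆ A := by
    intro x hx
    rcases Finset.mem_insert.1 hx with rfl | hx
    · exact hv
    · rw [Finset.mem_singleton.1 hx]; exact hv'
  have h' : (C.cell v' ∩ C.cell v).Nonempty := by rwa [Set.inter_comm]
  have h1 : (f v - f v') ^ 2 ≤ ∑ x ∈ A, if (C.cell v ∩ C.cell x).Nonempty then (f v - f x) ^ 2 else 0 :=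
    le_trans (by rw [if_pos h]) (Finset.single_le_sum (fun x _ => hnn v x) hv')
  have h2 : (f v - f v') ^ 2 ≤ ∑ x ∈ A, if (C.cell v' ∩ C.cell x).Nonempty then (f v' - f x) ^ 2 else 0 :=
    le_trans (by rw [if_pos h']; exact le_of_eq (by ring)) (Finset.single_le_sum (fun x _ => hnn v' x) hv)
  have h3 := Finset.sum_le_sum_of_subset_of_nonneg (f := fun y => ∑ x ∈ A,
    if (C.cell y ∩ C.cell x).Nonempty then (f y - f x) ^ 2 else 0) hsub
    fun y _ _ => Finset.sum_nonneg fun x _ => hnn y x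
  rw [Finset.sum_pair hne] at h3
  rw [energy]
  linarith

open scoped Classical in
theorem sum_extend_eq {F : Finset (List S)} (γ : List S → ℝ) :
    ∑ v ∈ extend F, γ v = ∑ i, ∑ u ∈ F, γ (i :: u) := by
  rw [extend, Finset.sum_biUnion]
  · refine Finset.sum_congr rfl fun i _ => ?_
    rw [Finset.sum_image fun _ _ _ _ h => (List.cons.inj h).2]
  · intro i _ j _ hij
    rw [Function.onFun, Finset.disjoint_left]
    intro v hv hv'
    obtain ⟨u, -, rfl⟩ := Finset.mem_image.1 hv
    obtain ⟨u', -, h⟩ := Finset.mem_image.1 hv'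
    exact hij (List.cons.inj h).1.symm

/-- If the differences of `f` along a skeleton in each tile are small, geometrically in the level, then
the oscillation of `f` is small: the extended skeleton of a tile is crossed by the extended skeletons
of its subtiles. -/
theorem abs_sub_le_of_skeletons [Nontrivial S] {m : ℕ} {f γ : List S → ℝ} (hγ : ∀ v, 0 ≤ γ v)
    (hf : ∀ u v, u.length = m → v.length = m → (C.cell u ∩ C.cell v).Nonempty → |f u - f v| ≤ γ u)
    {τ θ : ℝ} (hτ : 0 ≤ τ) (hθ : 0 < θ) (hθ1 : θ < 1)
    (hskel : ∀ x j, x.length + 1 + j = m → ∃ F, C.IsSkeleton j F ∧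
      ∑ v ∈ extend F, γ (x ++ v) ≤ τ * θ ^ (x.length + 1))
    (j : ℕ) (x : List S) (hx : x.length + 1 + j = m) (F : Finset (List S)) (hF : C.IsSkeleton j F)
    (hsum : ∑ v ∈ extend F, γ (x ++ v) ≤ τ * θ ^ (x.length + 1)) (a : List S) (ha : a ∈ extend F)
    (u : List S) (hu : u.length = j + 1) :
    |f (x ++ a) - f (x ++ u)| ≤ 3 * τ * θ ^ (x.length + 1) / (1 - θ) := by
  have hθ' : 0 < 1 - θ := by linarith
  have hin : ∀ (j x F) (_ : x.length + 1 + j = m) (_ : C.IsSkeleton j F)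
      (_ : ∑ v ∈ extend F, γ (x ++ v) ≤ τ * θ ^ (x.length + 1)) (a b) (_ : a ∈ extend F)
      (_ : b ∈ extend F), |f (x ++ a) - f (x ++ b)| ≤ 2 * (τ * θ ^ (x.length + 1)) := by
    intro j x F hx hF hsum a b ha hb
    have hE := hF.extend C
    refine (IsLinked.abs_sub_le (C.isLinked_of_isPreconnected hE.isPreconnected)
      (f := fun v => f (x ++ v)) (γ := fun v => γ (x ++ v)) (fun v => hγ _) ?_ ha hb).trans (by linarith)
    rintro v v' ⟨hv, hv', hm⟩
    refine hf _ _ ?_ ?_ ((C.cell_append_inter_nonempty_iff x v v').2 hm)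
    · rw [List.length_append, hE.length_eq v hv]; omega
    · rw [List.length_append, hE.length_eq v' hv']; omega
  induction j generalizing x F a u with
  | zero =>
    obtain ⟨i, rfl⟩ := List.length_eq_one_iff.1 hu
    have hu' : [i] ∈ extend F := by
      obtain ⟨v, hv⟩ := hF.nonempty
      obtain rfl := List.length_eq_zero_iff.1 (hF.length_eq v hv)
      exact mem_extend.2 ⟨i, [], hv, rfl⟩
    refine (hin _ x F hx hF hsum a [i] ha hu').trans ?_
    rw [le_div_iff₀ hθ']
    have : 0 ≤ τ * θ ^ (x.length + 1) := by positivity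
    nlinarith
  | succ j ih =>
    cases u with
    | nil => simp at hu
    | cons i u =>
    rw [List.length_cons, add_left_inj] at hu
    obtain ⟨F', hF', hsum'⟩ := hskel (x ++ [i]) j (by rw [List.length_append]; simp; omega)
    obtain ⟨c, hc, b, hb, hcb⟩ := IsSkeleton.exists_crossing C hF (hF'.extend C)
    have hi : i :: c ∈ extend F := mem_extend.2 ⟨i, c, hc, rfl⟩
    have h1 := hin _ x F hx hF hsum a (i :: c) ha hi
    have h2 : |f (x ++ i :: c) - f (x ++ i :: b)| ≤ γ (x ++ i :: c) := by
      refine hf _ _ ?_ ?_ ?_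
      · rw [List.length_append, List.length_cons, hF.length_eq c hc]; omega
      · rw [List.length_append, List.length_cons, (hF'.extend C).length_eq b hb]; omega
      · rw [cell_append_inter_nonempty_iff]
        exact (C.cell_append_inter_nonempty_iff [i] c b).2 hcb
    have h3 : γ (x ++ i :: c) ≤ τ * θ ^ (x.length + 1) :=
      (Finset.single_le_sum (f := fun v => γ (x ++ v)) (fun v _ => hγ _) hi).trans hsum
    have h4 := ih (x ++ [i]) (by rw [List.length_append]; simp; omega) F' hF' hsum' b hb u hu
    simp only [List.append_assoc, List.singleton_append, List.length_append, List.length_singleton] at h4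
    have h5 := abs_sub_le (f (x ++ a)) (f (x ++ i :: c)) (f (x ++ i :: u))
    have h6 := abs_sub_le (f (x ++ i :: c)) (f (x ++ i :: b)) (f (x ++ i :: u))
    have h7 : 3 * τ * θ ^ (x.length + 1) / (1 - θ) =
        3 * (τ * θ ^ (x.length + 1)) + 3 * τ * θ ^ (x.length + 1 + 1) / (1 - θ) := by
      rw [pow_succ θ (x.length + 1)]; field_simp; ring
    rw [h7]
    linarith

open scoped Classical in
/-- A function on the words of length `m` oscillates little if its energy is small compared to the
inverse of a resistance `R` that dominates the weights of skeletons of all levels. -/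
theorem exists_oscillation_le [Nontrivial S] {M : ℝ} (hM : 0 < M) : ∃ A > 0, ∀ (m : ℕ) (R : ℝ), 1 ≤ m → 0 ≤ R →
    (∀ k j E, 1 ≤ k → k + j = m → C.HasWeight j E →
      1 ≤ M * (Fintype.card S * C.ratio ^ 2) ^ k * E * R) →
    ∀ (f : List S → ℝ) (u v : List S), u.length = m → v.length = m →
      (f u - f v) ^ 2 ≤ A * R * C.energy (words S m) f := by
  have hs : (1 : ℝ) ≤ Fintype.card S := by exact_mod_cast Fintype.card_pos
  set s : ℝ := (Fintype.card S : ℝ) with hsdef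
  have hr := C.ratio_pos
  have hq1 := C.card_mul_ratio_sq_lt_one
  set q : ℝ := s * C.ratio ^ 2 with hq
  have hq0 : 0 < q := by positivity
  set θ := Real.sqrt q with hθ
  have hθ0 : 0 < θ := Real.sqrt_pos.2 hq0
  have hθ1 : θ < 1 := by rw [hθ, Real.sqrt_lt' one_pos]; linarith
  have hθ2 : θ ^ 2 = q := Real.sq_sqrt hq0.le
  have hθ' : 0 < 1 - θ := by linarith
  refine ⟨(6 * θ / (1 - θ)) ^ 2 * (2 * s * M), by positivity, fun m R hm hR hw f u v hu hv => ?_⟩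
  set D := C.energy (words S m) f with hD
  set γ : List S → ℝ := fun v => Real.sqrt (∑ v' ∈ words S m,
    if (C.cell v ∩ C.cell v').Nonempty then (f v - f v') ^ 2 else 0) with hγdef
  have hγ : ∀ v, 0 ≤ γ v := fun v => Real.sqrt_nonneg _
  have hnn : ∀ v v' : List S, 0 ≤ (if (C.cell v ∩ C.cell v').Nonempty then (f v - f v') ^ 2 else 0) := by
    intro v v'; split_ifs <;> positivity
  have hγsq : ∀ v, γ v ^ 2 = ∑ v' ∈ words S m,
      if (C.cell v ∩ C.cell v').Nonempty then (f v - f v') ^ 2 else 0 := fun v =>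
    Real.sq_sqrt (Finset.sum_nonneg fun v' _ => hnn v v')
  have hγsum : ∑ v ∈ words S m, γ v ^ 2 = 2 * D := by
    rw [hD, energy, Finset.sum_congr rfl fun v _ => hγsq v]; ring
  have hf : ∀ u v, u.length = m → v.length = m → (C.cell u ∩ C.cell v).Nonempty → |f u - f v| ≤ γ u := by
    intro u v _ hv huv
    refine Real.abs_le_sqrt ?_
    refine le_trans ?_ (Finset.single_le_sum (fun v' _ => hnn u v') (mem_words.2 hv))
    rw [if_pos huv]
  have hD0 : 0 ≤ D := by
    have : 0 ≤ ∑ v ∈ words S m, γ v ^ 2 := Finset.sum_nonneg fun _ _ => sq_nonneg _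
    linarith
  -- in each tile there is a skeleton with small differences, as otherwise the differences give a weight
  have hskel : ∀ τ, 0 < τ → 2 * s * M * R * D < τ ^ 2 → ∀ x j, x.length + 1 + j = m →
      ∃ F, C.IsSkeleton j F ∧ ∑ v ∈ extend F, γ (x ++ v) ≤ τ * θ ^ (x.length + 1) := by
    intro τ hτ hτ2 x j hx
    by_contra! hcon
    set k := x.length + 1 with hk
    have ht : 0 < τ * θ ^ k := by positivity
    have hE : C.HasWeight j (2 * s * D / (τ * θ ^ k) ^ 2) := by
      refine ⟨fun u => (∑ i, γ (x ++ i :: u)) / (τ * θ ^ k), fun u =>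
        div_nonneg (Finset.sum_nonneg fun i _ => hγ _) ht.le, fun F hF => ?_, ?_⟩
      · rw [← Finset.sum_div, le_div_iff₀ ht, one_mul, Finset.sum_comm, ← sum_extend_eq (fun v => γ (x ++ v))]
        exact (hcon F hF).le
      · simp only [div_pow]
        rw [← Finset.sum_div]
        refine div_le_div_of_nonneg_right ?_ (by positivity)
        have h1 : ∀ u ∈ words S j, (∑ i, γ (x ++ i :: u)) ^ 2 ≤ s * ∑ i, γ (x ++ i :: u) ^ 2 :=
          fun u _ => sq_sum_le_card_mul_sum_sq
        refine (Finset.sum_le_sum h1).trans ?_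
        rw [← Finset.mul_sum, Finset.sum_comm, mul_comm 2 s, mul_assoc]
        refine mul_le_mul_of_nonneg_left ?_ (by linarith)
        rw [← sum_words_succ j (fun v => γ (x ++ v) ^ 2), ← hγsum, ← hx,
          show x.length + 1 + j = x.length + (j + 1) by ring, sum_words_add x.length (j + 1)]
        exact Finset.single_le_sum (f := fun y => ∑ v ∈ words S (j + 1), γ (y ++ v) ^ 2)
          (fun y _ => Finset.sum_nonneg fun _ _ => sq_nonneg _) (mem_words.2 rfl)
    have h1 := hw k j _ (by omega) hx hE
    have h2 : M * q ^ k * (2 * s * D / (τ * θ ^ k) ^ 2) * R = 2 * s * M * R * D / τ ^ 2 := by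
      have : (τ * θ ^ k) ^ 2 = τ ^ 2 * q ^ k := by rw [← hθ2]; ring
      have hqk : q ^ k ≠ 0 := (pow_pos hq0 k).ne'
      rw [this]
      generalize q ^ k = Q at hqk ⊢
      field_simp
    rw [h2, le_div_iff₀ (by positivity), one_mul] at h1
    linarith
  have hbound : ∀ τ, 0 < τ → 2 * s * M * R * D < τ ^ 2 → (f u - f v) ^ 2 ≤ (6 * θ / (1 - θ)) ^ 2 * τ ^ 2 := by
    intro τ hτ hτ2
    have hsk := hskel τ hτ hτ2
    obtain ⟨j, rfl⟩ : ∃ j, m = j + 1 := ⟨m - 1, by omega⟩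
    obtain ⟨F, hF, hsum⟩ := hsk [] j (by simp; omega)
    obtain ⟨a, ha⟩ := (hF.extend C).nonempty
    have key := C.abs_sub_le_of_skeletons hγ hf hτ.le hθ0 hθ1 hsk j [] (by simp; omega) F hF hsum a ha
    have h1 := key u hu
    have h2 := key v hv
    simp only [List.nil_append, List.length_nil, zero_add, pow_one] at h1 h2
    have h3 : |f u - f v| ≤ 6 * θ / (1 - θ) * τ := by
      have h4 := abs_sub_le (f u) (f a) (f v)
      rw [abs_sub_comm (f u) (f a)] at h4
      have : 6 * θ / (1 - θ) * τ = 3 * τ * θ / (1 - θ) + 3 * τ * θ / (1 - θ) := by ring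
      linarith
    rw [← mul_pow]
    exact sq_le_sq' (abs_le.1 h3).1 (abs_le.1 h3).2
  have hfin : (f u - f v) ^ 2 ≤ (6 * θ / (1 - θ)) ^ 2 * (2 * s * M * R * D) := by
    have hc : 0 < (6 * θ / (1 - θ)) ^ 2 := by positivity
    rw [← div_le_iff₀' hc]
    refine le_of_forall_gt_imp_ge_of_dense fun t ht => ?_
    have ht0 : 0 < t := lt_of_le_of_lt (by positivity) ht
    rw [div_le_iff₀' hc]
    have := hbound (Real.sqrt t) (Real.sqrt_pos.2 ht0) (by rwa [Real.sq_sqrt ht0.le])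
    rwa [Real.sq_sqrt ht0.le] at this
  calc _ ≤ _ := hfin
    _ = _ := by ring

/-- The values of a function on two intersecting cells. -/
theorem exists_sq_sub_le [Nontrivial S] {M : ℝ} (hM : 0 < M) : ∃ A > 0, ∀ (m : ℕ) (R : ℝ), 1 ≤ m → 0 ≤ R →
    (∀ k j E, 1 ≤ k → k + j = m → C.HasWeight j E →
      1 ≤ M * (Fintype.card S * C.ratio ^ 2) ^ k * E * R) →
    ∀ (w w' : List S) (B : Finset (List S)) (f : List S → ℝ), (C.cell w ∩ C.cell w').Nonempty →
      (∀ u ∈ words S m, w ++ u ∈ B) → (∀ u ∈ words S m, w' ++ u ∈ B) →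
      ∀ u ∈ words S m, ∀ u' ∈ words S m, (f (w ++ u) - f (w' ++ u')) ^ 2 ≤ A * R * C.energy B f := by
  obtain ⟨A, hA, hosc⟩ := C.exists_oscillation_le hM
  refine ⟨3 * (2 * A + M), by positivity, fun m R hm hR hw w w' B f hww' hB hB' u hu u' hu' => ?_⟩
  have hosc' := hosc m R hm hR hw
  -- subcells that contain a common point
  have hsub : ∀ m (y : ℂ), y ∈ C.K → ∃ v, v.length = m ∧ y ∈ C.cell v := by
    intro m
    induction m with
    | zero => exact fun y hy => ⟨[], rfl, y, hy, rfl⟩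
    | succ m ih =>
      intro y hy
      rw [C.K_eq] at hy
      obtain ⟨i, z, hz, rfl⟩ := Set.mem_iUnion.1 hy
      obtain ⟨v, hv, c, hc, rfl⟩ := ih z hz
      exact ⟨i :: v, by rw [List.length_cons, hv], c, hc, rfl⟩
  obtain ⟨y, ⟨a, ha, hay⟩, ⟨a', ha', hay'⟩⟩ := hww'
  obtain ⟨v, hv, hav⟩ := hsub m a ha
  obtain ⟨v', hv', hav'⟩ := hsub m a' ha'
  have hvv' : (C.cell (w ++ v) ∩ C.cell (w' ++ v')).Nonempty := by
    rw [cell_append, cell_append]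
    exact ⟨y, ⟨a, hav, hay⟩, ⟨a', hav', hay'⟩⟩
  have h1 := sq_sub_le_energy C f (hB v (mem_words.2 hv)) (hB' v' (mem_words.2 hv')) hvv'
  set D := C.energy B f with hD
  have hD0 : 0 ≤ D := (sq_nonneg _).trans h1
  have h2 := (hosc' (fun u => f (w ++ u)) u v (mem_words.1 hu) hv).trans
    (mul_le_mul_of_nonneg_left (C.energy_append_le hB f) (by positivity))
  have h3 := (hosc' (fun u => f (w' ++ u)) v' u' hv' (mem_words.1 hu')).trans
    (mul_le_mul_of_nonneg_left (C.energy_append_le hB' f) (by positivity))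
  have h4 : 1 ≤ M * R := by
    have hw0 : C.HasWeight 0 1 := by
      refine ⟨fun _ => 1, fun _ => zero_le_one, fun F hF => ?_, by rw [sum_words_zero]; norm_num⟩
      rw [Finset.sum_const, nsmul_eq_mul, mul_one]
      exact_mod_cast hF.nonempty.card_pos
    have h5 := hw m 0 1 hm rfl hw0
    have h6 : ((Fintype.card S : ℝ) * C.ratio ^ 2) ^ m ≤ 1 :=
      pow_le_one₀ (by positivity) C.card_mul_ratio_sq_lt_one.le
    have h7 : M * (Fintype.card S * C.ratio ^ 2) ^ m * 1 * R ≤ M * 1 * 1 * R := by gcongr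
    linarith
  have h8 : D ≤ M * R * D := le_mul_of_one_le_left hD0 h4
  nlinarith [sq_nonneg (f (w ++ u) - f (w ++ v) - (f (w ++ v) - f (w' ++ v'))),
    sq_nonneg (f (w ++ u) - f (w ++ v) - (f (w' ++ v') - f (w' ++ u'))),
    sq_nonneg (f (w ++ v) - f (w' ++ v') - (f (w' ++ v') - f (w' ++ u')))]

end Carpet

end PolygonCarpet

/-! ### Reduction to the standard position -/

namespace PolygonCarpet

namespace Carpet

variable {N : ℕ} {S : Type*} [Fintype S] (C : Carpet N S)

/-- The attractor is not contained in the boundary of the polygon. -/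
theorem exists_mem_K_notMem_stdSide [Nontrivial S] : ∃ y ∈ C.K, ∀ k, y ∉ stdSide N k := by
  have hN := C.three_le
  by_contra! hcon
  -- a point of the attractor on a common side of two small polygons would be a common vertex
  obtain ⟨i, j, hij⟩ := exists_pair_ne S
  obtain ⟨i, j, hij, k₀, k₁, h1, h2⟩ : ∃ i j, i ≠ j ∧ SideTouching N (C.map i) (C.map j) := by
    rcases Relation.ReflTransGen.cases_head (C.chain i j) with h | ⟨c, hc, -⟩
    · exact absurd h hij
    · refine ⟨i, c, ?_, hc⟩
      rintro rfl
      obtain ⟨k, k', h, -⟩ := hc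
      rw [Set.inter_self] at h
      have h0 : C.map i 0 ∈ C.map i '' stdSide N k := h ▸ ⟨0, zero_mem_body hN, rfl⟩
      obtain ⟨y, hy, hy0⟩ := h0
      rw [C.map_injective i hy0] at hy
      have := norm_ge_of_mem_stdSide hy
      rw [norm_zero] at this
      linarith [cos_pi_div_pos hN]
  obtain ⟨g, hg, hgk⟩ := exists_symmetry_of_common_side hN C.ratio_pos (C.isTile i) (C.isTile j) h2
  have hspin₀ : ∀ y ∈ C.K, y ∈ stdSide N k₀ → ∃ l, y = spin N (2 * l) := by
    intro y hy hyk
    obtain ⟨k, hk⟩ := hcon (C.map i y) (by rw [C.K_eq]; exact Set.mem_iUnion.2 ⟨i, y, hy, rfl⟩)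
    exact C.exists_eq_spin_of_mem_stdSide (x := [i]) (x' := [j]) rfl (by simpa using hij)
      (C.K_subset hy) (map_mem_stdBody hg (C.K_subset hy)) (hgk y hyk) hk
  have hspin : ∀ y ∈ C.K, ∃ l, y = spin N (2 * l) := by
    intro y hy
    obtain ⟨k, hk⟩ := hcon y hy
    obtain ⟨g, hg, hgk⟩ := exists_side_to_side (N := N) k k₀
    obtain ⟨l, hl⟩ := hspin₀ (g y) (C.map_mem_K ⟨g, hg⟩ hy) (hgk ▸ ⟨y, hk, rfl⟩)
    obtain ⟨l', hl'⟩ := exists_map_spin ((polygonGroup N).inv_mem hg) l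
    refine ⟨l', ?_⟩
    rw [← hl', ← hl]
    exact (g.symm_apply_apply y).symm
  have hcount : C.K.Countable :=
    (Set.countable_range fun l : ℤ => spin N (2 * l)).mono fun y hy => (hspin y hy).imp fun l hl => hl.symm
  have hsub := hcount.isTotallyDisconnected C.K subset_rfl C.isPreconnected_K
  obtain ⟨y, hy, hy0⟩ := C.exists_mem_K_stdSide 0
  have h3 := hsub (C.map_mem_K ⟨rot N 1, rot_mem 1⟩ hy) hy
  simp only [rot_apply] at h3
  have hynz : y ≠ 0 := by
    rintro rfl
    have := norm_ge_of_mem_stdSide hy0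
    rw [norm_zero] at this
    linarith [cos_pi_div_pos hN]
  have h4 : spin N (2 * 1) = 1 := mul_right_cancel₀ hynz (by rw [h3, one_mul])
  have := spin_ne_spin_add_two hN 0
  rw [mul_zero, zero_add, spin_zero] at this
  exact this (by rw [← h4]; rfl)

theorem take_eq_of_cell_subset [Nontrivial S] {n : ℕ} {v w : List S} (hv : n ≤ v.length)
    (hw : w.length = n) (h : C.cell v ⊆ C.cell w) : v.take n = w := by
  by_contra hne
  obtain ⟨y, hy, hyk⟩ := C.exists_mem_K_notMem_stdSide
  have hl : (v.take n).length = w.length := by rw [List.length_take, hw]; omega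
  have hm : C.wordMap (v.take n) (C.wordMap (v.drop n) y) ∈ C.cell w := by
    apply h
    rw [← wordMap_append, List.take_append_drop]
    exact ⟨y, hy, rfl⟩
  obtain ⟨b, hb, e⟩ := hm
  obtain ⟨k, hk⟩ := C.exists_mem_stdSide hl hne (C.wordMap_mem_body _ (C.K_subset hy)) (C.K_subset hb) e.symm
  have hm : C.wordMap (v.drop n) y ∈ C.wordMap (v.drop n) '' stdBody N ∩ stdSide N k :=
    ⟨⟨y, C.K_subset hy, rfl⟩, hk⟩
  rcases (C.isTile_wordMap (v.drop n)).inter_stdSide C.three_le (C.ratio_pow_pos _)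
    (C.wordMap_image_body _) k with h1 | ⟨l, h1⟩ | ⟨l, h1⟩
  · rw [h1] at hm; exact hm
  · rw [h1] at hm
    obtain ⟨z, hz, hzy⟩ := hm
    rw [C.wordMap_injective _ hzy] at hz
    exact hyk l hz
  · rw [h1] at hm
    apply hyk l
    rw [C.wordMap_injective _ hm]
    exact left_mem_stdSide l

end Carpet

namespace RegularPolygon

variable {N : ℕ} (P : RegularPolygon N)

/-- The affine map that takes the standard polygon to the polygon `P`. -/
noncomputable def place : ℂ →ᵃ[ℝ] ℂ :=
  AffineMap.const ℝ ℂ P.center + (LinearMap.mulLeft ℝ P.spoke).toAffineMap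

theorem place_apply (y : ℂ) : P.place y = P.center + P.spoke * y := rfl

theorem spoke_ne_zero : P.spoke ≠ 0 := by
  intro h
  have := P.side_length
  simp [h] at this

theorem place_injective : Function.Injective P.place := by
  intro x y h
  rw [place_apply, place_apply] at h
  exact mul_left_cancel₀ P.spoke_ne_zero (add_left_cancel h)

theorem place_div (z : ℂ) : P.place ((z - P.center) / P.spoke) = z := by
  have := P.spoke_ne_zero
  rw [place_apply]; field_simp; ring

theorem image_place_preimage (X : Set ℂ) : P.place '' (P.place ⁻¹' X) = X :=
  Set.image_preimage_eq X fun z => ⟨_, P.place_div z⟩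

theorem preimage_place_eq (X : Set ℂ) : P.place ⁻¹' X = (fun z => (z - P.center) / P.spoke) '' X := by
  ext y
  constructor
  · intro hy
    exact ⟨_, hy, P.place_injective (P.place_div _)⟩
  · rintro ⟨z, hz, rfl⟩
    rw [Set.mem_preimage, place_div]; exact hz

theorem exp_eq_spin (k : ℕ) : Complex.exp (2 * Real.pi * Complex.I * k / N) = spin N (2 * k) := by
  rw [spin]
  congr 1
  push_cast
  ring

theorem vertex_eq (k : ℕ) : P.vertex k = P.place (spin N (2 * k)) := by
  rw [vertex, exp_eq_spin, place_apply]

theorem side_eq (k : ℕ) : P.side k = P.place '' stdSide N k := by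
  rw [side, stdSide, image_segment, vertex_eq, vertex_eq]
  push_cast
  rw [mul_add, mul_one]

theorem exists_fin (hN₃ : 3 ≤ N) (k : ℤ) : ∃ j : Fin N, spin N (2 * k) = spin N (2 * (j : ℕ)) := by
  have hN : N ≠ 0 := by omega
  have h0 : (N : ℤ) ≠ 0 := by exact_mod_cast hN
  have h1 := Int.emod_nonneg k h0
  have h2 := Int.emod_lt_of_pos k (show (0 : ℤ) < N by omega)
  refine ⟨⟨(k % N).toNat, by omega⟩, ?_⟩
  rw [spin_two_mul_eq_iff hN]
  simp only [Int.toNat_of_nonneg h1]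
  exact Int.dvd_self_sub_emod

theorem body_eq : P.body = P.place '' stdBody N := by
  rw [body, stdBody, AffineMap.image_convexHull, ← Set.range_comp]
  congr 1
  ext z
  constructor
  · rintro ⟨k, rfl⟩
    exact ⟨(k : ℕ), (P.vertex_eq k).symm⟩
  · rintro ⟨k, rfl⟩
    obtain ⟨j, hj⟩ := exists_fin P.three_le k
    exact ⟨j, by simp only [Function.comp, hj, vertex_eq]⟩

theorem rotation_place (j : ℕ) (y : ℂ) : P.rotation j (P.place y) = P.place (rot N j y) := by
  rw [rotation, place_apply, place_apply, exp_eq_spin, rot_apply]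
  ring

theorem reflection_place (j : ℕ) (y : ℂ) : P.reflection j (P.place y) = P.place (refl N j y) := by
  have h : (starRingEnd ℂ) P.spoke ≠ 0 := (map_ne_zero _).2 P.spoke_ne_zero
  rw [reflection, place_apply, place_apply, exp_eq_spin, refl_apply, add_sub_cancel_left, map_mul]
  field_simp

theorem image_eq_of_isSymmetric {X : Set ℂ} (h : P.IsSymmetric (P.place '' X)) {g : ℂ ≃ₗᵢ[ℝ] ℂ}
    (hg : g ∈ polygonGroup N) : g '' X = X := by
  apply P.place_injective.image_injective
  obtain ⟨k, rfl | rfl⟩ := eq_rot_or_refl hg <;> obtain ⟨j, hj⟩ := exists_fin P.three_le k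
  · have := (h j).1
    rw [Set.image_image] at this ⊢
    simp only [rotation_place] at this
    simpa only [rot_apply, hj] using this
  · have := (h j).2
    rw [Set.image_image] at this ⊢
    simp only [reflection_place] at this
    simpa only [refl_apply, hj] using this

end RegularPolygon

namespace PolygonIFS

variable {N₀ : ℕ} {S : Type*} [Fintype S] (I : PolygonIFS N₀ S)

/-- The similarity `Ψ i` in the coordinates of the standard polygon. -/
noncomputable def stdMap (i : S) (y : ℂ) : ℂ :=
  (I.sign i : ℂ) * I.ratio i * y + (I.map i I.center - I.center) / I.spoke

theorem map_place (i : S) (y : ℂ) : I.map i (I.place y) = I.place (I.stdMap i y) := by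
  have h := I.spoke_ne_zero
  rw [I.place_apply, I.place_apply, stdMap, map, map]
  push_cast
  field_simp
  ring

theorem map_image_place (i : S) (X : Set ℂ) : I.map i '' (I.place '' X) = I.place '' (I.stdMap i '' X) := by
  simp only [Set.image_image, map_place]

theorem isTile_stdMap (i : S) : IsTile (I.ratio i) (I.stdMap i) :=
  ⟨I.sign i, _, I.sign_eq i, fun _ => rfl⟩

theorem map_image_inter (i j : S) : I.map i '' I.body ∩ I.map j '' I.body =
    I.place '' (I.stdMap i '' stdBody N₀ ∩ I.stdMap j '' stdBody N₀) := by
  rw [I.body_eq, map_image_place, map_image_place, Set.image_inter I.place_injective]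

theorem PerfectlyTouching.sideTouching {i j : S} (h : I.PerfectlyTouching i j) :
    SideTouching N₀ (I.stdMap i) (I.stdMap j) := by
  obtain ⟨-, k, k', h1, h2⟩ := h
  refine ⟨(k : ℕ), (k' : ℕ), ?_, ?_⟩
  · apply I.place_injective.image_injective
    rw [← map_image_inter, h1, I.side_eq, map_image_place]
  · apply I.place_injective.image_injective
    rw [← map_image_place, ← map_image_place, ← I.side_eq, ← I.side_eq, h2]

theorem VertexTouching.cornerTouching {i j : S} (h : I.VertexTouching i j) :
    CornerTouching N₀ (I.stdMap i) (I.stdMap j) := by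
  obtain ⟨k, k', h1, h2⟩ := h
  refine ⟨(k : ℕ), (k' : ℕ), ?_, ?_⟩
  · apply I.place_injective.image_injective
    rw [← map_image_inter, h1, I.vertex_eq, map_place, Set.image_singleton]
  · apply I.place_injective
    rw [← map_place, ← map_place, ← I.vertex_eq, ← I.vertex_eq, h2]

theorem PerfectlyTouching.ratio_eq {i j : S} (h : I.PerfectlyTouching i j) : I.ratio i = I.ratio j := by
  obtain ⟨k, k', -, h2⟩ := PerfectlyTouching.sideTouching I h
  have hd : ∀ i k, Metric.diam (I.stdMap i '' stdSide N₀ k) = I.ratio i * dist 1 (spin N₀ 2) := by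
    intro i k
    rw [stdSide, (I.isTile_stdMap i).image_segment, ← convexHull_pair, convexHull_diam, Metric.diam_pair,
      (I.isTile_stdMap i).dist_eq (I.ratio_pos i), dist_side]
  have h3 := hd i k
  rw [h2, hd] at h3
  have h4 : dist 1 (spin N₀ 2) ≠ 0 := by
    rw [dist_ne_zero]
    have := spin_ne_spin_add_two I.three_le 0
    rwa [mul_zero, zero_add, spin_zero] at this
  exact (mul_right_cancel₀ h4 h3).symm

theorem ratio_eq (hI : I.IsPerfect) (i j : S) : I.ratio i = I.ratio j := by
  by_cases hij : i = j
  · rw [hij]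
  · have h := hI.chain i j hij
    clear hij
    induction h with
    | refl => rfl
    | tail _ h ih => exact ih.trans (PerfectlyTouching.ratio_eq I h)

/-- The carpet in the coordinates of the standard polygon. -/
noncomputable def toCarpet (hI : I.IsPerfectPolygonCarpet) : Carpet N₀ S where
  three_le := I.three_le
  ratio := I.minRatio
  ratio_pos := I.minRatio_pos
  ratio_lt_one := by
    have := I.nonempty_index
    obtain ⟨i, hi⟩ := exists_eq_ciInf_of_finite (f := I.ratio)
    rw [minRatio, ← hi]
    exact I.ratio_lt_one i
  map := I.stdMap
  isTile i := by
    have : I.ratio i = I.minRatio := by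
      have := I.nonempty_index
      obtain ⟨j, hj⟩ := exists_eq_ciInf_of_finite (f := I.ratio)
      rw [minRatio, ← hj]
      exact I.ratio_eq hI.toIsPerfect i j
    rw [← this]
    exact I.isTile_stdMap i
  maps_body i := by
    have := I.maps_body i
    rw [I.body_eq] at this
    exact (Set.image_subset_image_iff I.place_injective).1 (by rw [← map_image_place]; exact this)
  symmetric g hg := by
    refine I.image_eq_of_isSymmetric ?_ hg
    have := hI.symmetric
    simp only [I.body_eq, map_image_place] at this
    rwa [Set.image_iUnion]
  nontrivial h := by
    apply hI.nontrivial
    simp only [I.body_eq, map_image_place]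
    rw [← Set.image_iUnion, h]
  K := I.place ⁻¹' I.attractor
  isCompact_K := by
    rw [I.preimage_place_eq]
    exact I.attractor_spec.2.1.image (by fun_prop)
  nonempty_K := by
    obtain ⟨z, hz⟩ := I.attractor_spec.2.2.1
    have hz' := I.attractor_spec.1 hz
    rw [I.body_eq] at hz'
    obtain ⟨y, -, rfl⟩ := hz'
    exact ⟨y, hz⟩
  K_eq := by
    apply I.place_injective.image_injective
    rw [Set.image_iUnion, I.image_place_preimage]
    simp only [← map_image_place, I.image_place_preimage]
    exact I.attractor_spec.2.2.2
  K_subset y hy := by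
    have := I.attractor_spec.1 hy
    rw [I.body_eq] at this
    obtain ⟨z, hz, hzy⟩ := this
    rwa [← I.place_injective hzy]
  isPreconnected_K := by
    rw [I.preimage_place_eq]
    exact hI.connected.isPreconnected.image _ (by fun_prop)
  chain i j := by
    by_cases hij : i = j
    · rw [hij]
    · exact (hI.chain i j hij).lift id fun a b h => PerfectlyTouching.sideTouching I h
  touching i j hij h := by
    have h' : (I.map i '' I.body ∩ I.map j '' I.body).Nonempty := by
      rw [map_image_inter]; exact h.image _
    exact (hI.touching i j hij h').imp (PerfectlyTouching.sideTouching I) (VertexTouching.cornerTouching I)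

end PolygonIFS

end PolygonCarpet

/-! ### Levels, cells and energies -/

namespace PolygonCarpet

namespace PolygonIFS

variable {N₀ : ℕ} {S : Type*} [Fintype S] (I : PolygonIFS N₀ S)

theorem ratio_eq_minRatio (hI : I.IsPerfectPolygonCarpet) (i : S) : I.ratio i = I.minRatio := by
  have := I.nonempty_index
  obtain ⟨j, hj⟩ := exists_eq_ciInf_of_finite (f := I.ratio)
  rw [minRatio, ← hj]
  exact I.ratio_eq hI.toIsPerfect i j

theorem nontrivial_index (I : PolygonIFS N₀ S) : Nontrivial S :=
  Fintype.one_lt_card_iff_nontrivial.1 (by have := I.three_le; have := I.le_card; omega)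

theorem wordRatio_eq (hI : I.IsPerfectPolygonCarpet) (w : List S) :
    I.wordRatio w = I.minRatio ^ w.length := by
  induction w with
  | nil => simp [wordRatio]
  | cons i w ih =>
    rw [List.length_cons, pow_succ', ← ih, ← I.ratio_eq_minRatio hI i]
    simp [wordRatio]

/-- As all ratios are equal, the partition `Λ n` consists of the words of length `n`. -/
theorem level_eq (hI : I.IsPerfectPolygonCarpet) (n : ℕ) : I.level n = words S n := by
  have h0 := (I.toCarpet hI).ratio_pos
  have h1 := (I.toCarpet hI).ratio_lt_one
  change 0 < I.minRatio at h0
  change I.minRatio < 1 at h1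
  ext w
  rw [mem_words, level, Set.Finite.mem_toFinset, levelSet]
  split_ifs with hn
  · rw [Set.mem_singleton_iff, hn, List.length_eq_zero_iff]
  · rw [Set.mem_ofPred_eq, wordRatio_eq I hI, wordRatio_eq I hI,
      pow_le_pow_iff_right_of_lt_one₀ h0 h1, pow_lt_pow_iff_right_of_lt_one₀ h0 h1, List.length_dropLast]
    omega

theorem wordMap_place (hI : I.IsPerfectPolygonCarpet) (w : List S) (y : ℂ) :
    I.wordMap w (I.place y) = I.place ((I.toCarpet hI).wordMap w y) := by
  induction w with
  | nil => rfl
  | cons i w ih =>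
    rw [Carpet.wordMap_cons]
    change I.map i (I.wordMap w (I.place y)) = _
    rw [ih, map_place]
    rfl

theorem cell_eq (hI : I.IsPerfectPolygonCarpet) (w : List S) : I.cell w = I.place '' (I.toCarpet hI).cell w := by
  have h : I.attractor = I.place '' (I.toCarpet hI).K := (I.image_place_preimage I.attractor).symm
  rw [cell, Carpet.cell, h]
  simp only [Set.image_image, wordMap_place I hI]

theorem cell_inter_nonempty_iff (hI : I.IsPerfectPolygonCarpet) (w v : List S) : (I.cell w ∩ I.cell v).Nonempty ↔
    ((I.toCarpet hI).cell w ∩ (I.toCarpet hI).cell v).Nonempty := by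
  rw [cell_eq I hI, cell_eq I hI, ← Set.image_inter I.place_injective, Set.image_nonempty]

theorem cell_subset_iff (hI : I.IsPerfectPolygonCarpet) (w v : List S) : I.cell w ⊆ I.cell v ↔
    (I.toCarpet hI).cell w ⊆ (I.toCarpet hI).cell v := by
  rw [cell_eq I hI, cell_eq I hI, Set.image_subset_image_iff I.place_injective]

theorem graph_adj_iff (hI : I.IsPerfectPolygonCarpet) (n : ℕ) (w v : List S) : (I.graph n).Adj w v ↔ w ≠ v ∧ w.length = n ∧ v.length = n ∧
    ((I.toCarpet hI).cell w ∩ (I.toCarpet hI).cell v).Nonempty := by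
  rw [← cell_inter_nonempty_iff I hI, ← mem_words, ← mem_words, ← I.level_eq hI]
  rfl

theorem mem_subcells_iff (hI : I.IsPerfectPolygonCarpet) (n m : ℕ) {A : Finset (List S)} (hA : ∀ w ∈ A, w.length = n) (v : List S) :
    v ∈ I.subcells n m A ↔ v.length = n + m ∧ v.take n ∈ A := by
  have := I.nontrivial_index
  classical
  rw [subcells, Finset.mem_filter, I.level_eq hI, mem_words]
  refine and_congr_right fun hv => ⟨?_, fun h => ⟨_, h, ?_⟩⟩
  · rintro ⟨w, hw, hvw⟩
    rw [cell_subset_iff I hI] at hvw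
    rwa [(I.toCarpet hI).take_eq_of_cell_subset (by omega) (hA w hw) hvw]
  · rw [cell_subset_iff I hI]
    exact (I.toCarpet hI).cell_subset_cell_take n v

theorem energy_eq (hI : I.IsPerfectPolygonCarpet) (n : ℕ) {A : Finset (List S)} (hA : ∀ w ∈ A, w.length = n) (f : List S → ℝ) :
    I.energy n A f = (I.toCarpet hI).energy A f := by
  classical
  rw [energy, Carpet.energy]
  congr 1
  refine Finset.sum_congr rfl fun w hw => Finset.sum_congr rfl fun v hv => ?_
  by_cases hwv : w = v
  · subst hwv; simp
  · refine if_congr ?_ rfl rfl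
    rw [graph_adj_iff I hI]
    simp [hwv, hA w hw, hA v hv]

theorem not_nonempty_of_mem_farLevel (hI : I.IsPerfectPolygonCarpet) {n : ℕ} {w v : List S} (hw : w.length = n)
    (hv : v ∈ I.farLevel n 2 w) : v.length = n ∧
      ¬ ((I.toCarpet hI).cell w ∩ (I.toCarpet hI).cell v).Nonempty := by
  classical
  rw [farLevel, Finset.mem_filter, I.level_eq hI, mem_words] at hv
  refine ⟨hv.1, fun hm => hv.2 ?_⟩
  by_cases hwv : w = v
  · subst hwv; simp
  · have : (I.graph n).Adj w v := (graph_adj_iff I hI n w v).2 ⟨hwv, hw, hv.1, hm⟩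
    refine (SimpleGraph.edist_le this.toWalk).trans ?_
    simp

/-- All the words of a level have the same weight, so the averages are arithmetic means. -/
theorem average_eq (hI : I.IsPerfectPolygonCarpet) (n m : ℕ) (w : List S) (hw : w.length = n) (f : List S → ℝ) :
    I.average (I.subcells n m {w}) f = ((words S m).card : ℝ)⁻¹ * ∑ u ∈ words S m, f (w ++ u) := by
  classical
  have hsub : I.subcells n m {w} = (words S m).image fun u => w ++ u := by
    ext v
    rw [mem_subcells_iff I hI n m (by simpa using hw), Finset.mem_singleton, Finset.mem_image]
    constructor
    · rintro ⟨h1, h2⟩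
      refine ⟨v.drop n, ?_, ?_⟩
      · rw [mem_words, List.length_drop, h1]; omega
      · rw [← h2, List.take_append_drop]
    · rintro ⟨u, hu, rfl⟩
      rw [mem_words] at hu
      refine ⟨by rw [List.length_append, hw, hu], ?_⟩
      rw [← hw, List.take_left]
  have hinj : Function.Injective (fun u : List S => w ++ u) := fun _ _ h => List.append_cancel_left h
  set κ : ℝ := (I.minRatio ^ (n + m)) ^ I.dimension with hκ
  have hκ0 : κ ≠ 0 := (Real.rpow_pos_of_pos (pow_pos I.minRatio_pos _) _).ne'
  have hwt : ∀ u ∈ words S m, I.wordRatio (w ++ u) ^ I.dimension = κ := by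
    intro u hu
    rw [wordRatio_eq I hI, List.length_append, hw, mem_words.1 hu]
  rw [average, hsub, Finset.sum_image hinj.injOn, Finset.sum_image hinj.injOn, Finset.sum_congr rfl hwt,
    Finset.sum_const, nsmul_eq_mul, Finset.sum_congr rfl fun u hu => by rw [hwt u hu], ← Finset.mul_sum,
    mul_inv, mul_assoc, inv_mul_cancel_left₀ hκ0]

/-- The lower bound for the resistances, in terms of the weights of skeletons, is the hypothesis of the
oscillation estimate, which bounds the difference of the averages over two cells that meet. -/
theorem conditionB (hI : I.IsPerfectPolygonCarpet) : I.ConditionB := by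
  classical
  have := I.nontrivial_index
  set C := I.toCarpet hI with hC
  obtain ⟨M, hM, hpot⟩ := C.exists_potential_of_hasWeight
  obtain ⟨A, hA, hosc⟩ := C.exists_sq_sub_le hM
  refine ⟨A, hA, fun m hm => ?_⟩
  -- a weight for the skeletons bounds all the resistances from below
  have hres : ∀ k j E, 1 ≤ k → k + j = m → C.HasWeight j E →
      (ENNReal.ofReal (M * (Fintype.card S * C.ratio ^ 2) ^ k * E))⁻¹ ≤ I.resistanceConst m := by
    intro k j E hk hkj hE
    refine le_iInf₂ fun n _ => le_iInf₂ fun w hw => ?_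
    rw [I.level_eq hI, mem_words] at hw
    obtain ⟨f, h1, h0, hf⟩ := hpot n k j w E hk hw hE
    rw [show n + k + j = n + m by omega] at h1 h0 hf
    refine ENNReal.inv_le_inv.2 ((iInf_le_of_le f (iInf_le_of_le ?_ (iInf_le_of_le ?_ ?_))))
    · intro v hv
      rw [mem_subcells_iff I hI n m (by simpa using hw), Finset.mem_singleton] at hv
      exact h1 v hv.1 hv.2
    · intro v hv
      rw [mem_subcells_iff I hI n m fun v hv => (not_nonempty_of_mem_farLevel I hI hw hv).1] at hv
      exact h0 v hv.1 (not_nonempty_of_mem_farLevel I hI hw hv.2).2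
    · rw [I.level_eq hI, energy_eq I hI (n + m) fun v hv => mem_words.1 hv]
      exact ENNReal.ofReal_le_ofReal hf
  by_cases htop : I.resistanceConst m = ∞
  · rw [htop, ENNReal.mul_top (by simpa using hA)]
    exact le_top
  set R := (I.resistanceConst m).toReal with hR
  have hRof : I.resistanceConst m = ENNReal.ofReal R := (ENNReal.ofReal_toReal htop).symm
  have hR0 : 0 ≤ R := ENNReal.toReal_nonneg
  have hw : ∀ k j E, 1 ≤ k → k + j = m → C.HasWeight j E →
      1 ≤ M * (Fintype.card S * C.ratio ^ 2) ^ k * E * R := by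
    intro k j E hk hkj hE
    have h := hres k j E hk hkj hE
    have hE0 := hE.nonneg
    have hr := C.ratio_pos
    rw [ENNReal.inv_le_iff_le_mul (fun h => absurd h htop) (fun h => absurd h ENNReal.ofReal_ne_top), hRof,
      ← ENNReal.ofReal_mul (by positivity)] at h
    exact ENNReal.one_le_ofReal.1 h
  refine iSup₂_le fun n _ => iSup₂_le fun w w' => iSup_le fun hadj => iSup₂_le fun f hf => ?_
  obtain ⟨-, hwn, hwn', hmeet⟩ := (graph_adj_iff I hI n w w').1 hadj
  have hpair : ∀ v ∈ ({w, w'} : Finset (List S)), v.length = n := by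
    intro v hv
    rcases Finset.mem_insert.1 hv with rfl | hv
    · exact hwn
    · rw [Finset.mem_singleton.1 hv]; exact hwn'
  have hmem : ∀ x ∈ ({w, w'} : Finset (List S)), ∀ u ∈ words S m, x ++ u ∈ I.subcells n m {w, w'} := by
    intro x hx u hu
    rw [mem_subcells_iff I hI n m hpair, List.length_append, hpair x hx, mem_words.1 hu]
    refine ⟨rfl, ?_⟩
    rwa [← hpair x hx, List.take_left]
  rw [energy_eq I hI (n + m) fun v hv => ((mem_subcells_iff I hI n m hpair v).1 hv).1] at hf
  have key := hosc m R hm hR0 hw w w' _ f hmeet (hmem w (by simp)) (hmem w' (by simp))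
  rw [hf, mul_one] at key
  rw [hRof, ← ENNReal.ofReal_mul hA.le]
  apply ENNReal.ofReal_le_ofReal
  rw [average_eq I hI n m w hwn, average_eq I hI n m w' hwn', ← mul_sub, ← Finset.sum_sub_distrib]
  have hne : (words S m).Nonempty := ⟨List.replicate m (Classical.arbitrary S), by rw [mem_words]; simp⟩
  have hcard : (0 : ℝ) < (words S m).card := by exact_mod_cast hne.card_pos
  have habs : |∑ u ∈ words S m, (f (w ++ u) - f (w' ++ u))| ≤ (words S m).card * Real.sqrt (A * R) := by
    refine (Finset.abs_sum_le_sum_abs _ _).trans ?_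
    rw [← nsmul_eq_mul]
    exact Finset.sum_le_card_nsmul _ _ _ fun u hu => Real.abs_le_sqrt (key u hu u hu)
  have h2 : |((words S m).card : ℝ)⁻¹ * ∑ u ∈ words S m, (f (w ++ u) - f (w' ++ u))| ≤ Real.sqrt (A * R) := by
    rw [abs_mul, abs_of_pos (inv_pos.2 hcard), inv_mul_le_iff₀ hcard]
    exact habs
  have h3 := sq_le_sq' (abs_le.1 h2).1 (abs_le.1 h2).2
  rwa [Real.sq_sqrt (by positivity)] at h3

end PolygonIFS

end PolygonCarpet

theorem theorem5p3 {N₀ : ℕ} {S : Type*} [Fintype S] (I : PolygonCarpet.PolygonIFS N₀ S)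
    (hI : I.IsPerfectPolygonCarpet) : I.ConditionB :=
  I.conditionB hI
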